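/- **Setting.** Consider a sequence of samples with sample sizes $n\to\infty$ (the numbers $K,L$ of instruments and covariates, all nonrandom quantities, and the probability space may change along the sequence). In each sample, $Z_i\in\mathbb R^K$, $W_i\in\mathbb R^L$ are nonrandom, $Y_i=R_{Yi}+\zeta_i$, $X_i=R_i+\eta_i$ with $R_{Yi}=Z_i'\pi_Y+W_i'\gamma_Y$, $R_i=Z_i'\pi+W_i'\gamma$, where the pairs $(\zeta_i,\eta_i)$ are independent across $i$ with mean zero. Let $G$ be a nonrandom $n\times n$ matrix, $\beta\in\mathbb R$, $e_i(b)=Y_i-X_ib$, $e_i=e_i(\beta)$, $\nu_i=\zeta_i-\eta_i\beta$, $R_{\Delta i}=R_{Yi}-R_i\beta$. Let $Q$ have rows $Q_i'=(Z_i',W_i')$, $M=I-Q(Q'Q)^{-1}Q'$, $D_{ij}=M_{ii}M_{jj}-M_{ij}^2$, $D_{ijk}=M_{ii}D_{jk}-(M_{jj}M_{ik}^2+M_{kk}M_{ij}^2-2M_{jk}M_{ij}M_{ik})$, $\check M_{ik,-ij}=(M_{jj}M_{ik}-M_{ij}M_{jk})/D_{ij}$, $\check M_{il,-ijk}=(M_{il}-M_{ij}\check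 M_{jl,-jk}-M_{ik}\check M_{kl,-jk})/(D_{ijk}/D_{jk})$. Write $R_{mi}$ for either $R_i$ or $R_{\Delta i}$, $\tilde R_{mi}=\sum_{j\ne i}G_{ij}R_{mj}$, and $$r_n=\sum_i\Big(\sum_{j\ne i}G_{ij}R_j\Big)^2+\sum_i\Big(\sum_{j\ne i}G_{ij}R_{\Delta j}\Big)^2+\sum_i\sum_{j\ne i}G_{ij}^2 .$$ Let $V_{LM}=\mathrm{Var}\big(\sum_i\sum_{j\ne i}G_{ij}e_iX_j\big)$ and, for a hypothesized value $\beta_0$, with $e_i$ short for $e_i(\beta_0)$ in the next displays, $\hat\tau_{-ijk}=(\sum_{l\ne i,j,k}Q_lQ_l')^{-1}\sum_{l\ne i,j,k}Q_lX_l$ and $\hat\tau_{\Delta,-ijk}=(\sum_{l\ne i,j,k}Q_lQ_l')^{-1}\sum_{l\ne i,j,k}Q_le_l$, let $\hat V_{LM}=A_1+\dots+A_5$, where $$A_1=\sum_i\sum_{j\ne i}\sum_{k\ne i}G_{ij}X_jG_{ik}X_ke_i(e_i-Q_i'\hat\tau_{\Delta,-ijk}),\qquad A_2=2\sum_i\sum_{j\ne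 i}\sum_{k\ne i}G_{ij}X_jG_{ki}e_ke_i(X_i-Q_i'\hat\tau_{-ijk}),$$ $$A_3=\sum_i\sum_{j\ne i}\sum_{k\ne i}G_{ji}e_jG_{ki}e_kX_i(X_i-Q_i'\hat\tau_{-ijk}),\qquad A_4=-\sum_i\sum_{j\ne i}\sum_{k\ne j}G_{ji}^2X_i\check M_{ik,-ij}X_ke_j(e_j-Q_j'\hat\tau_{\Delta,-ijk}),$$ $$A_5=-\sum_i\sum_{j\ne i}\sum_{k\ne j}G_{ij}G_{ji}e_i\check M_{ik,-ij}X_ke_j(X_j-Q_j'\hat\tau_{-ijk}).$$ **Assumption 1.** (a) $E[\eta_i^4]+E[\nu_i^4]\le C<\infty$ for all $i$ and all samples. (b) $E[\nu_i^2]$ and $E[\eta_i^2]$ are bounded away from $0$ and $|\mathrm{corr}(\nu_i,\eta_i)|$ is bounded away from $1$, uniformly over $i$ and the samples. (c) For any $c_1,c_2,c_3$ not all zero there is $\underline c>0$, not depending on the sample, with $$\tfrac1{r_n}\sum_i\Big(c_3\sum_{j\ne i}(G_{ij}+G_{ji})R_j+c_2\sum_{j\ne i}G_{ji}R_{\Delta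 j}\Big)^2+\tfrac1{r_n}\sum_i\Big(c_1\sum_{j\ne i}(G_{ij}+G_{ji})R_{\Delta j}+c_2\sum_{j\ne i}G_{ij}R_j\Big)^2+\tfrac1{r_n}\mathrm{Var}\Big(\sum_i\sum_{j\ne i}G_{ij}(c_1\nu_i\nu_j+c_2\nu_i\eta_j+c_3\eta_i\eta_j)\Big)\ge\underline c .$$ (d) $\frac1{r_n^2}\sum_i\big((\sum_{j\ne i}G_{ij}R_j)^4+(\sum_{j\ne i}G_{ij}R_{\Delta j})^4+(\sum_{j\ne i}G_{ji}R_j)^4+(\sum_{j\ne i}G_{ji}R_{\Delta j})^4\big)\to0$. (e) $\|\frac1{r_n}G_LG_L'\|_F+\|\frac1{r_n}G_UG_U'\|_F\to0$, where $G_L,G_U$ are the strictly lower and strictly upper triangular parts of $G$. **Assumption 2.** (a) $\sum_{l\ne i,j,k}Q_lQ_l'$ is invertible for all $i,j,k$ (not necessarily distinct) in every sample. (b) $\max_{i\ne j\ne k\ne i}D_{ijk}^{-1}$ is bounded along the sequence. **Assumption 3.** With constants $C<\infty$ not depending on the sample: (a) $\sum_jG_{ij}^2\le C$, $\sum_jG_{ji}^2\le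 C$, $|R_{mi}|\le C$, and each of $\sum_{j\ne k}(\sum_{i\ne j,k}G_{ij}G_{ik})^2$, $\sum_{j\ne k}(\sum_{i\ne j,k}G_{ij}G_{ki})^2$, $\sum_{j\ne k}(\sum_{i\ne j,k}G_{ji}G_{ki})^2$ is at most $C\sum_{j\ne k}G_{jk}^2$. For the remaining parts let $h_p$ ($p=2,3,4$) be any fixed product of factors $G_{ab}$, $\check M_{ab,-ac}$, $\check M_{ab,-acd}$ ($a\neq b$; left-out indices $a,c$, resp. $a,c,d$, distinct), with $a,b,c,d$ among $p$ index labels, each label occurring as the index $a$ or $b$ of some factor; for $p=4$ the labels moreover cannot be split into two pairs such that for every factor $a$ and $b$ are in the same pair. For every such product there is $C$ such that, for both choices of $m$: (b) $\sum_{i\ne j\ne k}\big(\sum_{l\ne i,j,k}h_4(i,j,k,l)R_{ml}\big)^2$, $\sum_{i\ne j}\big(\sum_{k\ne i,j}\sum_{l\ne i,j,k}h_4(i,j,k,l)R_{ml}\big)^2$ and $\sum_i\big(\sum_{j\ne i}\sum_{k\ne i,j}\sum_{l\ne i,j,k}h_4(i,j,k,l)R_{ml}\big)^2$ (outer sums over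 distinct indices) are at most $C\sum_i\tilde R_{mi}^2$; (c) $\sum_{i\ne j}\big(\sum_{k\ne i,j}h_3(i,j,k)R_{mk}\big)^2$ and $\sum_i\big(\sum_{j\ne i}\sum_{k\ne i,j}h_3(i,j,k)R_{mk}\big)^2$ are at most $C\sum_i\tilde R_{mi}^2$; (d) $\sum_i\big(\sum_{j\ne i}h_2(i,j)R_{mj}\big)^2\le C\sum_i\tilde R_{mi}^2$. **Theorem.** If $\beta=\beta_0$ (in every sample) and Assumptions 1–3 hold, then $E[\hat V_{LM}]=V_{LM}$ in every sample, and $\hat V_{LM}/V_{LM}\xrightarrow{p}1$. -/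

import Mathlib

open MeasureTheory ProbabilityTheory Filter Topology

noncomputable section

/-- The hat matrix `H_A = A (A' A)⁻¹ A'`. -/
def hatMatrix {m p : Type*} [Fintype m] [Fintype p] [DecidableEq p]
    (A : Matrix m p ℝ) : Matrix m m ℝ :=
  A * (A.transpose * A)⁻¹ * A.transpose

/-- The Frobenius norm of a real matrix. -/
def frobNorm {m p : Type*} [Fintype m] [Fintype p] (A : Matrix m p ℝ) : ℝ :=
  letI : NormedAddCommGroup (Matrix m p ℝ) := Matrix.frobeniusNormedAddCommGroup
  ‖A‖

/-- The correlation coefficient of two real random variables. -/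
def corr {Ω : Type*} [MeasurableSpace Ω] (P : Measure Ω) (U V : Ω → ℝ) : ℝ :=
  cov[U, V; P] / (√(Var[U; P]) * √(Var[V; P]))

/-- One sample from the linear instrumental variables model with `n` independent observations,
`K` instruments and `L` covariates. Everything is conditional on instruments and covariates, so
these are nonrandom. `G` is an arbitrary nonrandom weighting matrix. -/
structure IVSample (Ω : Type*) [MeasurableSpace Ω] (P : Measure Ω) (n K L : ℕ) where
  /-- instruments, one row per observation -/
  Z : Matrix (Fin n) (Fin K) ℝ
  /-- covariates, one row per observation -/
  W : Matrix (Fin n) (Fin L) ℝ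
  /-- reduced-form coefficients -/
  piY : Fin K → ℝ
  gammaY : Fin L → ℝ
  /-- first-stage coefficients -/
  piX : Fin K → ℝ
  gammaX : Fin L → ℝ
  /-- the estimand -/
  β : ℝ
  /-- the weights -/
  G : Matrix (Fin n) (Fin n) ℝ
  /-- reduced-form errors -/
  ζ : Fin n → Ω → ℝ
  /-- first-stage errors -/
  η : Fin n → Ω → ℝ
  measurable_ζ : ∀ i, Measurable (ζ i)
  measurable_η : ∀ i, Measurable (η i)
  integrable_ζ : ∀ i, Integrable (ζ i) P
  integrable_η : ∀ i, Integrable (η i) P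
  mean_ζ : ∀ i, ∫ ω, ζ i ω ∂P = 0
  mean_η : ∀ i, ∫ ω, η i ω ∂P = 0
  /-- independence across observations -/
  indep : iIndepFun (fun i ω => (ζ i ω, η i ω)) P

namespace IVSample

variable {Ω : Type*} [MeasurableSpace Ω] {P : Measure Ω} {n K L : ℕ}
variable (s : IVSample Ω P n K L)

/-- `R_{Yi} = Z_i' π_Y + W_i' γ_Y`. -/
def RY (i : Fin n) : ℝ := s.Z i ⬝ᵥ s.piY + s.W i ⬝ᵥ s.gammaY

/-- `R_i = Z_i' π + W_i' γ`. -/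
def R (i : Fin n) : ℝ := s.Z i ⬝ᵥ s.piX + s.W i ⬝ᵥ s.gammaX

/-- The outcome `Y_i = R_{Yi} + ζ_i`. -/
def Y (i : Fin n) (ω : Ω) : ℝ := s.RY i + s.ζ i ω

/-- The endogenous variable `X_i = R_i + η_i`. -/
def X (i : Fin n) (ω : Ω) : ℝ := s.R i + s.η i ω

/-- `e_i(b) = Y_i - X_i b`; the error `e_i` is `e_i(β)`. -/
def e (b : ℝ) (i : Fin n) (ω : Ω) : ℝ := s.Y i ω - s.X i ω * b

/-- `R_{Δi} = R_{Yi} - R_i β`. -/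
def RΔ (i : Fin n) : ℝ := s.RY i - s.R i * s.β

/-- `ν_i = ζ_i - η_i β`. -/
def ν (i : Fin n) (ω : Ω) : ℝ := s.ζ i ω - s.η i ω * s.β

/-- `R_{mi}`, which stands for either `R_{Δi}` or `R_i`. -/
def Rm (m : Bool) : Fin n → ℝ := if m then s.RΔ else s.R

/-- `R̃_{mi} = ∑_{j ≠ i} G_{ij} R_{mj}`. -/
def Rtilde (m : Bool) (i : Fin n) : ℝ := ∑ j ∈ {i}ᶜ, s.G i j * s.Rm m j

/-- `r_n`. -/
def r : ℝ :=
  ∑ i, (∑ j ∈ {i}ᶜ, s.G i j * s.R j) ^ 2 + ∑ i, (∑ j ∈ {i}ᶜ, s.G i j * s.RΔ j) ^ 2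
    + ∑ i, ∑ j ∈ {i}ᶜ, s.G i j ^ 2

/-- `G_L`, the strictly lower triangular part of `G`. -/
def Glower : Matrix (Fin n) (Fin n) ℝ := Matrix.of fun i j => if j < i then s.G i j else 0

/-- `G_U`, the strictly upper triangular part of `G`. -/
def Gupper : Matrix (Fin n) (Fin n) ℝ := Matrix.of fun i j => if i < j then s.G i j else 0

/-- `V_LM = Var(∑_i ∑_{j ≠ i} G_{ij} e_i X_j)`. -/
def VLM : ℝ := Var[fun ω => ∑ i, ∑ j ∈ {i}ᶜ, s.G i j * s.e s.β i ω * s.X j ω; P]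

/-- The design matrix `Q = (Z, W)`. -/
def Q : Matrix (Fin n) (Fin K ⊕ Fin L) ℝ := Matrix.fromCols s.Z s.W

/-- The annihilator matrix `M = I - H_Q`. -/
def M : Matrix (Fin n) (Fin n) ℝ := 1 - hatMatrix s.Q

/-- `D_{ij} = M_{ii} M_{jj} - M_{ij}²`. -/
def D2 (i j : Fin n) : ℝ := s.M i i * s.M j j - s.M i j ^ 2

/-- `D_{ijk}`. -/
def D3 (i j k : Fin n) : ℝ :=
  s.M i i * s.D2 j k
    - (s.M j j * s.M i k ^ 2 + s.M k k * s.M i j ^ 2 - 2 * s.M j k * s.M i j * s.M i k)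

/-- `Mc2 i k j` is `M̌_{ik,-ij}`. -/
def Mc2 (i k j : Fin n) : ℝ := (s.M j j * s.M i k - s.M i j * s.M j k) / s.D2 i j

/-- `Mc3 i l j k` is `M̌_{il,-ijk}`. -/
def Mc3 (i l j k : Fin n) : ℝ :=
  (s.M i l - s.M i j * s.Mc2 j l k - s.M i k * s.Mc2 k l j) / (s.D3 i j k / s.D2 j k)

/-- `∑_{l ≠ i,j,k} Q_l Q_l'`. -/
def gram3 (i j k : Fin n) : Matrix (Fin K ⊕ Fin L) (Fin K ⊕ Fin L) ℝ :=
  ∑ l ∈ {i, j, k}ᶜ, Matrix.vecMulVec (s.Q l) (s.Q l)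

/-- Leave-three-out least squares coefficients on `Q` of the variable with values `x`:
`(∑_{l ≠ i,j,k} Q_l Q_l')⁻¹ ∑_{l ≠ i,j,k} Q_l x_l`. -/
def tauHat (x : Fin n → ℝ) (i j k : Fin n) : Fin K ⊕ Fin L → ℝ :=
  (s.gram3 i j k)⁻¹.mulVec (∑ l ∈ {i, j, k}ᶜ, x l • s.Q l)

/-- `X_a - Q_a' τ̂_{-ijk}`. -/
def resX (a i j k : Fin n) (ω : Ω) : ℝ :=
  s.X a ω - s.Q a ⬝ᵥ s.tauHat (fun l => s.X l ω) i j k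

/-- `e_a(b) - Q_a' τ̂_{Δ,-ijk}`, where `τ̂_{Δ,-ijk}` is computed from `e(b)`. -/
def resE (b : ℝ) (a i j k : Fin n) (ω : Ω) : ℝ :=
  s.e b a ω - s.Q a ⬝ᵥ s.tauHat (fun l => s.e b l ω) i j k

def A1 (b : ℝ) (ω : Ω) : ℝ :=
  ∑ i, ∑ j ∈ {i}ᶜ, ∑ k ∈ {i}ᶜ,
    s.G i j * s.X j ω * s.G i k * s.X k ω * s.e b i ω * s.resE b i i j k ω

def A2 (b : ℝ) (ω : Ω) : ℝ :=
  2 * ∑ i, ∑ j ∈ {i}ᶜ, ∑ k ∈ {i}ᶜ,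
    s.G i j * s.X j ω * s.G k i * s.e b k ω * s.e b i ω * s.resX i i j k ω

def A3 (b : ℝ) (ω : Ω) : ℝ :=
  ∑ i, ∑ j ∈ {i}ᶜ, ∑ k ∈ {i}ᶜ,
    s.G j i * s.e b j ω * s.G k i * s.e b k ω * s.X i ω * s.resX i i j k ω

def A4 (b : ℝ) (ω : Ω) : ℝ :=
  -∑ i, ∑ j ∈ {i}ᶜ, ∑ k ∈ {j}ᶜ,
    s.G j i ^ 2 * s.X i ω * s.Mc2 i k j * s.X k ω * s.e b j ω * s.resE b j i j k ω

def A5 (b : ℝ) (ω : Ω) : ℝ :=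
  -∑ i, ∑ j ∈ {i}ᶜ, ∑ k ∈ {j}ᶜ,
    s.G i j * s.G j i * s.e b i ω * s.Mc2 i k j * s.X k ω * s.e b j ω * s.resX j i j k ω

/-- The leave-three-out variance estimator computed with the hypothesized value `b`. -/
def VhatLM (b : ℝ) (ω : Ω) : ℝ := s.A1 b ω + s.A2 b ω + s.A3 b ω + s.A4 b ω + s.A5 b ω

end IVSample

/-- A factor of a monomial in `m` index labels: `G_{ab}`, `M̌_{ab,-ac}` or `M̌_{ab,-acd}`. -/
inductive HFactor (m : ℕ) where
  | G (a b : Fin m)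
  | Mc2 (a b c : Fin m)
  | Mc3 (a b c d : Fin m)

namespace HFactor

variable {m : ℕ}

/-- First index of the factor. -/
def fst : HFactor m → Fin m
  | G a _ => a
  | Mc2 a _ _ => a
  | Mc3 a _ _ _ => a

/-- Second index of the factor. -/
def snd : HFactor m → Fin m
  | G _ b => b
  | Mc2 _ b _ => b
  | Mc3 _ b _ _ => b

/-- The two indices differ, and the left-out observations are distinct. -/
def Valid : HFactor m → Prop
  | G a b => a ≠ b
  | Mc2 a b c => a ≠ b ∧ a ≠ c
  | Mc3 a b c d => a ≠ b ∧ a ≠ c ∧ a ≠ d ∧ c ≠ d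

/-- Value of the factor when the labels are replaced by the observations `v`. -/
def eval {Ω : Type*} [MeasurableSpace Ω] {P : Measure Ω} {n K L : ℕ}
    (s : IVSample Ω P n K L) (v : Fin m → Fin n) : HFactor m → ℝ
  | G a b => s.G (v a) (v b)
  | Mc2 a b c => s.Mc2 (v a) (v b) (v c)
  | Mc3 a b c d => s.Mc3 (v a) (v b) (v c) (v d)

end HFactor

/-- The functions `h_m`: products of any number of factors in which every label occurs
as one of the two indices of some factor (left-out observations do not count). -/
structure HMonomial (m : ℕ) where
  factors : List (HFactor m)
  valid : ∀ f ∈ factors, f.Valid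
  occurs : ∀ a : Fin m, ∃ f ∈ factors, f.fst = a ∨ f.snd = a

namespace HMonomial

variable {m : ℕ}

/-- Value of the product when the labels are replaced by the observations `v`. -/
def eval (h : HMonomial m) {Ω : Type*} [MeasurableSpace Ω] {P : Measure Ω} {n K L : ℕ}
    (s : IVSample Ω P n K L) (v : Fin m → Fin n) : ℝ :=
  (h.factors.map (HFactor.eval s v)).prod

/-- For `h_4`: the labels cannot be partitioned into two pairs such that the product splits into
a product over the first pair times a product over the second pair. -/
def NoSplit (h : HMonomial 4) : Prop :=
  ∀ S : Finset (Fin 4), S.card = 2 → ∃ f ∈ h.factors, ¬ (f.fst ∈ S ↔ f.snd ∈ S)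

end HMonomial

section Assumptions

variable {Ω : ℕ → Type*} [∀ t, MeasurableSpace (Ω t)] {P : ∀ t, Measure (Ω t)} {N K L : ℕ → ℕ}

/-- Moment, nondegeneracy and Lyapunov-type conditions on a sequence of samples. -/
structure MomentAssumption (s : ∀ t, IVSample (Ω t) (P t) (N t) (K t) (L t)) : Prop where
  moments : ∃ C : ℝ, ∀ t i,
    MemLp ((s t).η i) 4 (P t) ∧ MemLp ((s t).ν i) 4 (P t) ∧
      ∫ ω, (s t).η i ω ^ 4 ∂(P t) + ∫ ω, (s t).ν i ω ^ 4 ∂(P t) ≤ C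
  nondegenerate : ∃ c : ℝ, 0 < c ∧ ∀ t i,
    c ≤ ∫ ω, (s t).ν i ω ^ 2 ∂(P t) ∧ c ≤ ∫ ω, (s t).η i ω ^ 2 ∂(P t) ∧
      |corr (P t) ((s t).ν i) ((s t).η i)| ≤ 1 - c
  variance_bound : ∀ c₁ c₂ c₃ : ℝ, ¬ (c₁ = 0 ∧ c₂ = 0 ∧ c₃ = 0) → ∃ c : ℝ, 0 < c ∧ ∀ t,
    c ≤ 1 / (s t).r * ∑ i, (c₃ * ∑ j ∈ {i}ᶜ, ((s t).G i j + (s t).G j i) * (s t).R j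
            + c₂ * ∑ j ∈ {i}ᶜ, (s t).G j i * (s t).RΔ j) ^ 2
        + 1 / (s t).r * ∑ i, (c₁ * ∑ j ∈ {i}ᶜ, ((s t).G i j + (s t).G j i) * (s t).RΔ j
            + c₂ * ∑ j ∈ {i}ᶜ, (s t).G i j * (s t).R j) ^ 2
        + 1 / (s t).r * Var[fun ω => ∑ i, ∑ j ∈ {i}ᶜ, (s t).G i j *
            (c₁ * (s t).ν i ω * (s t).ν j ω + c₂ * (s t).ν i ω * (s t).η j ω
              + c₃ * (s t).η i ω * (s t).η j ω); P t]
  fourth_powers : Tendsto (fun t => 1 / (s t).r ^ 2 * ∑ i,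
      ((∑ j ∈ {i}ᶜ, (s t).G i j * (s t).R j) ^ 4 + (∑ j ∈ {i}ᶜ, (s t).G i j * (s t).RΔ j) ^ 4
        + (∑ j ∈ {i}ᶜ, (s t).G j i * (s t).R j) ^ 4
        + (∑ j ∈ {i}ᶜ, (s t).G j i * (s t).RΔ j) ^ 4)) atTop (𝓝 0)
  frobenius : Tendsto (fun t =>
      frobNorm ((1 / (s t).r) • ((s t).Glower * (s t).Glower.transpose))
        + frobNorm ((1 / (s t).r) • ((s t).Gupper * (s t).Gupper.transpose))) atTop (𝓝 0)

/-- The leave-three-out designs are invertible, and `D_{ijk}⁻¹` is bounded. -/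
structure LeaveThreeOutAssumption (s : ∀ t, IVSample (Ω t) (P t) (N t) (K t) (L t)) : Prop where
  invertible : ∀ t i j k, IsUnit ((s t).gram3 i j k)
  bounded : ∃ C : ℝ, ∀ t i j k, i ≠ j → j ≠ k → k ≠ i → ((s t).D3 i j k)⁻¹ ≤ C

/-- Regularity (approximate sparsity) conditions. All bounds are uniform along the sequence; for
the conditions on the products `h_2`, `h_3`, `h_4`, the constant may depend on the product. -/
structure SparsityAssumption (s : ∀ t, IVSample (Ω t) (P t) (N t) (K t) (L t)) : Prop where
  row_sums : ∃ C : ℝ, ∀ t i, ∑ j, (s t).G i j ^ 2 ≤ C ∧ ∑ j, (s t).G j i ^ 2 ≤ C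
  cross_sums : ∃ C : ℝ, ∀ t,
    ∑ j, ∑ k ∈ {j}ᶜ, (∑ i ∈ {j, k}ᶜ, (s t).G i j * (s t).G i k) ^ 2
        ≤ C * ∑ j, ∑ k ∈ {j}ᶜ, (s t).G j k ^ 2 ∧
    ∑ j, ∑ k ∈ {j}ᶜ, (∑ i ∈ {j, k}ᶜ, (s t).G i j * (s t).G k i) ^ 2
        ≤ C * ∑ j, ∑ k ∈ {j}ᶜ, (s t).G j k ^ 2 ∧
    ∑ j, ∑ k ∈ {j}ᶜ, (∑ i ∈ {j, k}ᶜ, (s t).G j i * (s t).G k i) ^ 2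
        ≤ C * ∑ j, ∑ k ∈ {j}ᶜ, (s t).G j k ^ 2
  bounded_R : ∃ C : ℝ, ∀ t m i, |(s t).Rm m i| ≤ C
  four : ∀ h : HMonomial 4, h.NoSplit → ∃ C : ℝ, ∀ t m,
    ∑ i, ∑ j ∈ {i}ᶜ, ∑ k ∈ {i, j}ᶜ,
        (∑ l ∈ {i, j, k}ᶜ, h.eval (s t) ![i, j, k, l] * (s t).Rm m l) ^ 2
      ≤ C * ∑ i, (s t).Rtilde m i ^ 2 ∧
    ∑ i, ∑ j ∈ {i}ᶜ,
        (∑ k ∈ {i, j}ᶜ, ∑ l ∈ {i, j, k}ᶜ, h.eval (s t) ![i, j, k, l] * (s t).Rm m l) ^ 2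
      ≤ C * ∑ i, (s t).Rtilde m i ^ 2 ∧
    ∑ i, (∑ j ∈ {i}ᶜ, ∑ k ∈ {i, j}ᶜ, ∑ l ∈ {i, j, k}ᶜ,
        h.eval (s t) ![i, j, k, l] * (s t).Rm m l) ^ 2
      ≤ C * ∑ i, (s t).Rtilde m i ^ 2
  three : ∀ h : HMonomial 3, ∃ C : ℝ, ∀ t m,
    ∑ i, ∑ j ∈ {i}ᶜ, (∑ k ∈ {i, j}ᶜ, h.eval (s t) ![i, j, k] * (s t).Rm m k) ^ 2
      ≤ C * ∑ i, (s t).Rtilde m i ^ 2 ∧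
    ∑ i, (∑ j ∈ {i}ᶜ, ∑ k ∈ {i, j}ᶜ, h.eval (s t) ![i, j, k] * (s t).Rm m k) ^ 2
      ≤ C * ∑ i, (s t).Rtilde m i ^ 2
  two : ∀ h : HMonomial 2, ∃ C : ℝ, ∀ t m,
    ∑ i, (∑ j ∈ {i}ᶜ, h.eval (s t) ![i, j] * (s t).Rm m j) ^ 2
      ≤ C * ∑ i, (s t).Rtilde m i ^ 2

end Assumptions

end

/-!
# Consistency of the leave-three-out variance estimator

Leave-three-out residuals of a variable `x_l = Q_l' θ + τ_l` are `τ_i + ∑_l w_l τ_l` with weights `w`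
that vanish on the observations left out (`residual_eq`): the part linear in `Q` drops out because
`M Q = 0`. Hence each of the five sums of the estimator, a `leaveOutForm` or a `doubleOutForm`, splits
into polynomial forms in the independent observations without coinciding indices. The terms
with a residual error `τ_l`, for `l` an index of its own, have mean zero. The means of the others add
up to `linVar + quadVar`, the sum of the variances of the linear and of the quadratic part of the
statistic in its Hoeffding decomposition, which is `V_LM` (`VLM_eq`). This is unbiasedness.

The variances of all these forms are bounded by decoupling. A form without coinciding indices and with
a centred slot has, up to constants, at most the second moment that results when its other slots are
replaced by their means plus multiples of independent random signs
(`integral_sq_chaos_le_signAvg`). The deterministic problem that remains is to bound the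
coefficients contracted with bounded vectors (`quartic_coef_bound`, `cubic_coef_bound`,
`double_loo_coef_bound`). The weights are combinations of rows of the contraction `M`, with
coefficients bounded through the lower bound `δ` on the determinants `D_{ijk}`. The expansion
`Mc3_expand` puts an entry of `M` next to every dependence of the weights on `j` and on `k`, so that
no sum over these indices is lost to the triangle inequality.

The outcome is that the variance of the estimator is at most a constant times `errorBound`, that is
`‖G G'‖_F² + ∑_i (x_i⁴ + y_i⁴) + ‖G G'‖_F ∑_i (x_i² + y_i²)`, where `G` has its diagonal removed,
`x = G R` are the row sums and `y = G' R_Δ` the column sums (`centredL2_VhatLM`). The sum of the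
fourth powers is of smaller order than `r²` by assumption, `‖G G'‖_F` is controlled by the triangular
parts of `G`, the squared row sums are part of `r`, and the squared column sums of `R_Δ` are of order
`r` by the condition on products of two labels, for the single factor `G_{ba}`
(`exists_sum_sq_colE_le`). So the variance is of smaller order than `r²`, while the nondegeneracy
condition with coefficients `(0, 1, 0)` gives `V_LM ≥ c r` (`VLM_ge`), and Chebyshev's inequality
concludes.
-/

noncomputable section

/-! ### Products of independent observations -/

section Chaos

variable {Ω N : Type*} [mΩ : MeasurableSpace Ω]

/-- The `σ`-algebra generated by the observations with index in `T`. -/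
abbrev sigmaOn (m : N → MeasurableSpace Ω) (T : Set N) : MeasurableSpace Ω := ⨆ i ∈ T, m i

/-- A family of random variables whose `i`-th member depends only on the `i`-th observation and
whose second moments are at most `κ²`. -/
structure Slot (m : N → MeasurableSpace Ω) (P : Measure Ω) (κ : ℝ) (F : N → Ω → ℝ) : Prop where
  meas : ∀ i, Measurable[m i] (F i)
  memLp : ∀ i, MemLp (F i) 2 P
  sq_le : ∀ i, ∫ ω, F i ω ^ 2 ∂P ≤ κ ^ 2

variable {m : N → MeasurableSpace Ω} {P : Measure Ω}

omit mΩ in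
lemma measurable_sigmaOn {F : N → Ω → ℝ} (hF : ∀ i, Measurable[m i] (F i)) {T : Set N} {i : N}
    (hi : i ∈ T) : Measurable[sigmaOn m T] (F i) :=
  (hF i).mono (le_iSup₂_of_le i hi le_rfl) le_rfl

lemma indepFun_of_disjoint (hm : ∀ i, m i ≤ mΩ) (hI : iIndep m P) {S T : Set N}
    (hST : Disjoint S T) {Y Z : Ω → ℝ} (hY : Measurable[sigmaOn m S] Y)
    (hZ : Measurable[sigmaOn m T] Z) : IndepFun Y Z P := by
  rw [IndepFun_iff_Indep]
  exact indep_of_indep_of_le_left (indep_of_indep_of_le_right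
    (indep_iSup_of_disjoint hm hI hST) hZ.comap_le) hY.comap_le

lemma sigmaOn_le (hm : ∀ i, m i ≤ mΩ) (T : Set N) : sigmaOn m T ≤ mΩ := iSup₂_le fun i _ => hm i

lemma integral_mul_of_disjoint (hm : ∀ i, m i ≤ mΩ) (hI : iIndep m P) {S T : Set N}
    (hST : Disjoint S T) {Y Z : Ω → ℝ} (hY : Measurable[sigmaOn m S] Y)
    (hZ : Measurable[sigmaOn m T] Z) : ∫ ω, Y ω * Z ω ∂P = (∫ ω, Y ω ∂P) * ∫ ω, Z ω ∂P :=
  (indepFun_of_disjoint hm hI hST hY hZ).integral_fun_mul_eq_mul_integral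
    (hY.mono (sigmaOn_le hm _) le_rfl).aestronglyMeasurable
    (hZ.mono (sigmaOn_le hm _) le_rfl).aestronglyMeasurable

lemma memLp_two_mul_of_disjoint (hm : ∀ i, m i ≤ mΩ) (hI : iIndep m P) {S T : Set N}
    (hST : Disjoint S T) {Y Z : Ω → ℝ} (hY : Measurable[sigmaOn m S] Y)
    (hZ : Measurable[sigmaOn m T] Z) (hY2 : MemLp Y 2 P) (hZ2 : MemLp Z 2 P) :
    MemLp (fun ω => Y ω * Z ω) 2 P := by
  have hYm := (hY.mono (sigmaOn_le hm _) le_rfl)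
  have hZm := (hZ.mono (sigmaOn_le hm _) le_rfl)
  rw [memLp_two_iff_integrable_sq (Measurable.aestronglyMeasurable (by fun_prop))]
  have := (indepFun_of_disjoint hm hI hST (hY.pow_const 2) (hZ.pow_const 2)).integrable_mul
    hY2.integrable_sq hZ2.integrable_sq
  refine this.congr (Eventually.of_forall fun ω => ?_)
  simp [mul_pow]

variable {ι : Type*}

omit mΩ in
lemma measurable_prod_slots {F : ι → N → Ω → ℝ} (hF : ∀ q i, Measurable[m i] (F q i))
    (v : ι → N) (Q : Finset ι) (T : Set N) (hT : ∀ q ∈ Q, v q ∈ T) :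
    Measurable[sigmaOn m T] (fun ω => ∏ q ∈ Q, F q (v q) ω) :=
  Finset.measurable_fun_prod Q fun q hq => measurable_sigmaOn (hF q) (hT q hq)

lemma prod_slots_sq [IsProbabilityMeasure P] (hm : ∀ i, m i ≤ mΩ) (hI : iIndep m P) {κ : ℝ}
    {F : ι → N → Ω → ℝ} (hF : ∀ q, Slot m P κ (F q)) {v : ι → N} (hv : Function.Injective v)
    (Q : Finset ι) :
    MemLp (fun ω => ∏ q ∈ Q, F q (v q) ω) 2 P ∧
      ∫ ω, (∏ q ∈ Q, F q (v q) ω) ^ 2 ∂P ≤ κ ^ (2 * Q.card) := by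
  classical
  induction Q using Finset.induction_on with
  | empty => simp [memLp_const]
  | insert q Q hq ih =>
    have hd : Disjoint ({v q} : Set N) (v '' (Q : Set ι)) := by
      rw [Set.disjoint_singleton_left]
      rintro ⟨q', hq', h⟩
      exact hq (hv h ▸ hq')
    have h1 : Measurable[sigmaOn m {v q}] (F q (v q)) :=
      measurable_sigmaOn (hF q).meas rfl
    have h2 : Measurable[sigmaOn m (v '' (Q : Set ι))] (fun ω => ∏ q ∈ Q, F q (v q) ω) :=
      measurable_prod_slots (fun q => (hF q).meas) v Q _ fun q hq => ⟨q, hq, rfl⟩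
    simp only [Finset.prod_insert hq, mul_pow]
    refine ⟨memLp_two_mul_of_disjoint hm hI hd h1 h2 ((hF q).memLp _) ih.1, ?_⟩
    rw [integral_mul_of_disjoint hm hI hd (h1.pow_const 2) (h2.pow_const 2),
      Finset.card_insert_of_notMem hq, mul_add, pow_add, mul_comm]
    exact mul_le_mul ih.2 (by simpa using (hF q).sq_le (v q))
      (integral_nonneg fun _ => sq_nonneg _) (by rw [pow_mul]; positivity)

/-- Products of centred slots over different sets of observations are orthogonal. -/
lemma integral_prod_slots_eq_zero [Fintype ι] (hm : ∀ i, m i ≤ mΩ) (hI : iIndep m P)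
    {F : ι → N → Ω → ℝ} (hF : ∀ q i, Measurable[m i] (F q i))
    (h0 : ∀ q i, ∫ ω, F q i ω ∂P = 0) {v w : ι → N} (hv : Function.Injective v)
    {q₀ : ι} (hq : ∀ q, w q ≠ v q₀) :
    ∫ ω, (∏ q, F q (v q) ω) * ∏ q, F q (w q) ω ∂P = 0 := by
  classical
  have h2 : Measurable[sigmaOn m {v q₀}ᶜ] fun ω =>
      (∏ q ∈ Finset.univ.erase q₀, F q (v q) ω) * ∏ q, F q (w q) ω :=
    (measurable_prod_slots hF v _ {v q₀}ᶜ fun _ hq h => (Finset.ne_of_mem_erase hq) (hv h)).mul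
      (measurable_prod_slots hF w _ {v q₀}ᶜ fun q _ => hq q)
  have := integral_mul_of_disjoint hm hI (disjoint_compl_right (a := ({v q₀} : Set N)))
    (measurable_sigmaOn (hF q₀) rfl) h2
  rw [h0, zero_mul] at this
  rw [← this]
  congr 1 with ω
  rw [← mul_assoc, Finset.mul_prod_erase _ (fun q => F q (v q) ω) (Finset.mem_univ q₀)]

lemma image_eq_of_subset [Fintype ι] [DecidableEq N] {v w : ι → N} (hv : Function.Injective v)
    (hw : Function.Injective w) (h : ∀ q, ∃ q', w q' = v q) :
    Finset.univ.image v = Finset.univ.image w := by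
  refine Finset.eq_of_subset_of_card_le ?_ ?_
  · intro i hi
    obtain ⟨q, -, rfl⟩ := Finset.mem_image.1 hi
    obtain ⟨q', h⟩ := h q
    exact Finset.mem_image.2 ⟨q', Finset.mem_univ _, h⟩
  · rw [Finset.card_image_of_injective _ hv, Finset.card_image_of_injective _ hw]

/-- Second moment of a homogeneous chaos in centred slots without coinciding indices. -/
lemma integral_sq_chaos_le [Fintype ι] [DecidableEq ι] [Fintype N] [IsProbabilityMeasure P]
    (hm : ∀ i, m i ≤ mΩ) (hI : iIndep m P) {κ : ℝ} {F : ι → N → Ω → ℝ}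
    (hF : ∀ q, Slot m P κ (F q)) (h0 : ∀ q i, ∫ ω, F q i ω ∂P = 0) {d : (ι → N) → ℝ}
    (hd : ∀ v, ¬ Function.Injective v → d v = 0) :
    ∫ ω, (∑ v, d v * ∏ q, F q (v q) ω) ^ 2 ∂P
      ≤ (Fintype.card ι : ℝ) ^ Fintype.card ι * κ ^ (2 * Fintype.card ι) * ∑ v, d v ^ 2 := by
  classical
  set p := Fintype.card ι with hp
  have hκ : 0 ≤ κ ^ (2 * p) := by rw [pow_mul]; positivity
  have hint : ∀ v w, Integrable (fun ω =>
      d v * d w * ((∏ q, F q (v q) ω) * ∏ q, F q (w q) ω)) P := by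
    intro v w
    by_cases hv : Function.Injective v
    · by_cases hw : Function.Injective w
      · exact ((prod_slots_sq hm hI hF hv Finset.univ).1.integrable_mul
          (prod_slots_sq hm hI hF hw Finset.univ).1).const_mul _
      · simp [hd w hw]
    · simp [hd v hv]
  -- products over different sets of observations are orthogonal
  have hcov : ∀ v w, ∫ ω, d v * d w * ((∏ q, F q (v q) ω) * ∏ q, F q (w q) ω) ∂P
      ≤ if Finset.univ.image v = Finset.univ.image w then
          κ ^ (2 * p) * ((d v ^ 2 + d w ^ 2) / 2) else 0 := by
    intro v w
    by_cases hv : Function.Injective v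
    swap
    · simp only [hd v hv, zero_mul, integral_zero]
      split_ifs <;> positivity
    by_cases hw : Function.Injective w
    swap
    · simp only [hd w hw, mul_zero, zero_mul, integral_zero]
      split_ifs <;> positivity
    rw [integral_const_mul]
    split_ifs with h
    · have hA := prod_slots_sq hm hI hF hv Finset.univ
      have hB := prod_slots_sq hm hI hF hw Finset.univ
      rw [Finset.card_univ, ← hp] at hA hB
      have hAB : |∫ ω, (∏ q, F q (v q) ω) * ∏ q, F q (w q) ω ∂P| ≤ κ ^ (2 * p) := by
        refine (abs_integral_le_integral_abs).trans ?_
        have : ∫ ω, |(∏ q, F q (v q) ω) * ∏ q, F q (w q) ω| ∂P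
            ≤ ∫ ω, ((∏ q, F q (v q) ω) ^ 2 / 2 + (∏ q, F q (w q) ω) ^ 2 / 2) ∂P := by
          refine integral_mono (hA.1.integrable_mul hB.1).abs
            ((hA.1.integrable_sq.div_const 2).add (hB.1.integrable_sq.div_const 2)) fun ω => ?_
          simp only [abs_mul]
          have := two_mul_le_add_sq |∏ q, F q (v q) ω| |∏ q, F q (w q) ω|
          simp only [sq_abs] at this
          linarith
        rw [integral_add (hA.1.integrable_sq.div_const 2) (hB.1.integrable_sq.div_const 2),
          integral_div, integral_div] at this
        linarith [hA.2, hB.2]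
      have h3 : |d v * d w| ≤ (d v ^ 2 + d w ^ 2) / 2 := by
        rw [abs_mul]
        have := two_mul_le_add_sq |d v| |d w|
        simp only [sq_abs] at this
        linarith
      calc _ ≤ |d v * d w * ∫ ω, (∏ q, F q (v q) ω) * ∏ q, F q (w q) ω ∂P| := le_abs_self _
        _ = |d v * d w| * |∫ ω, (∏ q, F q (v q) ω) * ∏ q, F q (w q) ω ∂P| := abs_mul _ _
        _ ≤ (d v ^ 2 + d w ^ 2) / 2 * κ ^ (2 * p) :=
          mul_le_mul h3 hAB (abs_nonneg _) (by positivity)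
        _ = _ := mul_comm _ _
    · have : ∃ q₀, ∀ q, w q ≠ v q₀ := by
        by_contra! hc
        exact h (image_eq_of_subset hv hw hc)
      obtain ⟨q₀, hq⟩ := this
      rw [integral_prod_slots_eq_zero hm hI (fun q => (hF q).meas) h0 hv hq, mul_zero]
  -- a set of observations is the image of at most `p ^ p` index tuples
  have hcard : ∀ v : ι → N, ((Finset.univ.filter fun w : ι → N =>
      Finset.univ.image v = Finset.univ.image w).card : ℝ) ≤ (p : ℝ) ^ p := by
    intro v
    have h1 : (Finset.univ.filter fun w : ι → N => Finset.univ.image v = Finset.univ.image w)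
        ⊆ Fintype.piFinset fun _ : ι => Finset.univ.image v := by
      intro w hw
      rw [Finset.mem_filter] at hw
      rw [Fintype.mem_piFinset]
      intro q
      rw [hw.2]
      exact Finset.mem_image_of_mem _ (Finset.mem_univ _)
    have h2 := Finset.card_le_card h1
    rw [Fintype.card_piFinset, Finset.prod_const, Finset.card_univ] at h2
    calc ((Finset.univ.filter fun w : ι → N =>
          Finset.univ.image v = Finset.univ.image w).card : ℝ)
        ≤ (((Finset.univ.image v).card ^ Fintype.card ι : ℕ) : ℝ) := by exact_mod_cast h2
      _ ≤ _ := by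
        push_cast
        gcongr
        exact_mod_cast Finset.card_image_le
  have hexp : ∀ ω, (∑ v, d v * ∏ q, F q (v q) ω) ^ 2
      = ∑ v, ∑ w, d v * d w * ((∏ q, F q (v q) ω) * ∏ q, F q (w q) ω) := by
    intro ω
    rw [sq, Finset.sum_mul_sum]
    refine Finset.sum_congr rfl fun v _ => Finset.sum_congr rfl fun w _ => by ring
  simp_rw [hexp]
  rw [integral_finsetSum _ fun v _ => integrable_finsetSum _ fun w _ => hint v w]
  simp_rw [integral_finsetSum _ fun w _ => hint _ w]
  calc _ ≤ ∑ v, ∑ w, (if Finset.univ.image v = Finset.univ.image w then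
          κ ^ (2 * p) * ((d v ^ 2 + d w ^ 2) / 2) else 0) :=
        Finset.sum_le_sum fun v _ => Finset.sum_le_sum fun w _ => hcov v w
    _ = κ ^ (2 * p) * ∑ v, ∑ w, (if Finset.univ.image v = Finset.univ.image w then
          d v ^ 2 else 0) := by
        have hsym : ∑ v : ι → N, ∑ w : ι → N,
            (if Finset.univ.image v = Finset.univ.image w then d w ^ 2 else 0)
            = ∑ v : ι → N, ∑ w : ι → N,
            (if Finset.univ.image v = Finset.univ.image w then d v ^ 2 else 0) := by
          rw [Finset.sum_comm]
          simp_rw [eq_comm]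
        have : ∀ v w : ι → N, (if Finset.univ.image v = Finset.univ.image w then
            κ ^ (2 * p) * ((d v ^ 2 + d w ^ 2) / 2) else 0)
            = κ ^ (2 * p) / 2 * (if Finset.univ.image v = Finset.univ.image w then d v ^ 2 else 0)
            + κ ^ (2 * p) / 2 *
              (if Finset.univ.image v = Finset.univ.image w then d w ^ 2 else 0) := by
          intro v w
          split_ifs <;> ring
        simp_rw [this, Finset.sum_add_distrib, ← Finset.mul_sum]
        rw [hsym]
        ring
    _ ≤ κ ^ (2 * p) * ∑ v, (p : ℝ) ^ p * d v ^ 2 := by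
        gcongr with v
        rw [← Finset.sum_filter, Finset.sum_const, nsmul_eq_mul]
        gcongr
        exact hcard v
    _ = _ := by rw [← Finset.mul_sum]; ring

lemma integral_sub_const_sq [IsProbabilityMeasure P] {Y : Ω → ℝ} (hY : MemLp Y 2 P) (c : ℝ) :
    ∫ ω, (Y ω - c) ^ 2 ∂P = ∫ ω, Y ω ^ 2 ∂P - 2 * c * (∫ ω, Y ω ∂P) + c ^ 2 := by
  have h1 : Integrable (fun ω => 2 * c * Y ω) P := (hY.integrable (by norm_num)).const_mul _
  have h2 : Integrable (fun ω => Y ω ^ 2) P := hY.integrable_sq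
  have e : ∀ ω, (Y ω - c) ^ 2 = (Y ω ^ 2 - 2 * c * Y ω) + c ^ 2 := fun ω => by ring
  simp_rw [e]
  rw [integral_add (f := fun ω => Y ω ^ 2 - 2 * c * Y ω) (h2.sub h1) (integrable_const _),
    integral_sub h2 h1, integral_const_mul]
  simp

lemma Slot.sub_mean [IsProbabilityMeasure P] {κ : ℝ} {F : N → Ω → ℝ} (hF : Slot m P κ F) :
    Slot m P κ fun i ω => F i ω - ∫ ω', F i ω' ∂P where
  meas i := (hF.meas i).sub_const _
  memLp i := (hF.memLp i).sub (memLp_const _)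
  sq_le i := by
    rw [integral_sub_const_sq (hF.memLp i)]
    nlinarith [hF.sq_le i, sq_nonneg (∫ ω, F i ω ∂P)]

lemma integral_sub_mean [IsProbabilityMeasure P] {Y : Ω → ℝ} (hY : Integrable Y P) :
    ∫ ω, (Y ω - ∫ ω', Y ω' ∂P) ∂P = 0 := by
  rw [integral_sub hY (integrable_const _)]
  simp

lemma Slot.integrable [IsProbabilityMeasure P] {κ : ℝ} {F : N → Ω → ℝ} (hF : Slot m P κ F)
    (i : N) : Integrable (F i) P := (hF.memLp i).integrable (by norm_num)

lemma Slot.sq_mean_le [IsProbabilityMeasure P] {κ : ℝ} {F : N → Ω → ℝ} (hF : Slot m P κ F)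
    (i : N) : (∫ ω, F i ω ∂P) ^ 2 ≤ κ ^ 2 := by
  have : 0 ≤ ∫ ω, (F i ω - ∫ ω', F i ω' ∂P) ^ 2 ∂P := integral_nonneg fun _ => sq_nonneg _
  rw [integral_sub_const_sq (hF.memLp i)] at this
  nlinarith [hF.sq_le i]

end Chaos

/-! ### Decoupling -/

section Decoupling

open scoped BigOperators

/-- The sign encoded by a Boolean. -/
def signOf (b : Bool) : ℝ := if b then 1 else -1

lemma signOf_not (b : Bool) : signOf (!b) = -signOf b := by cases b <;> simp [signOf]

lemma signOf_mul_self (b : Bool) : signOf b * signOf b = 1 := by cases b <;> simp [signOf]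

lemma abs_signOf (b : Bool) : |signOf b| = 1 := by cases b <;> simp [signOf]

variable {N : Type*} [Fintype N] [DecidableEq N]

/-- Flipping the `i`-th sign. -/
def flipAt (i : N) : (N → Bool) ≃ (N → Bool) where
  toFun ε := Function.update ε i (!ε i)
  invFun ε := Function.update ε i (!ε i)
  left_inv ε := by simp
  right_inv ε := by simp

lemma expect_signOf (i : N) : 𝔼 ε : N → Bool, signOf (ε i) = 0 := by
  have h := Fintype.expect_equiv (flipAt i) (fun ε => -signOf (ε i)) (fun ε => signOf (ε i))
    (fun ε => by simp [flipAt, signOf_not])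
  rw [Finset.expect_neg_distrib] at h
  linarith

lemma expect_signOf_mul (i j : N) :
    𝔼 ε : N → Bool, signOf (ε i) * signOf (ε j) = if i = j then 1 else 0 := by
  split_ifs with hij
  · subst hij
    simp_rw [signOf_mul_self]
    exact Fintype.expect_const _
  · have h := Fintype.expect_equiv (flipAt i) (fun ε => -(signOf (ε i) * signOf (ε j)))
      (fun ε => signOf (ε i) * signOf (ε j))
      (fun ε => by simp [flipAt, signOf_not, Function.update_of_ne (Ne.symm hij)])
    rw [Finset.expect_neg_distrib] at h
    linarith

/-- Second moment of a linear form in `μ + κ ε` for independent signs `ε`. -/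
lemma expect_sq_sum (μ x : N → ℝ) (κ : ℝ) :
    𝔼 ε : N → Bool, (∑ i, (μ i + κ * signOf (ε i)) * x i) ^ 2
      = (∑ i, μ i * x i) ^ 2 + κ ^ 2 * ∑ i, x i ^ 2 := by
  have e : ∀ ε : N → Bool, (∑ i, (μ i + κ * signOf (ε i)) * x i) ^ 2
      = (∑ i, μ i * x i) ^ 2 + 2 * (∑ i, μ i * x i) * κ * (∑ i, x i * signOf (ε i))
        + κ ^ 2 * ∑ i, ∑ j, x i * x j * (signOf (ε i) * signOf (ε j)) := by
    intro ε
    have h1 : ∑ i, (μ i + κ * signOf (ε i)) * x i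
        = ∑ i, μ i * x i + κ * ∑ i, x i * signOf (ε i) := by
      rw [Finset.mul_sum, ← Finset.sum_add_distrib]
      exact Finset.sum_congr rfl fun i _ => by ring
    have h2 : ∑ i, ∑ j, x i * x j * (signOf (ε i) * signOf (ε j))
        = (∑ i, x i * signOf (ε i)) ^ 2 := by
      rw [sq, Finset.sum_mul_sum]
      exact Finset.sum_congr rfl fun i _ => Finset.sum_congr rfl fun j _ => by ring
    rw [h1, h2]
    ring
  simp_rw [e]
  rw [Finset.expect_add_distrib, Finset.expect_add_distrib, ← Finset.mul_expect,
    ← Finset.mul_expect, Finset.expect_sum_comm]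
  simp_rw [Finset.expect_sum_comm, ← Finset.mul_expect, expect_signOf, expect_signOf_mul]
  simp [sq]

/-- Average over independent signs `ε` of the sum over `w` of the squares of
`∑ v, c v w * ∏ q, (μ q (v q) + κ * ε q (v q))`. -/
def signAvg (κ : ℝ) : (p : ℕ) → (Fin p → N → ℝ) → {W : Type*} → [Fintype W] →
    ((Fin p → N) → W → ℝ) → ℝ
  | 0, _, _, _, c => ∑ w, c Fin.elim0 w ^ 2
  | p + 1, μ, _, _, c => 𝔼 ε : N → Bool, signAvg κ p (Fin.tail μ)
      fun v w => ∑ i, (μ 0 i + κ * signOf (ε i)) * c (Fin.cons i v) w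

lemma signAvg_equiv (κ : ℝ) {W W' : Type*} [Fintype W] [Fintype W'] (e : W ≃ W') (p : ℕ)
    (μ : Fin p → N → ℝ) (c : (Fin p → N) → W' → ℝ) :
    signAvg κ p μ (fun v w => c v (e w)) = signAvg κ p μ c := by
  induction p with
  | zero => exact Fintype.sum_equiv e _ _ fun _ => rfl
  | succ p ih =>
    simp only [signAvg]
    exact Finset.expect_congr rfl fun ε _ => ih _ fun v w =>
      ∑ i, (μ 0 i + κ * signOf (ε i)) * c (Fin.cons i v) w

lemma expect_signAvg (κ : ℝ) (p : ℕ) (ν : N → ℝ) (μ : Fin p → N → ℝ) {W : Type*} [Fintype W]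
    (c : N → (Fin p → N) → W → ℝ) :
    𝔼 ε : N → Bool, signAvg κ p μ (fun v w => ∑ i, (ν i + κ * signOf (ε i)) * c i v w)
      = signAvg κ p μ (fun v w => ∑ i, ν i * c i v w)
        + κ ^ 2 * signAvg κ p μ (fun v (w : N × W) => c w.1 v w.2) := by
  induction p generalizing W with
  | zero =>
    simp only [signAvg]
    rw [Finset.expect_sum_comm]
    simp_rw [expect_sq_sum]
    rw [Finset.sum_add_distrib, ← Finset.mul_sum, Fintype.sum_prod_type, Finset.sum_comm]
  | succ p ih =>
    simp only [signAvg]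
    rw [Finset.expect_comm, Finset.mul_expect, ← Finset.expect_add_distrib]
    refine Finset.expect_congr rfl fun ε' _ => ?_
    have := ih (Fin.tail μ) fun i v w =>
      ∑ j, (μ 0 j + κ * signOf (ε' j)) * c i (Fin.cons j v) w
    have key : ∀ x : N → ℝ,
        (fun (v : Fin p → N) (w : W) => ∑ i, (μ 0 i + κ * signOf (ε' i)) *
          ∑ j, x j * c j (Fin.cons i v) w)
        = fun v w => ∑ j, x j * ∑ i, (μ 0 i + κ * signOf (ε' i)) * c j (Fin.cons i v) w := by
      intro x
      funext v w
      simp_rw [Finset.mul_sum]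
      rw [Finset.sum_comm]
      exact Finset.sum_congr rfl fun j _ => Finset.sum_congr rfl fun i _ => by ring
    simp_rw [key]
    exact this

lemma signAvg_nonneg (κ : ℝ) (p : ℕ) (μ : Fin p → N → ℝ) {W : Type*} [Fintype W]
    (c : (Fin p → N) → W → ℝ) : 0 ≤ signAvg κ p μ c := by
  induction p with
  | zero => exact Finset.sum_nonneg fun _ _ => sq_nonneg _
  | succ p ih => exact Finset.expect_nonneg fun ε _ => ih _ _

variable {Ω : Type*} [mΩ : MeasurableSpace Ω] {m : N → MeasurableSpace Ω} {P : Measure Ω}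

/-- The chaos with coefficients `c` in the slots `F` and `φ`. -/
def chaos {p k : ℕ} (F : Fin p → N → Ω → ℝ) (φ : Fin k → N → Ω → ℝ)
    (c : (Fin p → N) → (Fin k → N) → ℝ) (ω : Ω) : ℝ :=
  ∑ v, ∑ w, c v w * ((∏ q, F q (v q) ω) * ∏ q, φ q (w q) ω)

lemma memLp_chaos [IsProbabilityMeasure P] (hm : ∀ i, m i ≤ mΩ) (hI : iIndep m P) {κ : ℝ}
    {p k : ℕ} {F : Fin p → N → Ω → ℝ} {φ : Fin k → N → Ω → ℝ} (hF : ∀ q, Slot m P κ (F q))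
    (hφ : ∀ q, Slot m P κ (φ q)) {c : (Fin p → N) → (Fin k → N) → ℝ}
    (hc : ∀ v w, ¬ Function.Injective (Sum.elim v w) → c v w = 0) :
    MemLp (chaos F φ c) 2 P := by
  unfold chaos
  refine memLp_finsetSum _ fun v _ => memLp_finsetSum _ fun w _ => ?_
  by_cases h : Function.Injective (Sum.elim v w)
  · have := (prod_slots_sq hm hI (F := Sum.elim F φ) (κ := κ)
      (by rintro (q | q) <;> simp [hF, hφ]) h Finset.univ).1
    simp only [Fintype.prod_sum_type, Sum.elim_inl, Sum.elim_inr] at this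
    exact this.const_mul _
  · simp [hc v w h]

lemma sum_fin_succ_pi {α M : Type*} [Fintype α] [AddCommMonoid M] {p : ℕ}
    (f : (Fin (p + 1) → α) → M) : ∑ v, f v = ∑ i, ∑ v, f (Fin.cons i v) := by
  rw [← Fintype.sum_prod_type']
  exact (Fintype.sum_equiv (Fin.consEquiv fun _ => α) _ _ fun _ => rfl).symm

lemma injective_elim_iff {α β γ : Type*} {v : α → γ} {w : β → γ} :
    Function.Injective (Sum.elim v w) ↔
      Function.Injective v ∧ Function.Injective w ∧ ∀ a b, v a ≠ w b :=
  ⟨fun h => ⟨h.comp Sum.inl_injective, h.comp Sum.inr_injective,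
    fun a b hab => Sum.inl_ne_inr (h (show Sum.elim v w (.inl a) = Sum.elim v w (.inr b) from hab))⟩,
    fun h => h.1.sumElim h.2.1 h.2.2⟩

/-- **Decoupling.** The second moment of a chaos without coinciding indices, at least one slot
of which is centred, is bounded by that of the decoupled chaos in which every remaining slot
is replaced by its mean plus `κ` times a family of independent signs. -/
theorem integral_sq_chaos_le_signAvg [IsProbabilityMeasure P] (hm : ∀ i, m i ≤ mΩ)
    (hI : iIndep m P) {κ : ℝ} (p k : ℕ) {F : Fin p → N → Ω → ℝ} {φ : Fin k → N → Ω → ℝ}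
    (hF : ∀ q, Slot m P κ (F q)) (hφ : ∀ q, Slot m P κ (φ q))
    (h0 : ∀ q i, ∫ ω, φ q i ω ∂P = 0) {c : (Fin p → N) → (Fin k → N) → ℝ}
    (hc : ∀ v w, ¬ Function.Injective (Sum.elim v w) → c v w = 0) :
    ∫ ω, chaos F φ c ω ^ 2 ∂P ≤ 2 ^ p * ((p + k : ℕ) : ℝ) ^ (p + k) * κ ^ (2 * k) *
      signAvg κ p (fun q i => ∫ ω, F q i ω ∂P) c := by
  induction p generalizing k with
  | zero =>
    have e : ∀ ω, chaos F φ c ω = ∑ w, c Fin.elim0 w * ∏ q, φ q (w q) ω := by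
      intro ω
      simp [chaos, Subsingleton.elim (default : Fin 0 → N) Fin.elim0]
    simp_rw [e]
    have := integral_sq_chaos_le hm hI hφ h0 (d := c Fin.elim0) fun w hw => hc _ _ fun h =>
      hw (injective_elim_iff.1 h).2.1
    simpa [signAvg] using this
  | succ p ih =>
    -- the first slot is split into its mean, absorbed in the coefficients `c₁`, and its fluctuation,
    -- which joins the centred slots with coefficients `c₂`
    set μ := fun i => ∫ ω, F 0 i ω ∂P with hμ
    set c₁ : (Fin p → N) → (Fin k → N) → ℝ := fun v w => ∑ i, μ i * c (Fin.cons i v) w with hc₁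
    set c₂ : (Fin p → N) → (Fin (k + 1) → N) → ℝ := fun v w => c (Fin.cons (w 0) v) (Fin.tail w)
      with hc₂
    set F' : Fin p → N → Ω → ℝ := Fin.tail F
    set φ' : Fin (k + 1) → N → Ω → ℝ := Fin.cons (fun i ω => F 0 i ω - μ i) φ with hφ'
    have hs : ∀ q, Slot m P κ (φ' q) := by
      refine Fin.cases ?_ fun q => ?_
      · simpa [hφ'] using (hF 0).sub_mean
      · simpa [hφ'] using hφ q
    have h0' : ∀ q i, ∫ ω, φ' q i ω ∂P = 0 := by
      refine Fin.cases (fun i => ?_) fun q i => ?_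
      · simpa [hφ', hμ] using integral_sub_mean ((hF 0).integrable i)
      · simpa [hφ'] using h0 q i
    have hz₁ : ∀ v w, ¬ Function.Injective (Sum.elim v w) → c₁ v w = 0 := by
      intro v w h
      refine Finset.sum_eq_zero fun i _ => ?_
      rw [hc _ _ fun h' => h ?_, mul_zero]
      rw [injective_elim_iff] at h' ⊢
      exact ⟨(Fin.cons_injective_iff.1 h'.1).2, h'.2.1, fun a b => h'.2.2 a.succ b⟩
    have hz₂ : ∀ v w, ¬ Function.Injective (Sum.elim v w) → c₂ v w = 0 := by
      intro v w h
      refine hc _ _ fun h' => h ?_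
      rw [injective_elim_iff] at h' ⊢
      obtain ⟨h1, h2, h3⟩ := h'
      rw [Fin.cons_injective_iff] at h1
      refine ⟨h1.2, ?_, fun a => Fin.cases ?_ fun b => h3 a.succ b⟩
      · rw [← Fin.cons_self_tail w, Fin.cons_injective_iff]
        exact ⟨fun ⟨b, hb⟩ => h3 0 b hb.symm, h2⟩
      · exact fun h => h1.1 ⟨a, h⟩
    have hsplit : ∀ ω, chaos F φ c ω = chaos F' φ c₁ ω + chaos F' φ' c₂ ω := by
      intro ω
      simp only [chaos, hc₁, hc₂]
      simp_rw [sum_fin_succ_pi (p := k)]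
      rw [sum_fin_succ_pi, Finset.sum_comm, ← Finset.sum_add_distrib]
      refine Finset.sum_congr rfl fun v _ => ?_
      simp_rw [Finset.sum_mul]
      rw [Finset.sum_comm (s := (Finset.univ : Finset (Fin k → N))), ← Finset.sum_add_distrib]
      refine Finset.sum_congr rfl fun i _ => ?_
      rw [← Finset.sum_add_distrib]
      refine Finset.sum_congr rfl fun w _ => ?_
      simp only [Fin.prod_univ_succ, Fin.cons_zero, Fin.cons_succ, hφ', Fin.tail_cons, F',
        Fin.tail]
      ring
    have hF' : ∀ q, Slot m P κ (F' q) := fun q => hF q.succ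
    have i₁ := memLp_chaos hm hI hF' hφ hz₁
    have i₂ := memLp_chaos hm hI hF' hs hz₂
    have b₁ := ih k hF' hφ h0 hz₁
    have b₂ := ih (k + 1) hF' hs h0' hz₂
    have hq : signAvg κ (p + 1) (fun q i => ∫ ω, F q i ω ∂P) c
        = signAvg κ p (fun q i => ∫ ω, F' q i ω ∂P) c₁
          + κ ^ 2 * signAvg κ p (fun q i => ∫ ω, F' q i ω ∂P) c₂ := by
      simp only [signAvg]
      refine (expect_signAvg κ p μ _ fun i v w => c (Fin.cons i v) w).trans ?_
      congr 2
      exact (signAvg_equiv κ (Fin.consEquiv fun _ => N) p _ c₂)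
    have hle : ∫ ω, chaos F φ c ω ^ 2 ∂P
        ≤ 2 * ∫ ω, chaos F' φ c₁ ω ^ 2 ∂P + 2 * ∫ ω, chaos F' φ' c₂ ω ^ 2 ∂P := by
      rw [← integral_const_mul, ← integral_const_mul,
        ← integral_add (i₁.integrable_sq.const_mul 2) (i₂.integrable_sq.const_mul 2)]
      refine integral_mono (memLp_chaos hm hI hF hφ hc).integrable_sq
        ((i₁.integrable_sq.const_mul 2).add (i₂.integrable_sq.const_mul 2)) fun ω => ?_
      simp only [hsplit]
      nlinarith [sq_nonneg (chaos F' φ c₁ ω - chaos F' φ' c₂ ω)]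
    rw [hq]
    have hk : 0 ≤ κ ^ (2 * k) := by rw [pow_mul]; positivity
    have q1 := signAvg_nonneg κ p (fun q i => ∫ ω, F' q i ω ∂P) c₁
    have q2 := signAvg_nonneg κ p (fun q i => ∫ ω, F' q i ω ∂P) c₂
    have e1 : ((p + k : ℕ) : ℝ) ^ (p + k) ≤ ((p + 1 + k : ℕ) : ℝ) ^ (p + 1 + k) := by
      have : (p + k) ^ (p + k) ≤ (p + 1 + k) ^ (p + 1 + k) :=
        (Nat.pow_le_pow_left (by omega) _).trans (Nat.pow_le_pow_right (by omega) (by omega))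
      exact_mod_cast this
    have e2 : p + (k + 1) = p + 1 + k := by ring
    rw [e2] at b₂
    have b₁' := b₁.trans (show _ ≤ 2 ^ p * ((p + 1 + k : ℕ) : ℝ) ^ (p + 1 + k) * κ ^ (2 * k) *
      signAvg κ p (fun q i => ∫ ω, F' q i ω ∂P) c₁ by gcongr)
    calc _ ≤ _ := hle
      _ ≤ 2 * (2 ^ p * ((p + 1 + k : ℕ) : ℝ) ^ (p + 1 + k) * κ ^ (2 * k) *
          signAvg κ p (fun q i => ∫ ω, F' q i ω ∂P) c₁)
          + 2 * (2 ^ p * ((p + 1 + k : ℕ) : ℝ) ^ (p + 1 + k) * κ ^ (2 * (k + 1)) *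
          signAvg κ p (fun q i => ∫ ω, F' q i ω ∂P) c₂) := by linarith
      _ = _ := by rw [mul_add 2 k 1, pow_add κ (2 * k)]; ring

end Decoupling

/-! ### Decoupled bounds for forms of order one to four -/

section DecouplingLow

open scoped BigOperators

variable {N : Type*} [Fintype N] [DecidableEq N]
variable {Ω : Type*} [mΩ : MeasurableSpace Ω] {m : N → MeasurableSpace Ω} {P : Measure Ω}

lemma integral_chaos_eq_zero [IsProbabilityMeasure P] (hm : ∀ i, m i ≤ mΩ) (hI : iIndep m P)
    {κ : ℝ} {p k : ℕ} {F : Fin p → N → Ω → ℝ} {φ : Fin (k + 1) → N → Ω → ℝ}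
    (hF : ∀ q, Slot m P κ (F q)) (hφ : ∀ q, Slot m P κ (φ q))
    (h0 : ∀ q i, ∫ ω, φ q i ω ∂P = 0) {c : (Fin p → N) → (Fin (k + 1) → N) → ℝ}
    (hc : ∀ v w, ¬ Function.Injective (Sum.elim v w) → c v w = 0) :
    ∫ ω, chaos F φ c ω ∂P = 0 := by
  have hint : ∀ v w, Integrable
      (fun ω => c v w * ((∏ q, F q (v q) ω) * ∏ q, φ q (w q) ω)) P := by
    intro v w
    by_cases h : Function.Injective (Sum.elim v w)
    · have := (prod_slots_sq hm hI (F := Sum.elim F φ) (κ := κ)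
        (by rintro (q | q) <;> simp [hF, hφ]) h Finset.univ).1
      simp only [Fintype.prod_sum_type, Sum.elim_inl, Sum.elim_inr] at this
      exact (this.integrable (by norm_num)).const_mul _
    · simp [hc v w h]
  unfold chaos
  rw [integral_finsetSum _ fun v _ => integrable_finsetSum _ fun w _ => hint v w]
  refine Finset.sum_eq_zero fun v _ => ?_
  rw [integral_finsetSum _ fun w _ => hint v w]
  refine Finset.sum_eq_zero fun w _ => ?_
  by_cases h : Function.Injective (Sum.elim v w)
  swap
  · simp [hc v w h]
  rw [injective_elim_iff] at h
  have h2 : Measurable[sigmaOn m {w 0}ᶜ] fun ω =>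
      (∏ q, F q (v q) ω) * ∏ q : Fin k, φ q.succ (w q.succ) ω :=
    (measurable_prod_slots (fun q => (hF q).meas) v Finset.univ {w 0}ᶜ fun q _ => h.2.2 q 0).mul
      (measurable_prod_slots (fun q => (hφ (Fin.succ q)).meas) (Fin.tail w) Finset.univ {w 0}ᶜ
        fun q _ hq => Fin.succ_ne_zero q (h.2.1 hq))
  have := integral_mul_of_disjoint hm hI (disjoint_compl_right (a := ({w 0} : Set N)))
    (measurable_sigmaOn (hφ 0).meas rfl) h2
  rw [h0, zero_mul] at this
  rw [integral_const_mul]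
  have e : ∀ ω, (∏ q, F q (v q) ω) * ∏ q, φ q (w q) ω
      = φ 0 (w 0) ω * ((∏ q, F q (v q) ω) * ∏ q : Fin k, φ q.succ (w q.succ) ω) := by
    intro ω
    rw [Fin.prod_univ_succ]
    ring
  simp_rw [e, this, mul_zero]

/-- The mean of the slot `F` plus `κ` times the signs `ε`. -/
def signed (P : Measure Ω) (κ : ℝ) (F : N → Ω → ℝ) (ε : N → Bool) (i : N) : ℝ :=
  ∫ ω, F i ω ∂P + κ * signOf (ε i)

omit [Fintype N] [DecidableEq N] in
lemma abs_signed_le [IsProbabilityMeasure P] {κ : ℝ} (hκ : 0 ≤ κ) {F : N → Ω → ℝ}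
    (hF : Slot m P κ F) (ε : N → Bool) (i : N) : |signed P κ F ε i| ≤ 2 * κ := by
  have h1 : |∫ ω, F i ω ∂P| ≤ κ := abs_le_of_sq_le_sq (hF.sq_mean_le i) hκ
  have h2 : |κ * signOf (ε i)| = κ := by rw [abs_mul, abs_signOf, mul_one, abs_of_nonneg hκ]
  exact (abs_add_le _ _).trans (by linarith)

lemma sum_fin_zero_pi {α M : Type*} [Fintype α] [AddCommMonoid M] (f : (Fin 0 → α) → M) :
    ∑ v, f v = f ![] := by
  rw [Fintype.sum_unique]
  congr 1

lemma injective_fin_three {α : Type*} {v : Fin 3 → α} (h1 : v 0 ≠ v 1) (h2 : v 0 ≠ v 2)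
    (h3 : v 1 ≠ v 2) : Function.Injective v := by
  have : ∀ a b : Fin 3, v a = v b → a = b := by
    simp only [Fin.forall_fin_succ, Fin.succ_zero_eq_one, IsEmpty.forall_iff, and_true]
    exact ⟨⟨fun _ => trivial, fun h => absurd h h1, fun h => absurd h h2⟩,
      ⟨fun h => absurd h.symm h1, fun _ => trivial, fun h => absurd h h3⟩,
      fun h => absurd h.symm h2, fun h => absurd h.symm h3, fun _ => trivial⟩
  exact this

lemma sum_fin_one_pi {α M : Type*} [Fintype α] [AddCommMonoid M] (f : (Fin 1 → α) → M) :
    ∑ v, f v = ∑ i, f ![i] := by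
  rw [sum_fin_succ_pi]
  simp_rw [sum_fin_zero_pi]
  rfl

lemma sum_fin_two_pi {α M : Type*} [Fintype α] [AddCommMonoid M] (f : (Fin 2 → α) → M) :
    ∑ v, f v = ∑ i, ∑ j, f ![i, j] := by
  rw [sum_fin_succ_pi]
  simp_rw [sum_fin_one_pi]
  rfl

lemma sum_fin_three_pi {α M : Type*} [Fintype α] [AddCommMonoid M] (f : (Fin 3 → α) → M) :
    ∑ v, f v = ∑ i, ∑ j, ∑ k, f ![i, j, k] := by
  rw [sum_fin_succ_pi]
  simp_rw [sum_fin_two_pi]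
  rfl

variable [IsProbabilityMeasure P] (hm : ∀ i, m i ≤ mΩ) (hI : iIndep m P) {κ : ℝ}
include hm hI

/-- Linear forms in a centred slot. -/
theorem linear_chaos {τ : N → Ω → ℝ} (hτ : Slot m P κ τ) (h0 : ∀ i, ∫ ω, τ i ω ∂P = 0)
    (c : N → ℝ) :
    MemLp (fun ω => ∑ l, c l * τ l ω) 2 P ∧ ∫ ω, ∑ l, c l * τ l ω ∂P = 0 ∧
      ∫ ω, (∑ l, c l * τ l ω) ^ 2 ∂P ≤ κ ^ 2 * ∑ l, c l ^ 2 := by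
  have hc : ∀ (v : Fin 0 → N) (w : Fin 1 → N), ¬ Function.Injective (Sum.elim v w) →
      (fun (_ : Fin 0 → N) (w : Fin 1 → N) => c (w 0)) v w = 0 := fun v w h => by
    exact absurd (injective_elim_iff.2 ⟨Function.injective_of_subsingleton v,
      Function.injective_of_subsingleton w, fun a => a.elim0⟩) h
  have hF : ∀ q, Slot m P κ ((![] : Fin 0 → N → Ω → ℝ) q) := fun q => q.elim0
  have hφ : ∀ q, Slot m P κ ((![τ] : Fin 1 → N → Ω → ℝ) q) := by simpa using hτ
  have hz : ∀ q i, ∫ ω, (![τ] : Fin 1 → N → Ω → ℝ) q i ω ∂P = 0 := by simpa using h0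
  have e : chaos (![] : Fin 0 → N → Ω → ℝ) ![τ] (fun _ w => c (w 0))
      = fun ω => ∑ l, c l * τ l ω := by
    funext ω
    simp [chaos, sum_fin_one_pi]
  have h1 := memLp_chaos hm hI hF hφ hc
  have h2 := integral_chaos_eq_zero hm hI hF hφ hz hc
  have h3 := integral_sq_chaos_le_signAvg hm hI 0 1 hF hφ hz hc
  rw [e] at h1 h2 h3
  refine ⟨h1, h2, h3.trans_eq ?_⟩
  simp [signAvg, sum_fin_one_pi]

/-- Decoupling for a centred slot `τ` and one further slot. -/
theorem quadratic_chaos {U τ : N → Ω → ℝ} (hU : Slot m P κ U) (hτ : Slot m P κ τ)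
    (h0 : ∀ i, ∫ ω, τ i ω ∂P = 0) {c : N → N → ℝ} (hc : ∀ i, c i i = 0) :
    MemLp (fun ω => ∑ j, ∑ l, c j l * (U j ω * τ l ω)) 2 P ∧
      ∫ ω, ∑ j, ∑ l, c j l * (U j ω * τ l ω) ∂P = 0 ∧
      ∫ ω, (∑ j, ∑ l, c j l * (U j ω * τ l ω)) ^ 2 ∂P ≤
        8 * κ ^ 2 * 𝔼 ε : N → Bool, ∑ l, (∑ j, signed P κ U ε j * c j l) ^ 2 := by
  have hc' : ∀ (v : Fin 1 → N) (w : Fin 1 → N), ¬ Function.Injective (Sum.elim v w) →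
      (fun (v : Fin 1 → N) (w : Fin 1 → N) => c (v 0) (w 0)) v w = 0 := fun v w h => by
    by_cases hvw : v 0 = w 0
    · simp only [hvw, hc]
    · refine absurd (injective_elim_iff.2 ⟨Function.injective_of_subsingleton v,
        Function.injective_of_subsingleton w, fun a b => ?_⟩) h
      rwa [Subsingleton.elim a 0, Subsingleton.elim b 0]
  have hF : ∀ q, Slot m P κ ((![U] : Fin 1 → N → Ω → ℝ) q) := by simpa using hU
  have hφ : ∀ q, Slot m P κ ((![τ] : Fin 1 → N → Ω → ℝ) q) := by simpa using hτ
  have hz : ∀ q i, ∫ ω, (![τ] : Fin 1 → N → Ω → ℝ) q i ω ∂P = 0 := by simpa using h0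
  have e : chaos (![U] : Fin 1 → N → Ω → ℝ) ![τ] (fun v w => c (v 0) (w 0))
      = fun ω => ∑ j, ∑ l, c j l * (U j ω * τ l ω) := by
    funext ω
    simp [chaos, sum_fin_one_pi]
  have h1 := memLp_chaos hm hI hF hφ hc'
  have h2 := integral_chaos_eq_zero hm hI hF hφ hz hc'
  have h3 := integral_sq_chaos_le_signAvg hm hI 1 1 hF hφ hz hc'
  rw [e] at h1 h2 h3
  refine ⟨h1, h2, h3.trans_eq ?_⟩
  simp only [signAvg, sum_fin_one_pi]
  norm_num [signed]

/-- Decoupling for a centred slot `τ` and two further slots. -/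
theorem cubic_chaos {U V τ : N → Ω → ℝ} (hU : Slot m P κ U) (hV : Slot m P κ V)
    (hτ : Slot m P κ τ) (h0 : ∀ i, ∫ ω, τ i ω ∂P = 0) {c : N → N → N → ℝ}
    (hc : ∀ j k l, j = k ∨ j = l ∨ k = l → c j k l = 0) :
    MemLp (fun ω => ∑ j, ∑ k, ∑ l, c j k l * (U j ω * V k ω * τ l ω)) 2 P ∧
      ∫ ω, ∑ j, ∑ k, ∑ l, c j k l * (U j ω * V k ω * τ l ω) ∂P = 0 ∧
      ∫ ω, (∑ j, ∑ k, ∑ l, c j k l * (U j ω * V k ω * τ l ω)) ^ 2 ∂P ≤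
        108 * κ ^ 2 * 𝔼 ε : N → Bool, 𝔼 ε' : N → Bool,
          ∑ l, (∑ j, ∑ k, signed P κ U ε j * signed P κ V ε' k * c j k l) ^ 2 := by
  have hc' : ∀ (v : Fin 2 → N) (w : Fin 1 → N), ¬ Function.Injective (Sum.elim v w) →
      (fun (v : Fin 2 → N) (w : Fin 1 → N) => c (v 0) (v 1) (w 0)) v w = 0 := fun v w h => by
    by_contra hne
    have := mt (hc (v 0) (v 1) (w 0)) hne
    push Not at this
    refine h (injective_elim_iff.2 ⟨?_, Function.injective_of_subsingleton w, fun a b => ?_⟩)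
    · intro a b hab
      fin_cases a <;> fin_cases b <;> simp_all
    · rw [Subsingleton.elim b 0]
      fin_cases a <;> simp_all
  have hF : ∀ q, Slot m P κ ((![U, V] : Fin 2 → N → Ω → ℝ) q) := by
    intro q; fin_cases q <;> simp [hU, hV]
  have hφ : ∀ q, Slot m P κ ((![τ] : Fin 1 → N → Ω → ℝ) q) := by simpa using hτ
  have hz : ∀ q i, ∫ ω, (![τ] : Fin 1 → N → Ω → ℝ) q i ω ∂P = 0 := by simpa using h0
  have e : chaos (![U, V] : Fin 2 → N → Ω → ℝ) ![τ] (fun v w => c (v 0) (v 1) (w 0))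
      = fun ω => ∑ j, ∑ k, ∑ l, c j k l * (U j ω * V k ω * τ l ω) := by
    funext ω
    simp [chaos, sum_fin_one_pi, sum_fin_two_pi]
  have h1 := memLp_chaos hm hI hF hφ hc'
  have h2 := integral_chaos_eq_zero hm hI hF hφ hz hc'
  have h3 := integral_sq_chaos_le_signAvg hm hI 2 1 hF hφ hz hc'
  rw [e] at h1 h2 h3
  refine ⟨h1, h2, h3.trans_eq ?_⟩
  simp only [signAvg, sum_fin_one_pi, Finset.mul_sum]
  have e2 : (2 : ℝ) ^ 2 * ((2 + 1 : ℕ) : ℝ) ^ (2 + 1) * κ ^ (2 * 1) = 108 * κ ^ 2 := by norm_num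
  rw [e2]
  congr 1
  refine Finset.expect_congr rfl fun ε _ => Finset.expect_congr rfl fun ε' _ =>
    Finset.sum_congr rfl fun l _ => ?_
  rw [Finset.sum_comm]
  congr 1
  refine Finset.sum_congr rfl fun j _ => Finset.sum_congr rfl fun k _ => ?_
  simp [signed, Fin.tail]
  ring

/-- Decoupling for a centred slot `τ` and three further slots. -/
theorem quartic_chaos {S U V τ : N → Ω → ℝ} (hS : Slot m P κ S) (hU : Slot m P κ U)
    (hV : Slot m P κ V) (hτ : Slot m P κ τ) (h0 : ∀ i, ∫ ω, τ i ω ∂P = 0)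
    {c : N → N → N → N → ℝ}
    (hc : ∀ i j k l, i = j ∨ i = k ∨ i = l ∨ j = k ∨ j = l ∨ k = l → c i j k l = 0) :
    MemLp (fun ω => ∑ i, ∑ j, ∑ k, ∑ l, c i j k l * (S i ω * U j ω * V k ω * τ l ω)) 2 P ∧
      ∫ ω, ∑ i, ∑ j, ∑ k, ∑ l, c i j k l * (S i ω * U j ω * V k ω * τ l ω) ∂P = 0 ∧
      ∫ ω, (∑ i, ∑ j, ∑ k, ∑ l, c i j k l * (S i ω * U j ω * V k ω * τ l ω)) ^ 2 ∂P ≤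
        2048 * κ ^ 2 * 𝔼 ε : N → Bool, 𝔼 ε' : N → Bool, 𝔼 ε'' : N → Bool,
          ∑ l, (∑ i, ∑ j, ∑ k,
            signed P κ S ε i * signed P κ U ε' j * signed P κ V ε'' k * c i j k l) ^ 2 := by
  have hc' : ∀ (v : Fin 3 → N) (w : Fin 1 → N), ¬ Function.Injective (Sum.elim v w) →
      (fun (v : Fin 3 → N) (w : Fin 1 → N) => c (v 0) (v 1) (v 2) (w 0)) v w = 0 :=
    fun v w h => by
    by_contra hne
    have := mt (hc (v 0) (v 1) (v 2) (w 0)) hne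
    push Not at this
    obtain ⟨h1, h2, h3, h4, h5, h6⟩ := this
    refine h (injective_elim_iff.2 ⟨injective_fin_three h1 h2 h4,
      Function.injective_of_subsingleton w, fun a b => ?_⟩)
    rw [Subsingleton.elim b 0]
    revert a
    simp only [Fin.forall_fin_succ, Fin.succ_zero_eq_one, IsEmpty.forall_iff, and_true]
    exact ⟨h3, h5, h6⟩
  have hF : ∀ q, Slot m P κ ((![S, U, V] : Fin 3 → N → Ω → ℝ) q) := by

    simp only [Fin.forall_fin_succ, IsEmpty.forall_iff, and_true]
    exact ⟨hS, hU, hV⟩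
  have hφ : ∀ q, Slot m P κ ((![τ] : Fin 1 → N → Ω → ℝ) q) := by simpa using hτ
  have hz : ∀ q i, ∫ ω, (![τ] : Fin 1 → N → Ω → ℝ) q i ω ∂P = 0 := by simpa using h0
  have e : chaos (![S, U, V] : Fin 3 → N → Ω → ℝ) ![τ] (fun v w => c (v 0) (v 1) (v 2) (w 0))
      = fun ω => ∑ i, ∑ j, ∑ k, ∑ l, c i j k l * (S i ω * U j ω * V k ω * τ l ω) := by
    funext ω
    simp only [chaos, sum_fin_one_pi, sum_fin_three_pi, Fin.prod_univ_three, Fin.prod_univ_one]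
    rfl
  have h1 := memLp_chaos hm hI hF hφ hc'
  have h2 := integral_chaos_eq_zero hm hI hF hφ hz hc'
  have h3 := integral_sq_chaos_le_signAvg hm hI 3 1 hF hφ hz hc'
  rw [e] at h1 h2 h3
  refine ⟨h1, h2, h3.trans_eq ?_⟩
  simp only [signAvg, sum_fin_one_pi, Finset.mul_sum]
  have e2 : (2 : ℝ) ^ 3 * ((3 + 1 : ℕ) : ℝ) ^ (3 + 1) * κ ^ (2 * 1) = 2048 * κ ^ 2 := by norm_num
  rw [e2]
  refine congrArg (2048 * κ ^ 2 * ·) ?_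
  refine Finset.expect_congr rfl fun ε _ => Finset.expect_congr rfl fun ε' _ =>
    Finset.expect_congr rfl fun ε'' _ => Finset.sum_congr rfl fun l _ => ?_
  refine congrArg (· ^ 2) ?_
  calc _ = ∑ k, ∑ i, ∑ j, signed P κ S ε i * signed P κ U ε' j * signed P κ V ε'' k
        * c i j k l := by
        refine Finset.sum_congr rfl fun k _ => ?_
        rw [Finset.sum_comm]
        refine Finset.sum_congr rfl fun i _ => Finset.sum_congr rfl fun j _ => ?_
        change signed P κ V ε'' k * (signed P κ U ε' j * (signed P κ S ε i * c i j k l)) = _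
        ring
    _ = _ := by
        rw [Finset.sum_comm]
        exact Finset.sum_congr rfl fun i _ => Finset.sum_comm

end DecouplingLow

/-! ### Leave-out algebra of the annihilator matrix -/

namespace IVSample

section LeaveOut

variable {Ω : Type*} [MeasurableSpace Ω] {P : Measure Ω} {n K L : ℕ}
variable (s : IVSample Ω P n K L)

/-- The coefficient vectors `(Q'Q)⁻¹ Q_a`, for which `M_{al} = 1{a = l} - w_a' Q_l`. -/
def hatCoef (a : Fin n) : Fin K ⊕ Fin L → ℝ :=
  Matrix.vecMul (s.Q a) (s.Q.transpose * s.Q)⁻¹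

lemma M_apply (a l : Fin n) : s.M a l = (if a = l then 1 else 0) - s.hatCoef a ⬝ᵥ s.Q l := by
  simp only [M, hatMatrix, Matrix.sub_apply, Matrix.one_apply, hatCoef]
  rfl

lemma gram3_mulVec (i j k : Fin n) (v : Fin K ⊕ Fin L → ℝ) :
    (s.gram3 i j k).mulVec v = ∑ l ∈ {i, j, k}ᶜ, (s.Q l ⬝ᵥ v) • s.Q l := by
  unfold gram3
  rw [Matrix.sum_mulVec]
  refine Finset.sum_congr rfl fun l _ => ?_
  rw [Matrix.vecMulVec_mulVec]
  ext p
  simp [mul_comm]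

lemma eq_zero_of_dotProduct_eq_zero {i j k : Fin n} (h : IsUnit (s.gram3 i j k))
    {v : Fin K ⊕ Fin L → ℝ} (hv : ∀ l ∉ ({i, j, k} : Finset (Fin n)), v ⬝ᵥ s.Q l = 0) :
    v = 0 := by
  have h1 : (s.gram3 i j k).mulVec v = 0 := by
    rw [gram3_mulVec]
    refine Finset.sum_eq_zero fun l hl => ?_
    rw [dotProduct_comm, hv l (Finset.mem_compl.1 hl), zero_smul]
  have h2 := Matrix.mulVec_injective_iff_isUnit.2 h
  exact h2 (by rw [h1, Matrix.mulVec_zero])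

lemma isUnit_gram {i j k : Fin n} (h : IsUnit (s.gram3 i j k)) :
    IsUnit (s.Q.transpose * s.Q) := by
  rw [← Matrix.mulVec_injective_iff_isUnit]
  refine (injective_iff_map_eq_zero (Matrix.mulVecLin (s.Q.transpose * s.Q))).2 fun v hv => ?_
  refine s.eq_zero_of_dotProduct_eq_zero h fun l _ => ?_
  have h1 : (s.Q.mulVec v) ⬝ᵥ (s.Q.mulVec v) = 0 := by
    rw [Matrix.mulVecLin_apply, ← Matrix.mulVec_mulVec] at hv
    rw [Matrix.dotProduct_mulVec, ← Matrix.mulVec_transpose, hv, zero_dotProduct]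
  rw [dotProduct_self_eq_zero] at h1
  rw [dotProduct_comm]
  exact congrFun h1 l

lemma M_symm (a l : Fin n) : s.M a l = s.M l a := by
  have h : s.M.transpose = s.M := by
    simp only [M, hatMatrix, Matrix.transpose_sub, Matrix.transpose_one, Matrix.transpose_mul,
      Matrix.transpose_transpose, Matrix.transpose_nonsing_inv, Matrix.mul_assoc]
  exact congrFun (congrFun h l) a

lemma M_mul_Q (hQ : IsUnit (s.Q.transpose * s.Q)) : s.M * s.Q = 0 := by
  have := Matrix.nonsing_inv_mul _ ((Matrix.isUnit_iff_isUnit_det _).1 hQ)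
  simp only [M, hatMatrix, Matrix.sub_mul, Matrix.one_mul, Matrix.mul_assoc, this, Matrix.mul_one,
    sub_self]

lemma M_mul_M (hQ : IsUnit (s.Q.transpose * s.Q)) : s.M * s.M = s.M := by
  have h := s.M_mul_Q hQ
  calc s.M * s.M = s.M * (1 - s.Q * (s.Q.transpose * s.Q)⁻¹ * s.Q.transpose) := rfl
    _ = s.M := by rw [Matrix.mul_sub, Matrix.mul_one, ← Matrix.mul_assoc, ← Matrix.mul_assoc, h]; simp

lemma sum_M_mul_M (hQ : IsUnit (s.Q.transpose * s.Q)) (a b : Fin n) :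
    ∑ l, s.M a l * s.M b l = s.M a b := by
  have := congrFun (congrFun (s.M_mul_M hQ) a) b
  rw [Matrix.mul_apply] at this
  rw [← this]
  exact Finset.sum_congr rfl fun l _ => by rw [s.M_symm b l]

lemma sum_M_smul_Q (hQ : IsUnit (s.Q.transpose * s.Q)) (a : Fin n) :
    ∑ l, s.M a l • s.Q l = 0 := by
  funext p
  have := congrFun (congrFun (s.M_mul_Q hQ) a) p
  rw [Matrix.mul_apply] at this
  simpa using this

lemma eq_zero_of_sum_ite_eq_zero {N : Type*} [DecidableEq N] {i j k : N} {α β γ : ℝ}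
    (h : ∀ l, 0 = α * (if i = l then 1 else 0) + β * (if j = l then 1 else 0)
        + γ * (if k = l then 1 else 0))
    (hij : i = j → β = 0) (hik : i = k → γ = 0) (hjk : j = k → γ = 0) :
    α = 0 ∧ β = 0 ∧ γ = 0 := by
  have hi := h i
  have hj := h j
  have hk := h k
  clear h
  grind

/-- The principal minors of `M` over left-out observations are positive: a combination of rows
of `M` that vanishes is, off the left-out observations, a linear function of `Q_l`. -/
lemma quadForm_pos {i j k : Fin n} (h : IsUnit (s.gram3 i j k)) {α β γ : ℝ}
    (hij : i = j → β = 0) (hik : i = k → γ = 0) (hjk : j = k → γ = 0)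
    (hne : ¬ (α = 0 ∧ β = 0 ∧ γ = 0)) :
    0 < α ^ 2 * s.M i i + β ^ 2 * s.M j j + γ ^ 2 * s.M k k + 2 * α * β * s.M i j
      + 2 * α * γ * s.M i k + 2 * β * γ * s.M j k := by
  have hQ := s.isUnit_gram h
  have hS : ∑ l, (α * s.M i l + β * s.M j l + γ * s.M k l) ^ 2
      = α ^ 2 * s.M i i + β ^ 2 * s.M j j + γ ^ 2 * s.M k k + 2 * α * β * s.M i j
      + 2 * α * γ * s.M i k + 2 * β * γ * s.M j k := by
    rw [← s.sum_M_mul_M hQ i i, ← s.sum_M_mul_M hQ j j, ← s.sum_M_mul_M hQ k k,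
      ← s.sum_M_mul_M hQ i j, ← s.sum_M_mul_M hQ i k, ← s.sum_M_mul_M hQ j k]
    simp only [Finset.mul_sum, ← Finset.sum_add_distrib]
    exact Finset.sum_congr rfl fun l _ => by ring
  rw [← hS]
  refine lt_of_le_of_ne (Finset.sum_nonneg fun _ _ => sq_nonneg _) fun h0 => hne ?_
  have h0' := fun l => (Finset.sum_eq_zero_iff_of_nonneg fun _ _ => sq_nonneg _).1 h0.symm l
    (Finset.mem_univ l)
  simp only [pow_eq_zero_iff two_ne_zero] at h0'
  set w := α • s.hatCoef i + β • s.hatCoef j + γ • s.hatCoef k with hw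
  have hwQ : ∀ l, w ⬝ᵥ s.Q l
      = α * (if i = l then 1 else 0) + β * (if j = l then 1 else 0)
        + γ * (if k = l then 1 else 0) := by
    intro l
    have := h0' l
    simp only [M_apply] at this
    simp only [hw, add_dotProduct, smul_dotProduct, smul_eq_mul]
    linarith
  have hw0 : w = 0 := by
    refine s.eq_zero_of_dotProduct_eq_zero h fun l hl => ?_
    simp only [Finset.mem_insert, Finset.mem_singleton, not_or] at hl
    rw [hwQ, if_neg (Ne.symm hl.1), if_neg (Ne.symm hl.2.1), if_neg (Ne.symm hl.2.2)]
    ring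
  simp only [hw0, zero_dotProduct] at hwQ
  exact eq_zero_of_sum_ite_eq_zero hwQ hij hik hjk

lemma M_diag_pos {i j k : Fin n} (h : IsUnit (s.gram3 i j k)) : 0 < s.M i i := by
  have := s.quadForm_pos h (α := 1) (β := 0) (γ := 0) (by simp) (by simp) (by simp) (by simp)
  simpa using this

lemma D2_pos {i j k : Fin n} (h : IsUnit (s.gram3 i j k)) (hij : i ≠ j) : 0 < s.D2 i j := by
  have h1 := s.M_diag_pos h
  have := s.quadForm_pos h (α := -s.M i j) (β := s.M i i) (γ := 0) (fun e => absurd e hij)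
    (by simp) (by simp) (by simp [h1.ne'])
  have e : 0 < s.M i i * s.D2 i j := by
    unfold D2
    linarith
  exact pos_of_mul_pos_right e h1.le

lemma D2_symm (i j : Fin n) : s.D2 i j = s.D2 j i := by
  unfold D2
  rw [s.M_symm j i]
  ring

lemma gram3_swap (i j k : Fin n) : s.gram3 i j k = s.gram3 j i k := by
  unfold gram3
  rw [Finset.insert_comm]

lemma gram3_swap' (i j k : Fin n) : s.gram3 i j k = s.gram3 i k j := by
  unfold gram3
  rw [Finset.pair_comm]

lemma D3_pos {i j k : Fin n} (h : IsUnit (s.gram3 i j k)) (hij : i ≠ j) (hik : i ≠ k)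
    (hjk : j ≠ k) : 0 < s.D3 i j k := by
  have h1 : 0 < s.D2 j k := s.D2_pos (k := i) (by rwa [← s.gram3_swap', ← s.gram3_swap]) hjk
  have := s.quadForm_pos h (α := s.D2 j k) (β := -(s.M i j * s.M k k - s.M i k * s.M j k))
    (γ := -(s.M i k * s.M j j - s.M i j * s.M j k)) (fun e => absurd e hij)
    (fun e => absurd e hik) (fun e => absurd e hjk) (by simp [h1.ne'])
  have e : 0 < s.D2 j k * s.D3 i j k := by
    unfold D3
    refine this.trans_eq ?_
    unfold D2
    ring
  exact pos_of_mul_pos_right e h1.le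

lemma D3_swap (i j k : Fin n) : s.D3 i j k = s.D3 j i k := by
  unfold D3 D2
  rw [s.M_symm j i]
  ring

lemma D3_swap' (i j k : Fin n) : s.D3 i j k = s.D3 i k j := by
  unfold D3 D2
  rw [s.M_symm k j]
  ring

/-! ### Leave-out weights as combinations of rows of the annihilator matrix -/

lemma Mc3_eq {i j k : Fin n} (l : Fin n) (h2 : s.D2 j k ≠ 0) :
    s.Mc3 i l j k = (s.D2 j k * s.M i l - (s.M k k * s.M i j - s.M i k * s.M j k) * s.M j l
      - (s.M j j * s.M i k - s.M i j * s.M j k) * s.M k l) / s.D3 i j k := by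
  unfold Mc3 Mc2
  rw [s.D2_symm k j, s.M_symm k j]
  by_cases h3 : s.D3 i j k = 0
  · simp [h3]
  field_simp
  ring

lemma Mc2_self {i j : Fin n} (h : s.D2 i j ≠ 0) : s.Mc2 i i j = 1 := by
  unfold Mc2
  rw [div_eq_one_iff_eq h, D2, s.M_symm j i]
  ring

lemma Mc2_right (i j : Fin n) : s.Mc2 i j j = 0 := by
  unfold Mc2
  rw [mul_comm, sub_self, zero_div]

lemma Mc3_self {i j k : Fin n} (h2 : s.D2 j k ≠ 0) (h3 : s.D3 i j k ≠ 0) :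
    s.Mc3 i i j k = 1 := by
  rw [s.Mc3_eq i h2, div_eq_one_iff_eq h3, D3, D2, s.M_symm j i, s.M_symm k i]
  ring

lemma Mc3_left {i j k : Fin n} (h2 : s.D2 j k ≠ 0) : s.Mc3 i j j k = 0 := by
  rw [s.Mc3_eq j h2, D2, s.M_symm k j]
  ring

lemma Mc3_right {i j k : Fin n} (h2 : s.D2 j k ≠ 0) : s.Mc3 i k j k = 0 := by
  rw [s.Mc3_eq k h2, D2]
  ring

lemma Mc3_swap {i j k : Fin n} (l : Fin n) (h2 : s.D2 j k ≠ 0) :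
    s.Mc3 i l j k = s.Mc3 i l k j := by
  rw [s.Mc3_eq l h2, s.Mc3_eq l (by rwa [s.D2_symm]), s.D3_swap' i k j, s.D2_symm k j,
    s.M_symm k j]
  ring

/-- Leaving out one more observation. -/
lemma Mc2_step {i j : Fin n} (l : Fin n) (hi : s.M i i ≠ 0) (h2 : s.D2 i j ≠ 0) :
    s.Mc2 i l j = s.M i l / s.M i i - s.M i j / s.M i i * s.Mc2 j l i := by
  unfold Mc2
  rw [s.D2_symm j i, s.M_symm j i]
  field_simp
  unfold D2
  ring

/-- Leaving out one more observation. -/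
lemma Mc3_step {i j k : Fin n} (l : Fin n) (hij : s.D2 i j ≠ 0) (hjk : s.D2 j k ≠ 0)
    (h3 : s.D3 i j k ≠ 0) :
    s.Mc3 i l j k = s.Mc2 i l j - s.Mc2 i k j * s.Mc3 k l i j := by
  rw [s.Mc3_eq l hjk, s.Mc3_eq l hij, s.D3_swap k i j, s.D3_swap' i k j]
  unfold Mc2
  field_simp
  unfold D3 D2
  rw [s.M_symm k j, s.M_symm k i]
  ring

/-- Expansion of a leave-three-out weight in which the dependence of every factor on `j` and on
`k` is accompanied by entries of `M`. -/
lemma Mc3_expand {i j k : Fin n} (l : Fin n) (hi : s.M i i ≠ 0) (hij : s.D2 i j ≠ 0)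
    (hik : s.D2 i k ≠ 0) (hjk : s.D2 j k ≠ 0) (h3 : s.D3 i j k ≠ 0) :
    s.Mc3 i l j k = s.M i l / s.M i i - s.M i j / s.M i i * s.Mc2 j l i
      - s.M i k / s.M i i * s.Mc2 k l i
      + s.M i k / s.M i i * s.Mc2 k j i * s.Mc3 j l i k
      + s.M i j / s.M i i * s.Mc2 j k i * s.Mc3 k l i j := by
  have e1 := s.Mc3_step l hij hjk h3
  have e2 := s.Mc2_step l hi hij
  have e3 := s.Mc2_step (j := j) k hi hij
  have e4 : s.Mc3 k l i j = s.Mc2 k l i - s.Mc2 k j i * s.Mc3 j l k i :=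
    s.Mc3_step l (by rwa [s.D2_symm]) hij (by rwa [s.D3_swap, s.D3_swap'])
  rw [s.Mc3_swap (i := j) l (by rwa [s.D2_symm] : s.D2 k i ≠ 0)] at e4
  rw [e1, e2, e3]
  linear_combination (-s.M i k / s.M i i) * e4

end LeaveOut

end IVSample

/-! ### Leave-out residuals and operator bounds -/

namespace IVSample

section Residuals

variable {Ω : Type*} [MeasurableSpace Ω] {P : Measure Ω} {n K L : ℕ}
variable (s : IVSample Ω P n K L)

/-- The weight of observation `l` in the leave-three-out residual of observation `i`. It is `0` for
the observations that are left out, and the residual itself carries observation `i` with weight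
one. -/
def loo (i j k l : Fin n) : ℝ :=
  if l ∈ ({i, j, k} : Finset (Fin n)) then 0 else if j = k then s.Mc2 i l j else s.Mc3 i l j k

lemma gram3_transpose (i j k : Fin n) : (s.gram3 i j k).transpose = s.gram3 i j k := by
  unfold gram3
  rw [Matrix.transpose_sum]
  exact Finset.sum_congr rfl fun l _ => Matrix.transpose_vecMulVec _ _

/-- Weights that are linear in `Q_l` off the left-out observations and reproduce `-Q_i` are the
weights of the leave-three-out fitted value. -/
lemma dotProduct_tauHat_of_weights {i j k : Fin n} (h : IsUnit (s.gram3 i j k)) {u : Fin n → ℝ}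
    {v : Fin K ⊕ Fin L → ℝ} (hv : ∀ l ∉ ({i, j, k} : Finset (Fin n)), u l = v ⬝ᵥ s.Q l)
    (hu : ∑ l ∈ {i, j, k}ᶜ, u l • s.Q l = -s.Q i) (x : Fin n → ℝ) :
    s.Q i ⬝ᵥ s.tauHat x i j k = -∑ l ∈ {i, j, k}ᶜ, u l * x l := by
  have h1 : s.Q i = -(s.gram3 i j k).mulVec v := by
    rw [gram3_mulVec, ← neg_eq_iff_eq_neg, ← hu]
    refine Finset.sum_congr rfl fun l hl => ?_
    rw [hv l (Finset.mem_compl.1 hl), dotProduct_comm]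
  have h2 := Matrix.mul_nonsing_inv _ ((Matrix.isUnit_iff_isUnit_det _).1 h)
  rw [h1, neg_dotProduct, tauHat, ← Matrix.vecMul_transpose, gram3_transpose,
    ← Matrix.dotProduct_mulVec, Matrix.mulVec_mulVec, h2, Matrix.one_mulVec, dotProduct_sum]
  refine congrArg Neg.neg (Finset.sum_congr rfl fun l hl => ?_)
  rw [hv l (Finset.mem_compl.1 hl), dotProduct_smul, smul_eq_mul, mul_comm]

lemma sum_Mc2_smul_Q (hQ : IsUnit (s.Q.transpose * s.Q)) (i j : Fin n) :
    ∑ l, s.Mc2 i l j • s.Q l = 0 := by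
  have e : ∀ l, s.Mc2 i l j • s.Q l
      = (s.M j j / s.D2 i j) • s.M i l • s.Q l - (s.M i j / s.D2 i j) • s.M j l • s.Q l := by
    intro l
    rw [smul_smul, smul_smul, ← sub_smul, Mc2]
    congr 1
    ring
  simp_rw [e]
  rw [Finset.sum_sub_distrib, ← Finset.smul_sum, ← Finset.smul_sum, s.sum_M_smul_Q hQ,
    s.sum_M_smul_Q hQ]
  simp

lemma sum_Mc3_smul_Q (hQ : IsUnit (s.Q.transpose * s.Q)) {i j k : Fin n} (h2 : s.D2 j k ≠ 0) :
    ∑ l, s.Mc3 i l j k • s.Q l = 0 := by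
  have e : ∀ l, s.Mc3 i l j k • s.Q l
      = (s.D2 j k / s.D3 i j k) • s.M i l • s.Q l
        - ((s.M k k * s.M i j - s.M i k * s.M j k) / s.D3 i j k) • s.M j l • s.Q l
        - ((s.M j j * s.M i k - s.M i j * s.M j k) / s.D3 i j k) • s.M k l • s.Q l := by
    intro l
    rw [smul_smul, smul_smul, smul_smul, ← sub_smul, ← sub_smul, s.Mc3_eq l h2]
    congr 1
    ring
  simp_rw [e]
  rw [Finset.sum_sub_distrib, Finset.sum_sub_distrib, ← Finset.smul_sum, ← Finset.smul_sum,
    ← Finset.smul_sum, s.sum_M_smul_Q hQ, s.sum_M_smul_Q hQ, s.sum_M_smul_Q hQ]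
  simp

lemma sum_loo_smul_Q {i j k : Fin n} (h : IsUnit (s.gram3 i j k)) (hij : i ≠ j) (hik : i ≠ k) :
    ∑ l ∈ {i, j, k}ᶜ, s.loo i j k l • s.Q l = -s.Q i := by
  have hQ := s.isUnit_gram h
  have hD := (s.D2_pos h hij).ne'
  by_cases hjk : j = k
  · subst hjk
    have h1 := s.sum_Mc2_smul_Q hQ i j
    rw [← Finset.sum_add_sum_compl {i, j, j}] at h1
    have e : ({i, j, j} : Finset (Fin n)) = {i, j} := by simp
    rw [e, Finset.sum_pair hij, s.Mc2_self hD, s.Mc2_right, one_smul, zero_smul, add_zero] at h1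
    rw [neg_eq_of_add_eq_zero_right h1, e]
    refine Finset.sum_congr rfl fun l hl => ?_
    rw [loo, if_neg (by simpa [e] using hl), if_pos rfl]
  · have hD' : s.D2 j k ≠ 0 :=
      (s.D2_pos (k := i) (by rwa [← s.gram3_swap', ← s.gram3_swap]) hjk).ne'
    have h1 := s.sum_Mc3_smul_Q hQ (i := i) hD'
    rw [← Finset.sum_add_sum_compl {i, j, k}, Finset.sum_insert (by simp [hij, hik]),
      Finset.sum_pair hjk, s.Mc3_self hD' (s.D3_pos h hij hik hjk).ne', s.Mc3_left hD',
      s.Mc3_right hD', one_smul, zero_smul, zero_smul, add_zero, add_zero] at h1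
    rw [neg_eq_of_add_eq_zero_right h1]
    refine Finset.sum_congr rfl fun l hl => ?_
    rw [loo, if_neg (by simpa using hl), if_neg hjk]

lemma dotProduct_tauHat {i j k : Fin n} (h : IsUnit (s.gram3 i j k)) (hij : i ≠ j) (hik : i ≠ k)
    (x : Fin n → ℝ) :
    s.Q i ⬝ᵥ s.tauHat x i j k = -∑ l ∈ {i, j, k}ᶜ, s.loo i j k l * x l := by
  have hD := (s.D2_pos h hij).ne'
  have hwt : ∃ v : Fin K ⊕ Fin L → ℝ, ∀ l ∉ ({i, j, k} : Finset (Fin n)),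
      s.loo i j k l = v ⬝ᵥ s.Q l := by
    by_cases hjk : j = k
    · subst hjk
      refine ⟨-(s.M j j / s.D2 i j) • s.hatCoef i + (s.M i j / s.D2 i j) • s.hatCoef j,
        fun l hl => ?_⟩
      rw [loo, if_neg hl, if_pos rfl]
      simp only [Finset.mem_insert, Finset.mem_singleton, not_or] at hl
      rw [add_dotProduct, smul_dotProduct, smul_dotProduct, Mc2, s.M_apply i l, s.M_apply j l,
        if_neg (Ne.symm hl.1), if_neg (Ne.symm hl.2.1)]
      simp only [smul_eq_mul]
      ring
    · have hD' : s.D2 j k ≠ 0 :=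
        (s.D2_pos (k := i) (by rwa [← s.gram3_swap', ← s.gram3_swap]) hjk).ne'
      refine ⟨-(s.D2 j k / s.D3 i j k) • s.hatCoef i
        + ((s.M k k * s.M i j - s.M i k * s.M j k) / s.D3 i j k) • s.hatCoef j
        + ((s.M j j * s.M i k - s.M i j * s.M j k) / s.D3 i j k) • s.hatCoef k,
        fun l hl => ?_⟩
      rw [loo, if_neg hl, if_neg hjk, s.Mc3_eq l hD']
      simp only [Finset.mem_insert, Finset.mem_singleton, not_or] at hl
      rw [add_dotProduct, add_dotProduct, smul_dotProduct, smul_dotProduct, smul_dotProduct,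
        s.M_apply i l, s.M_apply j l, s.M_apply k l, if_neg (Ne.symm hl.1),
        if_neg (Ne.symm hl.2.1), if_neg (Ne.symm hl.2.2)]
      simp only [smul_eq_mul]
      ring
  obtain ⟨v, hv⟩ := hwt
  exact s.dotProduct_tauHat_of_weights h hv (s.sum_loo_smul_Q h hij hik) x

/-- Leave-three-out residuals remove the part of a variable that is linear in `Q`. -/
lemma residual_eq {i j k : Fin n} (h : IsUnit (s.gram3 i j k)) (hij : i ≠ j) (hik : i ≠ k)
    (θ : Fin K ⊕ Fin L → ℝ) (x τ : Fin n → ℝ) (hx : ∀ l, x l = s.Q l ⬝ᵥ θ + τ l) :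
    x i - s.Q i ⬝ᵥ s.tauHat x i j k = τ i + ∑ l, s.loo i j k l * τ l := by
  rw [s.dotProduct_tauHat h hij hik]
  have h1 : ∑ l, s.loo i j k l * τ l = ∑ l ∈ {i, j, k}ᶜ, s.loo i j k l * τ l := by
    rw [← Finset.sum_add_sum_compl {i, j, k}]
    rw [Finset.sum_eq_zero, zero_add]
    intro l hl
    rw [loo, if_pos hl, zero_mul]
  have h2 : ∑ l ∈ {i, j, k}ᶜ, s.loo i j k l * (s.Q l ⬝ᵥ θ) = -(s.Q i ⬝ᵥ θ) := by
    have := congrArg (fun w => w ⬝ᵥ θ) (s.sum_loo_smul_Q h hij hik)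
    simpa [sum_dotProduct, smul_dotProduct] using this
  simp_rw [hx, mul_add]
  rw [Finset.sum_add_distrib, h2, h1]
  ring

lemma R_eq (l : Fin n) : s.R l = s.Q l ⬝ᵥ Sum.elim s.piX s.gammaX := by
  simp [R, Q, dotProduct, Matrix.fromCols]

lemma RΔ_eq (l : Fin n) : s.RΔ l
    = s.Q l ⬝ᵥ (Sum.elim s.piY s.gammaY - s.β • Sum.elim s.piX s.gammaX) := by
  rw [dotProduct_sub, dotProduct_smul, ← s.R_eq, RΔ, smul_eq_mul, mul_comm]
  congr 1
  simp [RY, Q, dotProduct, Matrix.fromCols]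

lemma e_eq (l : Fin n) (ω : Ω) : s.e s.β l ω = s.RΔ l + s.ν l ω := by
  unfold e Y X RΔ ν
  ring

lemma resX_eq {i j k : Fin n} (h : IsUnit (s.gram3 i j k)) (hij : i ≠ j) (hik : i ≠ k) (ω : Ω) :
    s.resX i i j k ω = s.η i ω + ∑ l, s.loo i j k l * s.η l ω :=
  s.residual_eq h hij hik _ (fun l => s.X l ω) (fun l => s.η l ω)
    fun l => by rw [X, ← s.R_eq]

lemma resE_eq {i j k : Fin n} (h : IsUnit (s.gram3 i j k)) (hij : i ≠ j) (hik : i ≠ k) (ω : Ω) :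
    s.resE s.β i i j k ω = s.ν i ω + ∑ l, s.loo i j k l * s.ν l ω :=
  s.residual_eq h hij hik _ (fun l => s.e s.β l ω) (fun l => s.ν l ω)
    fun l => by rw [e_eq, ← s.RΔ_eq]

lemma resX_swap (a i j k : Fin n) (ω : Ω) : s.resX a i j k ω = s.resX a j i k ω := by
  unfold resX tauHat
  rw [gram3_swap, Finset.insert_comm]

lemma resE_swap (b : ℝ) (a i j k : Fin n) (ω : Ω) : s.resE b a i j k ω = s.resE b a j i k ω := by
  unfold resE tauHat
  rw [gram3_swap, Finset.insert_comm]

/-- The weights `M̌_{ik,-ij}` annihilate `R`. -/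
lemma sum_Mc2_mul_R (hQ : IsUnit (s.Q.transpose * s.Q)) (i j : Fin n) :
    ∑ k, s.Mc2 i k j * s.R k = 0 := by
  have := congrArg (fun w => w ⬝ᵥ Sum.elim s.piX s.gammaX) (s.sum_Mc2_smul_Q hQ i j)
  simpa [sum_dotProduct, smul_dotProduct, s.R_eq] using this

lemma sum_M_sq (hQ : IsUnit (s.Q.transpose * s.Q)) (i : Fin n) :
    ∑ l, s.M i l ^ 2 = s.M i i := by
  rw [← s.sum_M_mul_M hQ]
  exact Finset.sum_congr rfl fun l _ => sq _

lemma M_diag_le_one {i : Fin n} (h : IsUnit (s.gram3 i i i)) : s.M i i ≤ 1 := by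
  have h1 := Finset.single_le_sum (f := fun l => s.M i l ^ 2) (fun _ _ => sq_nonneg _)
    (Finset.mem_univ i)
  simp only [s.sum_M_sq (s.isUnit_gram h)] at h1
  have h2 := s.M_diag_pos h
  nlinarith

lemma D3_le_D2 (h : ∀ i j k, IsUnit (s.gram3 i j k)) {i j k : Fin n} (hij : i ≠ j) (hik : i ≠ k)
    (hjk : j ≠ k) : s.D3 i j k ≤ s.D2 j k := by
  have h0 : 0 ≤ s.M i k ^ 2 * s.M j j + s.M i j ^ 2 * s.M k k
      - 2 * s.M i k * s.M i j * s.M j k := by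
    by_cases hz : s.M i k = 0 ∧ s.M i j = 0
    · simp [hz.1, hz.2]
    · have := s.quadForm_pos (h i j k) (α := 0) (β := s.M i k) (γ := -s.M i j)
        (fun e => absurd e hij) (fun e => absurd e hik) (fun e => absurd e hjk)
        (by simpa using hz)
      linarith
  have h2 : 0 < s.D2 j k := s.D2_pos (h j k i) hjk
  have h3 := s.M_diag_le_one (h i i i)
  unfold D3
  nlinarith

/-- Without regressors, `M` is the identity. -/
lemma M_eq_one [IsEmpty (Fin K ⊕ Fin L)] : s.M = 1 := by
  have : hatMatrix s.Q = 0 := by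
    ext i j
    simp [hatMatrix, Matrix.mul_apply]
  rw [M, this, sub_zero]

end Residuals

section OperatorBounds

variable {Ω : Type*} [MeasurableSpace Ω] {P : Measure Ω} {n K L : ℕ}

/-- The leave-three-out designs are invertible and the leave-out determinants are at least `δ`. -/
structure WellPosed (s : IVSample Ω P n K L) (δ : ℝ) : Prop where
  pos : 0 < δ
  inv : ∀ i j k, IsUnit (s.gram3 i j k)
  le_M : ∀ i, δ ≤ s.M i i
  le_D2 : ∀ {i j}, i ≠ j → δ ≤ s.D2 i j
  le_D3 : ∀ i j k, i ≠ j → i ≠ k → j ≠ k → δ ≤ s.D3 i j k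

/-- The lower bound on the determinants `D_{ijk}` is inherited by the smaller ones. With fewer than
three observations, where no `D_{ijk}` exists, invertibility leaves no room for regressors. -/
lemma wellPosed_of_le_D3 {s : IVSample Ω P n K L} {δ : ℝ} (hδ : 0 < δ) (hδ1 : δ ≤ 1)
    (h : ∀ i j k, IsUnit (s.gram3 i j k))
    (h3 : ∀ i j k, i ≠ j → i ≠ k → j ≠ k → δ ≤ s.D3 i j k) : s.WellPosed δ := by
  by_cases hn : 3 ≤ n
  · have hex : ∀ i j : Fin n, ∃ k, k ≠ i ∧ k ≠ j := fun i j => by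
      have h1 : ({i, j} : Finset (Fin n)).card < (Finset.univ : Finset (Fin n)).card := by
        rw [Finset.card_univ, Fintype.card_fin]
        exact (Finset.card_le_two).trans_lt hn
      obtain ⟨k, -, hk⟩ := Finset.exists_mem_notMem_of_card_lt_card h1
      exact ⟨k, by simpa using hk⟩
    have h2 : ∀ {i j}, i ≠ j → δ ≤ s.D2 i j := fun {i j} hij => by
      obtain ⟨k, hk1, hk2⟩ := hex i j
      exact (h3 k i j hk1 hk2 hij).trans (s.D3_le_D2 h hk1 hk2 hij)
    refine ⟨hδ, h, fun i => ?_, h2, h3⟩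
    obtain ⟨j, hj, -⟩ := hex i i
    have h1 := h2 (Ne.symm hj)
    have h4 := s.M_diag_le_one (h j j j)
    have h5 := s.M_diag_pos (h i i i)
    unfold D2 at h1
    nlinarith [sq_nonneg (s.M i j)]
  · have hM : Nonempty (Fin n) → s.M = 1 := fun ⟨i₀⟩ => by
      obtain ⟨i, j, hij⟩ : ∃ i j : Fin n, ∀ l, l = i ∨ l = j := by
        refine ⟨⟨0, i₀.pos⟩, ⟨n - 1, Nat.sub_lt i₀.pos one_pos⟩, fun l => ?_⟩
        have := l.2
        simp only [Fin.ext_iff]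
        omega
      have h0 : s.gram3 i j j = 0 := by
        rw [gram3, Finset.compl_eq_empty_iff _ |>.2 _, Finset.sum_empty]
        ext l
        simpa using hij l
      have h1 := h i j j
      rw [h0, isUnit_zero_iff] at h1
      have : IsEmpty (Fin K ⊕ Fin L) := by
        by_contra hne
        rw [not_isEmpty_iff] at hne
        exact zero_ne_one h1
      exact s.M_eq_one
    refine ⟨hδ, h, fun i => ?_, fun {i j} hij => ?_, h3⟩
    · rw [hM ⟨i⟩]
      simpa
    · rw [D2, hM ⟨i⟩]
      simpa [Matrix.one_apply, hij]

variable {s : IVSample Ω P n K L} {δ : ℝ} (h : s.WellPosed δ)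
include h

namespace WellPosed

lemma gram (i : Fin n) : IsUnit (s.Q.transpose * s.Q) := s.isUnit_gram (h.inv i i i)

lemma M_diag_le (i : Fin n) : s.M i i ≤ 1 := s.M_diag_le_one (h.inv i i i)

lemma sum_M_sq_le (i : Fin n) : ∑ l, s.M i l ^ 2 ≤ 1 := (s.sum_M_sq (h.gram i) i).trans_le (h.M_diag_le i)

lemma sum_M_sq_le' (l : Fin n) : ∑ i, s.M i l ^ 2 ≤ 1 := by
  simpa only [s.M_symm _ l] using h.sum_M_sq_le l

lemma M_sq_le (i j : Fin n) : s.M i j ^ 2 ≤ 1 :=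
  (Finset.single_le_sum (f := fun l => s.M i l ^ 2) (fun _ _ => sq_nonneg _)
    (Finset.mem_univ j)).trans (h.sum_M_sq_le i)

lemma abs_M_le (i j : Fin n) : |s.M i j| ≤ 1 := by
  rw [← sq_le_one_iff_abs_le_one]
  exact h.M_sq_le i j

lemma M_ne (i : Fin n) : s.M i i ≠ 0 := (h.pos.trans_le (h.le_M i)).ne'

lemma D2_ne {i j : Fin n} (hij : i ≠ j) : s.D2 i j ≠ 0 := (h.pos.trans_le (h.le_D2 hij)).ne'

lemma D3_ne {i j k : Fin n} (hij : i ≠ j) (hik : i ≠ k) (hjk : j ≠ k) : s.D3 i j k ≠ 0 :=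
  (h.pos.trans_le (h.le_D3 i j k hij hik hjk)).ne'

lemma D2_le_one (i j : Fin n) : s.D2 i j ≤ 1 := by
  have h1 := h.M_diag_le i
  have h2 := h.M_diag_le j
  have h3 := s.M_diag_pos (h.inv i i i)
  have h4 := s.M_diag_pos (h.inv j j j)
  unfold D2
  nlinarith [sq_nonneg (s.M i j)]

/-- `M` is a projection, hence a contraction. -/
lemma sum_sq_comb_le (x : Fin n → ℝ) : ∑ l, (∑ i, x i * s.M i l) ^ 2 ≤ ∑ i, x i ^ 2 := by
  have e1 : ∑ l, (∑ i, x i * s.M i l) ^ 2 = ∑ l, x l * ∑ i, x i * s.M i l := by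
    have : ∀ l, (∑ i, x i * s.M i l) ^ 2 = ∑ i, ∑ j, x i * x j * (s.M i l * s.M j l) := by
      intro l
      rw [sq, Finset.sum_mul_sum]
      exact Finset.sum_congr rfl fun i _ => Finset.sum_congr rfl fun j _ => by ring
    simp_rw [this]
    rw [Finset.sum_comm]
    refine Finset.sum_congr rfl fun i _ => ?_
    rw [Finset.sum_comm, Finset.mul_sum]
    refine Finset.sum_congr rfl fun j _ => ?_
    rw [← Finset.mul_sum, s.sum_M_mul_M (h.gram i), s.M_symm i j]
    ring
  have e2 : 0 ≤ ∑ l, (x l - ∑ i, x i * s.M i l) ^ 2 := Finset.sum_nonneg fun _ _ => sq_nonneg _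
  have e3 : ∑ l, (x l - ∑ i, x i * s.M i l) ^ 2
      = ∑ l, x l ^ 2 - 2 * (∑ l, x l * ∑ i, x i * s.M i l) + ∑ l, (∑ i, x i * s.M i l) ^ 2 := by
    rw [Finset.mul_sum, ← Finset.sum_sub_distrib, ← Finset.sum_add_distrib]
    exact Finset.sum_congr rfl fun l _ => by ring
  rw [e3, ← e1] at e2
  linarith

lemma abs_Mc2_le {i j : Fin n} (hij : i ≠ j) (l : Fin n) :
    |s.Mc2 i l j| ≤ (|s.M i l| + |s.M i j| * |s.M j l|) / δ := by
  unfold Mc2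
  have hD := h.le_D2 hij
  rw [abs_div, abs_of_pos (h.pos.trans_le hD)]
  refine div_le_div₀ (by positivity) ?_ h.pos hD
  refine (abs_sub _ _).trans ?_
  rw [abs_mul, abs_mul]
  have := mul_le_mul_of_nonneg_right (h.abs_M_le j j) (abs_nonneg (s.M i l))
  linarith

/-- Combinations of leave-two-out weights: `M̌_{il,-ij}` is a combination of the rows `i` and `j` of
`M` with coefficients at most `1 / δ`, and `M` is a contraction. -/
lemma sum_sq_comb_Mc2_le {x : Fin n → Fin n → ℝ} (hx : ∀ i, x i i = 0) :
    ∑ l, (∑ i, ∑ j, x i j * s.Mc2 i l j) ^ 2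
      ≤ 2 / δ ^ 2 * (∑ i, (∑ j, |x i j|) ^ 2 + ∑ j, (∑ i, |x i j|) ^ 2) := by
  have hδ := h.pos
  set p : Fin n → ℝ := fun i => ∑ j, x i j * (s.M j j / s.D2 i j) with hp
  set q : Fin n → ℝ := fun j => ∑ i, x i j * (s.M i j / s.D2 i j) with hq
  have e : ∀ l, ∑ i, ∑ j, x i j * s.Mc2 i l j = ∑ i, p i * s.M i l - ∑ j, q j * s.M j l := by
    intro l
    simp only [hp, hq, Finset.sum_mul]
    rw [Finset.sum_comm (f := fun j i => x i j * (s.M i j / s.D2 i j) * s.M j l),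
      ← Finset.sum_sub_distrib]
    refine Finset.sum_congr rfl fun i _ => ?_
    rw [← Finset.sum_sub_distrib]
    refine Finset.sum_congr rfl fun j _ => ?_
    unfold Mc2
    ring
  have hb : ∀ i j (m : ℝ), |m| ≤ 1 → |x i j * (m / s.D2 i j)| ≤ |x i j| / δ := by
    intro i j m hm
    by_cases hij : i = j
    · subst hij
      simp [hx]
    · have hD := h.le_D2 hij
      rw [abs_mul, abs_div, abs_of_pos (hδ.trans_le hD), div_eq_mul_one_div |x i j| δ]
      exact mul_le_mul_of_nonneg_left (div_le_div₀ zero_le_one hm hδ hD) (abs_nonneg _)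
  have hpb : ∀ i, p i ^ 2 ≤ (∑ j, |x i j|) ^ 2 / δ ^ 2 := by
    intro i
    rw [← div_pow]
    refine sq_le_sq' ?_ ?_ <;> [refine neg_le_of_abs_le ?_; refine le_of_abs_le ?_] <;>
    · rw [Finset.sum_div]
      exact (Finset.abs_sum_le_sum_abs _ _).trans
        (Finset.sum_le_sum fun j _ => hb i j _ (h.abs_M_le j j))
  have hqb : ∀ j, q j ^ 2 ≤ (∑ i, |x i j|) ^ 2 / δ ^ 2 := by
    intro j
    rw [← div_pow]
    refine sq_le_sq' ?_ ?_ <;> [refine neg_le_of_abs_le ?_; refine le_of_abs_le ?_] <;>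
    · rw [Finset.sum_div]
      exact (Finset.abs_sum_le_sum_abs _ _).trans
        (Finset.sum_le_sum fun i _ => hb i j _ (h.abs_M_le i j))
  calc ∑ l, (∑ i, ∑ j, x i j * s.Mc2 i l j) ^ 2
      ≤ ∑ l, (2 * (∑ i, p i * s.M i l) ^ 2 + 2 * (∑ j, q j * s.M j l) ^ 2) := by
        refine Finset.sum_le_sum fun l _ => ?_
        rw [e]
        nlinarith [sq_nonneg (∑ i, p i * s.M i l + ∑ j, q j * s.M j l)]
    _ ≤ 2 * ∑ i, p i ^ 2 + 2 * ∑ j, q j ^ 2 := by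
        rw [Finset.sum_add_distrib, ← Finset.mul_sum, ← Finset.mul_sum]
        have := h.sum_sq_comb_le p
        have := h.sum_sq_comb_le q
        linarith
    _ ≤ 2 * ∑ i, (∑ j, |x i j|) ^ 2 / δ ^ 2 + 2 * ∑ j, (∑ i, |x i j|) ^ 2 / δ ^ 2 := by
        have := Finset.sum_le_sum fun i (_ : i ∈ Finset.univ) => hpb i
        have := Finset.sum_le_sum fun i (_ : i ∈ Finset.univ) => hqb i
        linarith
    _ = _ := by
        rw [← Finset.sum_div, ← Finset.sum_div]
        ring

/-- Combinations of leave-three-out weights: `M̌_{il,-ijk}` is a combination of the rows `i`, `j`, `k`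
of `M` with bounded coefficients, and `M` is a contraction. -/
lemma sum_sq_comb_Mc3_le {x : Fin n → Fin n → Fin n → ℝ}
    (hx : ∀ i j k, i = j ∨ i = k ∨ j = k → x i j k = 0) :
    ∑ l, (∑ i, ∑ j, ∑ k, x i j k * s.Mc3 i l j k) ^ 2
      ≤ 12 / δ ^ 2 * (∑ i, (∑ j, ∑ k, |x i j k|) ^ 2 + ∑ j, (∑ i, ∑ k, |x i j k|) ^ 2
        + ∑ k, (∑ i, ∑ j, |x i j k|) ^ 2) := by
  have hδ := h.pos
  have hb : ∀ i j k (m : ℝ), |m| ≤ 2 → |x i j k * (m / s.D3 i j k)| ≤ |x i j k| * (2 / δ) := by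
    intro i j k m hm
    by_cases hijk : i = j ∨ i = k ∨ j = k
    · simp [hx i j k hijk]
    · push Not at hijk
      have hD := h.le_D3 i j k hijk.1 hijk.2.1 hijk.2.2
      rw [abs_mul, abs_div, abs_of_pos (hδ.trans_le hD)]
      exact mul_le_mul_of_nonneg_left (div_le_div₀ zero_le_two hm hδ hD) (abs_nonneg _)
  have hc1 : ∀ i j k, |s.D2 j k * 1| ≤ 2 ∨ i = j ∨ i = k ∨ j = k := by
    intro i j k
    by_cases hjk : j = k
    · exact Or.inr (Or.inr (Or.inr hjk))
    · left
      rw [mul_one, abs_of_pos (hδ.trans_le (h.le_D2 hjk))]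
      linarith [h.D2_le_one j k]
  have hc2 : ∀ i j k, |s.M k k * s.M i j - s.M i k * s.M j k| ≤ 2 := by
    intro i j k
    refine (abs_sub _ _).trans ?_
    rw [abs_mul, abs_mul]
    have := mul_le_one₀ (h.abs_M_le k k) (abs_nonneg _) (h.abs_M_le i j)
    have := mul_le_one₀ (h.abs_M_le i k) (abs_nonneg _) (h.abs_M_le j k)
    linarith
  set p : Fin n → ℝ := fun i => ∑ j, ∑ k, x i j k * (s.D2 j k / s.D3 i j k) with hp
  set q : Fin n → ℝ := fun j => ∑ i, ∑ k, x i j k *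
    ((s.M k k * s.M i j - s.M i k * s.M j k) / s.D3 i j k) with hq
  set r : Fin n → ℝ := fun k => ∑ i, ∑ j, x i j k *
    ((s.M j j * s.M i k - s.M i j * s.M k j) / s.D3 i j k) with hr
  have e : ∀ l, ∑ i, ∑ j, ∑ k, x i j k * s.Mc3 i l j k
      = ∑ i, p i * s.M i l - ∑ j, q j * s.M j l - ∑ k, r k * s.M k l := by
    intro l
    simp only [hp, hq, hr, Finset.sum_mul]
    rw [Finset.sum_comm (f := fun j i => ∑ k, x i j k *
        ((s.M k k * s.M i j - s.M i k * s.M j k) / s.D3 i j k) * s.M j l),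
      Finset.sum_comm (f := fun k i => ∑ j, x i j k *
        ((s.M j j * s.M i k - s.M i j * s.M k j) / s.D3 i j k) * s.M k l),
      ← Finset.sum_sub_distrib, ← Finset.sum_sub_distrib]
    refine Finset.sum_congr rfl fun i _ => ?_
    rw [Finset.sum_comm (f := fun k j => x i j k *
        ((s.M j j * s.M i k - s.M i j * s.M k j) / s.D3 i j k) * s.M k l),
      ← Finset.sum_sub_distrib, ← Finset.sum_sub_distrib]
    refine Finset.sum_congr rfl fun j _ => ?_
    rw [← Finset.sum_sub_distrib, ← Finset.sum_sub_distrib]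
    refine Finset.sum_congr rfl fun k _ => ?_
    by_cases hijk : i = j ∨ i = k ∨ j = k
    · simp [hx i j k hijk]
    · push Not at hijk
      rw [s.Mc3_eq l (h.D2_ne hijk.2.2), s.M_symm k j]
      ring
  have hbd : ∀ (y : Fin n → Fin n → ℝ) (z : Fin n → Fin n → ℝ),
      (∀ j k, |y j k| ≤ z j k * (2 / δ)) →
      (∑ j, ∑ k, y j k) ^ 2 ≤ 4 / δ ^ 2 * (∑ j, ∑ k, z j k) ^ 2 := by
    intro y z hyz
    have h1 : |∑ j, ∑ k, y j k| ≤ 2 / δ * ∑ j, ∑ k, z j k := by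
      simp only [Finset.mul_sum]
      refine (Finset.abs_sum_le_sum_abs _ _).trans (Finset.sum_le_sum fun j _ => ?_)
      refine (Finset.abs_sum_le_sum_abs _ _).trans (Finset.sum_le_sum fun k _ => ?_)
      rw [mul_comm]
      exact hyz j k
    calc _ = |∑ j, ∑ k, y j k| ^ 2 := (sq_abs _).symm
      _ ≤ (2 / δ * ∑ j, ∑ k, z j k) ^ 2 := by gcongr
      _ = _ := by ring
  have hpb : ∀ i, p i ^ 2 ≤ 4 / δ ^ 2 * (∑ j, ∑ k, |x i j k|) ^ 2 := fun i =>
    hbd _ _ fun j k => by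
      rcases hc1 i j k with h1 | h1
      · exact hb i j k _ (by simpa using h1)
      · simp [hx i j k h1]
  have hqb : ∀ j, q j ^ 2 ≤ 4 / δ ^ 2 * (∑ i, ∑ k, |x i j k|) ^ 2 := fun j =>
    hbd _ _ fun i k => hb i j k _ (hc2 i j k)
  have hrb : ∀ k, r k ^ 2 ≤ 4 / δ ^ 2 * (∑ i, ∑ j, |x i j k|) ^ 2 := fun k =>
    hbd _ _ fun i j => hb i j k _ (hc2 i k j)
  have hsum : ∀ f g : Fin n → ℝ, (∀ i, f i ≤ 4 / δ ^ 2 * g i) →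
      ∑ i, f i ≤ 4 / δ ^ 2 * ∑ i, g i := fun f g hfg => by
    rw [Finset.mul_sum]
    exact Finset.sum_le_sum fun i _ => hfg i
  calc ∑ l, (∑ i, ∑ j, ∑ k, x i j k * s.Mc3 i l j k) ^ 2
      ≤ ∑ l, (3 * (∑ i, p i * s.M i l) ^ 2 + 3 * (∑ j, q j * s.M j l) ^ 2
          + 3 * (∑ k, r k * s.M k l) ^ 2) := by
        refine Finset.sum_le_sum fun l _ => ?_
        rw [e]
        nlinarith [sq_nonneg (∑ i, p i * s.M i l + ∑ j, q j * s.M j l),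
          sq_nonneg (∑ i, p i * s.M i l + ∑ j, r j * s.M j l),
          sq_nonneg (∑ i, q i * s.M i l - ∑ j, r j * s.M j l)]
    _ ≤ 3 * ∑ i, p i ^ 2 + 3 * ∑ j, q j ^ 2 + 3 * ∑ k, r k ^ 2 := by
        rw [Finset.sum_add_distrib, Finset.sum_add_distrib, ← Finset.mul_sum, ← Finset.mul_sum,
          ← Finset.mul_sum]
        have := h.sum_sq_comb_le p
        have := h.sum_sq_comb_le q
        have := h.sum_sq_comb_le r
        linarith
    _ ≤ _ := by
        have h1 := hsum _ _ hpb
        have h2 := hsum _ _ hqb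
        have h3 := hsum _ _ hrb
        have e2 : 12 / δ ^ 2 = 3 * (4 / δ ^ 2) := by ring
        rw [e2]
        linarith

end WellPosed

end OperatorBounds

end IVSample

/-! ### Contracted coefficients of the fourth-order forms -/

namespace IVSample

section DeterministicBounds

lemma sq_sum_sum_mul_le {α β : Type*} [Fintype α] [Fintype β] (f g : α → β → ℝ) :
    (∑ i, ∑ j, f i j * g i j) ^ 2 ≤ (∑ i, ∑ j, f i j ^ 2) * ∑ i, ∑ j, g i j ^ 2 := by
  simp only [← Fintype.sum_prod_type']
  exact Finset.sum_mul_sq_le_sq_mul_sq _ _ _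

lemma sq_sum_mul_le {α : Type*} [Fintype α] (f g : α → ℝ) :
    (∑ i, f i * g i) ^ 2 ≤ (∑ i, f i ^ 2) * ∑ i, g i ^ 2 :=
  Finset.sum_mul_sq_le_sq_mul_sq _ _ _

lemma sq_le_sq_of_abs_le {x B : ℝ} (hx : |x| ≤ B) : x ^ 2 ≤ B ^ 2 := by
  rw [← sq_abs]
  gcongr

lemma sq_six_le (a b c d e f : ℝ) : (a - b - c + d + e - f) ^ 2
    ≤ 6 * (a ^ 2 + b ^ 2 + c ^ 2 + d ^ 2 + e ^ 2 + f ^ 2) := by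
  have h := Finset.sum_mul_sq_le_sq_mul_sq Finset.univ ![a, b, c, d, e, f] ![1, -1, -1, 1, 1, -1]
  simp only [Fin.sum_univ_succ, Matrix.cons_val_zero, Matrix.cons_val_succ, Finset.univ_unique,
    Finset.sum_singleton, Fin.default_eq_zero] at h
  norm_num at h
  have e : a - b - c + d + e - f = a + (-b + (-c + (d + (e + -f)))) := by ring
  rw [e]
  linarith

variable {Ω : Type*} [MeasurableSpace Ω] {P : Measure Ω} {n K L : ℕ}
  {s : IVSample Ω P n K L} {δ : ℝ} (h : s.WellPosed δ)
include h

namespace WellPosed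

/-- The extra entry `M_{ij}` turns the `ℓ¹` bounds of `sum_sq_comb_Mc2_le` into an `ℓ²` bound, since
the rows of `M` have norm at most one. -/
lemma sum_sq_M_mul_Mc2_le {y : Fin n → Fin n → ℝ} (hy : ∀ i, y i i = 0) :
    ∑ l, (∑ j, ∑ i, s.M i j / s.M i i * y i j * s.Mc2 j l i) ^ 2
      ≤ 4 / δ ^ 4 * ∑ i, ∑ j, y i j ^ 2 := by
  have hδ := h.pos
  have h1 := h.sum_sq_comb_Mc2_le (x := fun j i => s.M i j / s.M i i * y i j)
    (fun i => by simp [hy])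
  have hM : ∀ i j, |s.M i j / s.M i i * y i j| ≤ |s.M i j| * |y i j| / δ := by
    intro i j
    rw [abs_mul, abs_div, abs_of_pos (hδ.trans_le (h.le_M i)), div_mul_eq_mul_div]
    exact div_le_div_of_nonneg_left (by positivity) hδ (h.le_M i)
  have h2 : ∀ j, (∑ i, |s.M i j / s.M i i * y i j|) ^ 2 ≤ 1 / δ ^ 2 * ∑ i, y i j ^ 2 := by
    intro j
    calc (∑ i, |s.M i j / s.M i i * y i j|) ^ 2 ≤ (∑ i, |s.M i j| * |y i j| / δ) ^ 2 := by
          gcongr with i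
          exact hM i j
      _ = 1 / δ ^ 2 * (∑ i, |s.M i j| * |y i j|) ^ 2 := by
          rw [← Finset.sum_div, div_pow]; ring
      _ ≤ 1 / δ ^ 2 * (1 * ∑ i, y i j ^ 2) := by
          gcongr
          refine (sq_sum_mul_le _ _).trans ?_
          simp only [sq_abs]
          gcongr
          exact h.sum_M_sq_le' j
      _ = _ := by rw [one_mul]
  have h3 : ∀ i, (∑ j, |s.M i j / s.M i i * y i j|) ^ 2 ≤ 1 / δ ^ 2 * ∑ j, y i j ^ 2 := by
    intro i
    calc (∑ j, |s.M i j / s.M i i * y i j|) ^ 2 ≤ (∑ j, |s.M i j| * |y i j| / δ) ^ 2 := by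
          gcongr with j
          exact hM i j
      _ = 1 / δ ^ 2 * (∑ j, |s.M i j| * |y i j|) ^ 2 := by
          rw [← Finset.sum_div, div_pow]; ring
      _ ≤ 1 / δ ^ 2 * (1 * ∑ j, y i j ^ 2) := by
          gcongr
          refine (sq_sum_mul_le _ _).trans ?_
          simp only [sq_abs]
          gcongr
          exact h.sum_M_sq_le i
      _ = _ := by rw [one_mul]
  have h4 := Finset.sum_le_sum fun j (_ : j ∈ Finset.univ) => h2 j
  have h5 := Finset.sum_le_sum fun i (_ : i ∈ Finset.univ) => h3 i
  rw [← Finset.mul_sum] at h4 h5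
  rw [Finset.sum_comm] at h4
  refine h1.trans ?_
  calc 2 / δ ^ 2 * (∑ j, (∑ i, |s.M i j / s.M i i * y i j|) ^ 2
        + ∑ i, (∑ j, |s.M i j / s.M i i * y i j|) ^ 2)
      ≤ 2 / δ ^ 2 * (1 / δ ^ 2 * ∑ i, ∑ j, y i j ^ 2 + 1 / δ ^ 2 * ∑ i, ∑ j, y i j ^ 2) := by
        gcongr
    _ = _ := by
        field_simp
        ring

/-- With two further entries of `M`, the coefficients of leave-three-out weights need only be square
summable. -/
lemma sum_sq_M_mul_Mc3_le {w : Fin n → Fin n → Fin n → ℝ}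
    (hw : ∀ i j k, i = j ∨ i = k ∨ j = k → w i j k = 0) :
    ∑ l, (∑ k, ∑ i, ∑ j, w i j k * (s.M i j / s.M i i * s.Mc2 j k i) * s.Mc3 k l i j) ^ 2
      ≤ 144 / δ ^ 6 * ∑ i, ∑ j, ∑ k, w i j k ^ 2 := by
  have hδ := h.pos
  set z : Fin n → Fin n → Fin n → ℝ := fun i j k =>
    if i = j then 0 else |s.M i j / s.M i i * s.Mc2 j k i| with hz
  have hwz : ∀ i j k, |w i j k * (s.M i j / s.M i i * s.Mc2 j k i)| = |w i j k| * z i j k := by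
    intro i j k
    by_cases hij : i = j
    · simp [hw i j k (Or.inl hij)]
    · simp only [hz, if_neg hij, abs_mul]
  have hzb : ∀ i j k, z i j k ^ 2
      ≤ 2 / δ ^ 4 * (s.M i j ^ 2 * s.M j k ^ 2 + s.M i j ^ 2 * s.M i k ^ 2) := by
    intro i j k
    by_cases hij : i = j
    · simp only [hz, if_pos hij, zero_pow two_ne_zero]
      positivity
    · simp only [hz, if_neg hij]
      have h1 := h.abs_Mc2_le (Ne.symm hij) k
      rw [s.M_symm j i] at h1
      have h2 := h.M_sq_le i j
      have h3 : |s.M i j / s.M i i| ≤ |s.M i j| / δ := by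
        rw [abs_div, abs_of_pos (hδ.trans_le (h.le_M i))]
        exact div_le_div_of_nonneg_left (abs_nonneg _) hδ (h.le_M i)
      calc |s.M i j / s.M i i * s.Mc2 j k i| ^ 2
          ≤ (|s.M i j| / δ * ((|s.M j k| + |s.M i j| * |s.M i k|) / δ)) ^ 2 := by
            rw [abs_mul]
            gcongr
        _ = 1 / δ ^ 4 * (s.M i j ^ 2 * (|s.M j k| + |s.M i j| * |s.M i k|) ^ 2) := by
            rw [← sq_abs (s.M i j)]
            field_simp
        _ ≤ 1 / δ ^ 4 * (s.M i j ^ 2 * (2 * s.M j k ^ 2 + 2 * s.M i k ^ 2)) := by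
            gcongr
            have e1 : (|s.M i j| * |s.M i k|) ^ 2 ≤ s.M i k ^ 2 := by
              rw [mul_pow, sq_abs, sq_abs]
              exact mul_le_of_le_one_left (sq_nonneg _) h2
            have e2 := add_sq_le (a := |s.M j k|) (b := |s.M i j| * |s.M i k|)
            rw [sq_abs] at e2
            linarith
        _ = _ := by ring
  have key : ∀ {f : Fin n → Fin n → ℝ} {g : Fin n → Fin n → ℝ} {p q : Fin n → Fin n → ℝ},
      (∀ a b, g a b ^ 2 ≤ 2 / δ ^ 4 * (p a b + q a b)) → ∑ a, ∑ b, p a b ≤ 1 →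
      ∑ a, ∑ b, q a b ≤ 1 →
      (∑ a, ∑ b, |f a b| * g a b) ^ 2 ≤ 4 / δ ^ 4 * ∑ a, ∑ b, f a b ^ 2 := by
    intro f g p q hg hp hq
    refine (sq_sum_sum_mul_le _ _).trans ?_
    simp only [sq_abs]
    rw [mul_comm]
    gcongr
    calc ∑ a, ∑ b, g a b ^ 2 ≤ ∑ a, ∑ b, 2 / δ ^ 4 * (p a b + q a b) :=
          Finset.sum_le_sum fun a _ => Finset.sum_le_sum fun b _ => hg a b
      _ = 2 / δ ^ 4 * (∑ a, ∑ b, p a b + ∑ a, ∑ b, q a b) := by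
          simp only [← Finset.mul_sum, Finset.sum_add_distrib]
      _ ≤ 2 / δ ^ 4 * (1 + 1) := by gcongr
      _ = _ := by ring
  have s1 : ∀ (p : Fin n → ℝ) (q : Fin n → Fin n → ℝ), (∀ a, 0 ≤ p a) → ∑ a, p a ≤ 1 →
      (∀ a, ∑ b, q a b ≤ 1) → ∑ a, ∑ b, p a * q a b ≤ 1 := by
    intro p q h0 hp hq
    refine le_trans (Finset.sum_le_sum fun a _ => ?_) hp
    rw [← Finset.mul_sum]
    exact mul_le_of_le_one_right (h0 a) (hq a)
  have A1 : ∀ k, (∑ i, ∑ j, |w i j k * (s.M i j / s.M i i * s.Mc2 j k i)|) ^ 2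
      ≤ 4 / δ ^ 4 * ∑ i, ∑ j, w i j k ^ 2 := by
    intro k
    simp only [hwz]
    refine key (fun i j => hzb i j k) ?_ ?_
    · rw [Finset.sum_comm]
      simp_rw [mul_comm (s.M _ _ ^ 2) (s.M _ k ^ 2)]
      exact s1 _ _ (fun _ => sq_nonneg _) (h.sum_M_sq_le' k) fun j => h.sum_M_sq_le' j
    · simp_rw [mul_comm (s.M _ _ ^ 2) (s.M _ k ^ 2)]
      exact s1 _ _ (fun _ => sq_nonneg _) (h.sum_M_sq_le' k) fun j => h.sum_M_sq_le j
  have A2 : ∀ i, (∑ k, ∑ j, |w i j k * (s.M i j / s.M i i * s.Mc2 j k i)|) ^ 2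
      ≤ 4 / δ ^ 4 * ∑ k, ∑ j, w i j k ^ 2 := by
    intro i
    simp only [hwz]
    refine key (fun k j => hzb i j k) ?_ ?_
    · rw [Finset.sum_comm]
      exact s1 _ _ (fun _ => sq_nonneg _) (h.sum_M_sq_le i) fun j => h.sum_M_sq_le j
    · rw [Finset.sum_comm]
      exact s1 _ _ (fun _ => sq_nonneg _) (h.sum_M_sq_le i) fun j => h.sum_M_sq_le i
  have A3 : ∀ j, (∑ k, ∑ i, |w i j k * (s.M i j / s.M i i * s.Mc2 j k i)|) ^ 2
      ≤ 4 / δ ^ 4 * ∑ k, ∑ i, w i j k ^ 2 := by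
    intro j
    simp only [hwz]
    refine key (fun k i => hzb i j k) ?_ ?_
    · rw [Finset.sum_comm]
      exact s1 _ _ (fun _ => sq_nonneg _) (h.sum_M_sq_le' j) fun i => h.sum_M_sq_le j
    · rw [Finset.sum_comm]
      exact s1 _ _ (fun _ => sq_nonneg _) (h.sum_M_sq_le' j) fun i => h.sum_M_sq_le i
  have B1 := Finset.sum_le_sum fun k (_ : k ∈ Finset.univ) => A1 k
  have B2 := Finset.sum_le_sum fun k (_ : k ∈ Finset.univ) => A2 k
  have B3 := Finset.sum_le_sum fun k (_ : k ∈ Finset.univ) => A3 k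
  rw [← Finset.mul_sum] at B1 B2 B3
  have c1 : ∑ k, ∑ i, ∑ j, w i j k ^ 2 = ∑ i, ∑ j, ∑ k, w i j k ^ 2 := by
    rw [Finset.sum_comm]
    exact Finset.sum_congr rfl fun i _ => Finset.sum_comm
  have c2 : ∑ i, ∑ k, ∑ j, w i j k ^ 2 = ∑ i, ∑ j, ∑ k, w i j k ^ 2 :=
    Finset.sum_congr rfl fun i _ => Finset.sum_comm
  have c3 : ∑ j, ∑ k, ∑ i, w i j k ^ 2 = ∑ i, ∑ j, ∑ k, w i j k ^ 2 := by
    rw [Finset.sum_comm (f := fun i j => ∑ k, w i j k ^ 2)]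
    exact Finset.sum_congr rfl fun i _ => Finset.sum_comm
  rw [c1] at B1
  rw [c2] at B2
  rw [c3] at B3
  have h1 := h.sum_sq_comb_Mc3_le
    (x := fun k i j => w i j k * (s.M i j / s.M i i * s.Mc2 j k i)) (by
      intro k i j hk
      rw [hw i j k (by tauto), zero_mul])
  refine h1.trans ?_
  calc _ ≤ 12 / δ ^ 2 * (4 / δ ^ 4 * (∑ i, ∑ j, ∑ k, w i j k ^ 2)
        + 4 / δ ^ 4 * (∑ i, ∑ j, ∑ k, w i j k ^ 2)
        + 4 / δ ^ 4 * (∑ i, ∑ j, ∑ k, w i j k ^ 2)) := by gcongr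
    _ = _ := by
        field_simp
        ring

/-- The fourth-order coefficients, contracted with bounded vectors. -/
lemma quartic_coef_bound {a b : Fin n → Fin n → ℝ} (ha : ∀ i, a i i = 0) (hb : ∀ i, b i i = 0)
    {S U V : Fin n → ℝ} {B : ℝ} (hS : ∀ i, |S i| ≤ B) (hU : ∀ i, |U i| ≤ B)
    (hV : ∀ i, |V i| ≤ B) :
    ∑ l, (∑ i, ∑ j, ∑ k, S i * U j * V k *
        (if j = k then 0 else a i j * b i k * s.loo i j k l)) ^ 2
      ≤ 6 * (2 * B ^ 2 * (1 + B ^ 4) * (1 / δ ^ 2 + 1) + 16 * B ^ 4 * (1 + B ^ 2) / δ ^ 4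
          + 288 * B ^ 6 / δ ^ 6) *
        ∑ i, ((∑ j, a i j * U j) ^ 2 + ∑ j, a i j ^ 2)
          * ((∑ k, b i k * V k) ^ 2 + ∑ k, b i k ^ 2) := by
  have hδ := h.pos
  set Ut : Fin n → ℝ := fun i => ∑ j, a i j * U j with hUt
  set Vt : Fin n → ℝ := fun i => ∑ j, b i j * V j with hVt
  set α : Fin n → ℝ := fun i => ∑ j, a i j ^ 2 with hα
  set β : Fin n → ℝ := fun i => ∑ j, b i j ^ 2 with hβ
  have hα0 : ∀ i, 0 ≤ α i := fun i => Finset.sum_nonneg fun _ _ => sq_nonneg _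
  have hβ0 : ∀ i, 0 ≤ β i := fun i => Finset.sum_nonneg fun _ _ => sq_nonneg _
  set E : Fin n → ℝ := fun i => (Ut i ^ 2 + α i) * (Vt i ^ 2 + β i) with hE
  have hS2 := fun i => sq_le_sq_of_abs_le (hS i)
  have hU2 := fun i => sq_le_sq_of_abs_le (hU i)
  have hV2 := fun i => sq_le_sq_of_abs_le (hV i)
  have hE1 : ∀ i, Ut i ^ 2 * Vt i ^ 2 + α i * Vt i ^ 2 + Ut i ^ 2 * β i + α i * β i = E i :=
    fun i => by simp only [hE]; ring
  have p1 : ∀ i, 0 ≤ Ut i ^ 2 * Vt i ^ 2 := fun i => by positivity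
  have p2 : ∀ i, 0 ≤ α i * Vt i ^ 2 := fun i => mul_nonneg (hα0 i) (sq_nonneg _)
  have p3 : ∀ i, 0 ≤ Ut i ^ 2 * β i := fun i => mul_nonneg (sq_nonneg _) (hβ0 i)
  have p4 : ∀ i, 0 ≤ α i * β i := fun i => mul_nonneg (hα0 i) (hβ0 i)
  set w : Fin n → Fin n → Fin n → ℝ := fun i j k =>
    if j = k then 0 else S i * (a i j * U j) * (b i k * V k) with hw
  have hw0 : ∀ i j k, i = j ∨ i = k ∨ j = k → w i j k = 0 := by
    rintro i j k (rfl | rfl | rfl)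
    · simp [hw, ha]
    · simp [hw, hb]
    · simp [hw]
  set W : Fin n → ℝ := fun i => ∑ j, ∑ k, w i j k with hWdef
  set y₁ : Fin n → Fin n → ℝ := fun i j => ∑ k, w i j k with hy₁
  set y₂ : Fin n → Fin n → ℝ := fun i k => ∑ j, w i j k with hy₂
  -- the decomposition of the contracted coefficients
  have hdec : ∀ l, ∑ i, ∑ j, ∑ k, S i * U j * V k *
        (if j = k then 0 else a i j * b i k * s.loo i j k l)
      = ∑ i, (W i / s.M i i) * s.M i l
        - ∑ j, ∑ i, s.M i j / s.M i i * y₁ i j * s.Mc2 j l i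
        - ∑ k, ∑ i, s.M i k / s.M i i * y₂ i k * s.Mc2 k l i
        + ∑ j, ∑ i, ∑ k, w i j k * (s.M i k / s.M i i * s.Mc2 k j i) * s.Mc3 j l i k
        + ∑ k, ∑ i, ∑ j, w i j k * (s.M i j / s.M i i * s.Mc2 j k i) * s.Mc3 k l i j
        - W l := by
    intro l
    have e : ∀ i j k, S i * U j * V k * (if j = k then 0 else a i j * b i k * s.loo i j k l)
        = w i j k / s.M i i * s.M i l - s.M i j / s.M i i * w i j k * s.Mc2 j l i
          - s.M i k / s.M i i * w i j k * s.Mc2 k l i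
          + w i j k * (s.M i k / s.M i i * s.Mc2 k j i) * s.Mc3 j l i k
          + w i j k * (s.M i j / s.M i i * s.Mc2 j k i) * s.Mc3 k l i j
          - if i = l then w i j k else 0 := by
      intro i j k
      by_cases hijk : i = j ∨ i = k ∨ j = k
      · rw [hw0 i j k hijk]
        rcases hijk with rfl | rfl | rfl <;> simp [ha, hb]
      · push Not at hijk
        obtain ⟨hij, hik, hjk⟩ := hijk
        have e1 := s.Mc3_expand l (h.M_ne i) (h.D2_ne hij) (h.D2_ne hik) (h.D2_ne hjk)
          (h.D3_ne hij hik hjk)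
        have e2 : (if j = k then 0 else a i j * b i k * s.loo i j k l)
            = a i j * b i k * (s.Mc3 i l j k - if i = l then 1 else 0) := by
          rw [if_neg hjk, loo]
          by_cases hil : i = l
          · subst hil
            rw [s.Mc3_self (h.D2_ne hjk) (h.D3_ne hij hik hjk)]
            simp
          · rw [if_neg hil, if_neg hjk]
            by_cases hjl : j = l
            · subst hjl
              rw [s.Mc3_left (h.D2_ne hjk)]
              simp
            · by_cases hkl : k = l
              · subst hkl
                rw [s.Mc3_right (h.D2_ne hjk)]
                simp
              · rw [if_neg (by simp [Ne.symm hil, Ne.symm hjl, Ne.symm hkl]), sub_zero]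
        rw [e2, e1]
        simp only [hw, if_neg hjk]
        split_ifs <;> ring
    simp_rw [e]
    simp only [Finset.sum_sub_distrib, Finset.sum_add_distrib]
    have f1 : ∑ i, ∑ j, ∑ k, w i j k / s.M i i * s.M i l = ∑ i, (W i / s.M i i) * s.M i l := by
      simp only [hWdef, Finset.sum_div, Finset.sum_mul]
    have f2 : ∑ i, ∑ j, ∑ k, s.M i j / s.M i i * w i j k * s.Mc2 j l i
        = ∑ j, ∑ i, s.M i j / s.M i i * y₁ i j * s.Mc2 j l i := by
      rw [Finset.sum_comm]
      simp only [hy₁, Finset.mul_sum, Finset.sum_mul]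
    have f3 : ∑ i, ∑ j, ∑ k, s.M i k / s.M i i * w i j k * s.Mc2 k l i
        = ∑ k, ∑ i, s.M i k / s.M i i * y₂ i k * s.Mc2 k l i := by
      simp only [hy₂, Finset.mul_sum, Finset.sum_mul]
      rw [Finset.sum_comm (f := fun k i => ∑ j, s.M i k / s.M i i * w i j k * s.Mc2 k l i)]
      exact Finset.sum_congr rfl fun i _ => Finset.sum_comm
    have f4 : ∑ i, ∑ j, ∑ k, w i j k * (s.M i k / s.M i i * s.Mc2 k j i) * s.Mc3 j l i k
        = ∑ j, ∑ i, ∑ k, w i j k * (s.M i k / s.M i i * s.Mc2 k j i) * s.Mc3 j l i k :=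
      Finset.sum_comm
    have f5 : ∑ i, ∑ j, ∑ k, w i j k * (s.M i j / s.M i i * s.Mc2 j k i) * s.Mc3 k l i j
        = ∑ k, ∑ i, ∑ j, w i j k * (s.M i j / s.M i i * s.Mc2 j k i) * s.Mc3 k l i j := by
      rw [Finset.sum_comm (f := fun k i => ∑ j,
        w i j k * (s.M i j / s.M i i * s.Mc2 j k i) * s.Mc3 k l i j)]
      exact Finset.sum_congr rfl fun i _ => Finset.sum_comm
    have f6 : ∑ i, ∑ j, ∑ k, (if i = l then w i j k else 0) = W l := by
      rw [Finset.sum_eq_single l]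
      · simp [hWdef]
      · intro i _ hi
        simp [hi]
      · simp
    rw [f1, f2, f3, f4, f5, f6]
  -- second moments of the partial contractions
  have g1 : ∀ i j, y₁ i j = S i * (a i j * U j) * (Vt i - b i j * V j) := by
    intro i j
    simp only [hy₁, hw, hVt]
    rw [mul_sub, Finset.mul_sum, ← Finset.add_sum_erase _ _ (Finset.mem_univ j),
      ← Finset.add_sum_erase (a := j) Finset.univ (fun k => S i * (a i j * U j) * (b i k * V k))
        (Finset.mem_univ j), if_pos rfl, zero_add, add_sub_cancel_left]
    refine Finset.sum_congr rfl fun k hk => ?_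
    rw [if_neg (Ne.symm (Finset.ne_of_mem_erase hk))]
  have g2 : ∀ i k, y₂ i k = S i * (b i k * V k) * (Ut i - a i k * U k) := by
    intro i k
    simp only [hy₂, hw, hUt]
    rw [mul_sub, Finset.mul_sum, ← Finset.add_sum_erase _ _ (Finset.mem_univ k),
      ← Finset.add_sum_erase (a := k) Finset.univ (fun j => S i * (b i k * V k) * (a i j * U j))
        (Finset.mem_univ k), if_pos rfl, zero_add, add_sub_cancel_left]
    refine Finset.sum_congr rfl fun j hj => ?_
    rw [if_neg (Finset.ne_of_mem_erase hj)]
    ring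
  have hBsq : 0 ≤ B ^ 2 := sq_nonneg B
  have hsum1 : ∀ i, ∑ j, y₁ i j ^ 2 ≤ 2 * B ^ 4 * (1 + B ^ 2) * E i := by
    intro i
    have hb' : ∀ j, b i j ^ 2 ≤ β i := fun j =>
      Finset.single_le_sum (f := fun j => b i j ^ 2) (fun _ _ => sq_nonneg _) (Finset.mem_univ j)
    have e1 : ∀ j, y₁ i j ^ 2 ≤ a i j ^ 2 * (B ^ 4 * (2 * Vt i ^ 2 + 2 * (β i * B ^ 2))) := by
      intro j
      rw [g1]
      have : (Vt i - b i j * V j) ^ 2 ≤ 2 * Vt i ^ 2 + 2 * (β i * B ^ 2) := by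
        have q1 : (b i j * V j) ^ 2 ≤ β i * B ^ 2 := by
          rw [mul_pow]
          exact mul_le_mul (hb' j) (hV2 j) (sq_nonneg _) (hβ0 i)
        nlinarith [sq_nonneg (Vt i + b i j * V j)]
      calc (S i * (a i j * U j) * (Vt i - b i j * V j)) ^ 2
          = a i j ^ 2 * ((S i ^ 2 * U j ^ 2) * (Vt i - b i j * V j) ^ 2) := by ring
        _ ≤ a i j ^ 2 * ((B ^ 2 * B ^ 2) * (2 * Vt i ^ 2 + 2 * (β i * B ^ 2))) := by
            have hSU := mul_le_mul (hS2 i) (hU2 j) (sq_nonneg _) hBsq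
            exact mul_le_mul_of_nonneg_left
              (mul_le_mul hSU this (sq_nonneg _) (mul_nonneg hBsq hBsq)) (sq_nonneg _)
        _ = _ := by ring
    refine (Finset.sum_le_sum fun j _ => e1 j).trans ?_
    rw [← Finset.sum_mul]
    change α i * _ ≤ _
    rw [← hE1]
    have := mul_nonneg (pow_nonneg hBsq 2) (p1 i)
    have := mul_nonneg (pow_nonneg hBsq 2) (p2 i)
    have := mul_nonneg (pow_nonneg hBsq 2) (p3 i)
    have := mul_nonneg (pow_nonneg hBsq 2) (p4 i)
    have := mul_nonneg (pow_nonneg hBsq 3) (p1 i)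
    have := mul_nonneg (pow_nonneg hBsq 3) (p2 i)
    have := mul_nonneg (pow_nonneg hBsq 3) (p3 i)
    have := mul_nonneg (pow_nonneg hBsq 3) (p4 i)
    nlinarith
  have hsum2 : ∀ i, ∑ j, y₂ i j ^ 2 ≤ 2 * B ^ 4 * (1 + B ^ 2) * E i := by
    intro i
    have hb' : ∀ j, a i j ^ 2 ≤ α i := fun j =>
      Finset.single_le_sum (f := fun j => a i j ^ 2) (fun _ _ => sq_nonneg _) (Finset.mem_univ j)
    have e1 : ∀ j, y₂ i j ^ 2 ≤ b i j ^ 2 * (B ^ 4 * (2 * Ut i ^ 2 + 2 * (α i * B ^ 2))) := by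
      intro j
      rw [g2]
      have : (Ut i - a i j * U j) ^ 2 ≤ 2 * Ut i ^ 2 + 2 * (α i * B ^ 2) := by
        have q1 : (a i j * U j) ^ 2 ≤ α i * B ^ 2 := by
          rw [mul_pow]
          exact mul_le_mul (hb' j) (hU2 j) (sq_nonneg _) (hα0 i)
        nlinarith [sq_nonneg (Ut i + a i j * U j)]
      calc (S i * (b i j * V j) * (Ut i - a i j * U j)) ^ 2
          = b i j ^ 2 * ((S i ^ 2 * V j ^ 2) * (Ut i - a i j * U j) ^ 2) := by ring
        _ ≤ b i j ^ 2 * ((B ^ 2 * B ^ 2) * (2 * Ut i ^ 2 + 2 * (α i * B ^ 2))) := by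
            have hSV := mul_le_mul (hS2 i) (hV2 j) (sq_nonneg _) hBsq
            exact mul_le_mul_of_nonneg_left
              (mul_le_mul hSV this (sq_nonneg _) (mul_nonneg hBsq hBsq)) (sq_nonneg _)
        _ = _ := by ring
    refine (Finset.sum_le_sum fun j _ => e1 j).trans ?_
    rw [← Finset.sum_mul]
    change β i * _ ≤ _
    rw [← hE1]
    have := mul_nonneg (pow_nonneg hBsq 2) (p1 i)
    have := mul_nonneg (pow_nonneg hBsq 2) (p2 i)
    have := mul_nonneg (pow_nonneg hBsq 2) (p3 i)
    have := mul_nonneg (pow_nonneg hBsq 2) (p4 i)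
    have := mul_nonneg (pow_nonneg hBsq 3) (p1 i)
    have := mul_nonneg (pow_nonneg hBsq 3) (p2 i)
    have := mul_nonneg (pow_nonneg hBsq 3) (p3 i)
    have := mul_nonneg (pow_nonneg hBsq 3) (p4 i)
    nlinarith
  have hW : ∀ i, W i ^ 2 ≤ 2 * B ^ 2 * (1 + B ^ 4) * E i := by
    intro i
    have e1 : W i = S i * (Ut i * Vt i - ∑ j, a i j * b i j * (U j * V j)) := by
      have : W i = ∑ j, y₁ i j := rfl
      rw [this]
      simp_rw [g1, mul_sub]
      rw [Finset.sum_sub_distrib]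
      congr 1
      · rw [← Finset.sum_mul, ← Finset.mul_sum]
        exact mul_assoc _ _ _
      · rw [Finset.mul_sum]
        exact Finset.sum_congr rfl fun _ _ => by ring
    have e2 : (∑ j, a i j * b i j * (U j * V j)) ^ 2 ≤ B ^ 4 * (α i * β i) := by
      have e3 : (∑ j, a i j * b i j * (U j * V j)) ^ 2 = (∑ j, (a i j * U j) * (b i j * V j)) ^ 2 :=
        by congr 1; exact Finset.sum_congr rfl fun _ _ => by ring
      rw [e3]
      refine (sq_sum_mul_le _ _).trans ?_
      have q1 : ∑ j, (a i j * U j) ^ 2 ≤ B ^ 2 * α i := by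
        simp only [hα, Finset.mul_sum]
        refine Finset.sum_le_sum fun j _ => ?_
        rw [mul_pow, mul_comm]
        exact mul_le_mul_of_nonneg_right (hU2 j) (sq_nonneg _)
      have q2 : ∑ j, (b i j * V j) ^ 2 ≤ B ^ 2 * β i := by
        simp only [hβ, Finset.mul_sum]
        refine Finset.sum_le_sum fun j _ => ?_
        rw [mul_pow, mul_comm]
        exact mul_le_mul_of_nonneg_right (hV2 j) (sq_nonneg _)
      calc _ ≤ (B ^ 2 * α i) * (B ^ 2 * β i) :=
            mul_le_mul q1 q2 (Finset.sum_nonneg fun _ _ => sq_nonneg _)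
              (mul_nonneg hBsq (hα0 i))
        _ = _ := by ring
    rw [e1, mul_pow]
    have e4 : (Ut i * Vt i - ∑ j, a i j * b i j * (U j * V j)) ^ 2
        ≤ 2 * (1 + B ^ 4) * E i := by
      have := sq_nonneg (Ut i * Vt i + ∑ j, a i j * b i j * (U j * V j))
      have q0 : 0 ≤ B ^ 4 := by positivity
      have q1 := mul_nonneg q0 (p1 i)
      have q2 := mul_nonneg q0 (p2 i)
      have q3 := mul_nonneg q0 (p3 i)
      rw [← hE1]
      nlinarith [p1 i, p2 i, p3 i, p4 i]
    calc _ ≤ B ^ 2 * (2 * (1 + B ^ 4) * E i) :=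
          mul_le_mul (hS2 i) e4 (sq_nonneg _) hBsq
      _ = _ := by ring
  have hw2 : ∑ i, ∑ j, ∑ k, w i j k ^ 2 ≤ B ^ 6 * ∑ i, E i := by
    rw [Finset.mul_sum]
    refine Finset.sum_le_sum fun i _ => ?_
    have e1 : ∀ j k, w i j k ^ 2 ≤ B ^ 6 * (a i j ^ 2 * b i k ^ 2) := by
      intro j k
      by_cases hjk : j = k
      · simp only [hw, if_pos hjk, zero_pow two_ne_zero]
        positivity
      · simp only [hw, if_neg hjk]
        calc (S i * (a i j * U j) * (b i k * V k)) ^ 2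
            = S i ^ 2 * U j ^ 2 * V k ^ 2 * (a i j ^ 2 * b i k ^ 2) := by ring
          _ ≤ B ^ 2 * B ^ 2 * B ^ 2 * (a i j ^ 2 * b i k ^ 2) := by
              have hSU := mul_le_mul (hS2 i) (hU2 j) (sq_nonneg _) hBsq
              exact mul_le_mul_of_nonneg_right
                (mul_le_mul hSU (hV2 k) (sq_nonneg _) (mul_nonneg hBsq hBsq)) (by positivity)
          _ = _ := by ring
    calc ∑ j, ∑ k, w i j k ^ 2 ≤ ∑ j, ∑ k, B ^ 6 * (a i j ^ 2 * b i k ^ 2) :=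
          Finset.sum_le_sum fun j _ => Finset.sum_le_sum fun k _ => e1 j k
      _ = B ^ 6 * (α i * β i) := by
          simp only [hα, hβ]
          rw [Finset.sum_mul_sum]
          simp only [Finset.mul_sum]
      _ ≤ B ^ 6 * E i := by
          have : 0 ≤ B ^ 6 := by positivity
          refine mul_le_mul_of_nonneg_left ?_ this
          rw [← hE1]
          linarith [p1 i, p2 i, p3 i]
  have t0 : ∑ l, (∑ i, (W i / s.M i i) * s.M i l) ^ 2
      ≤ 1 / δ ^ 2 * (2 * B ^ 2 * (1 + B ^ 4) * ∑ i, E i) := by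
    refine (h.sum_sq_comb_le _).trans ?_
    rw [Finset.mul_sum, Finset.mul_sum]
    refine Finset.sum_le_sum fun i _ => ?_
    rw [div_pow]
    have e1 : δ ^ 2 ≤ s.M i i ^ 2 := pow_le_pow_left₀ hδ.le (h.le_M i) 2
    calc W i ^ 2 / s.M i i ^ 2 ≤ W i ^ 2 / δ ^ 2 :=
          div_le_div_of_nonneg_left (sq_nonneg _) (by positivity) e1
      _ = 1 / δ ^ 2 * W i ^ 2 := by ring
      _ ≤ _ := mul_le_mul_of_nonneg_left (hW i) (by positivity)
  have t1 := h.sum_sq_M_mul_Mc2_le (y := y₁) fun i => by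
    simp only [hy₁]; exact Finset.sum_eq_zero fun k _ => hw0 _ _ _ (Or.inl rfl)
  have t2 := h.sum_sq_M_mul_Mc2_le (y := y₂) fun i => by
    simp only [hy₂]; exact Finset.sum_eq_zero fun k _ => hw0 _ _ _ (Or.inr (Or.inl rfl))
  have t3 := h.sum_sq_M_mul_Mc3_le (w := fun i k j => w i j k) fun i k j hk => hw0 i j k (by tauto)
  have t4 := h.sum_sq_M_mul_Mc3_le (w := w) hw0
  have t5 : ∑ l, W l ^ 2 ≤ 2 * B ^ 2 * (1 + B ^ 4) * ∑ i, E i := by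
    rw [Finset.mul_sum]
    exact Finset.sum_le_sum fun i _ => hW i
  have u1 : ∑ i, ∑ j, y₁ i j ^ 2 ≤ 2 * B ^ 4 * (1 + B ^ 2) * ∑ i, E i := by
    rw [Finset.mul_sum]
    exact Finset.sum_le_sum fun i _ => hsum1 i
  have u2 : ∑ i, ∑ j, y₂ i j ^ 2 ≤ 2 * B ^ 4 * (1 + B ^ 2) * ∑ i, E i := by
    rw [Finset.mul_sum]
    exact Finset.sum_le_sum fun i _ => hsum2 i
  have u3 : ∑ i, ∑ k, ∑ j, w i j k ^ 2 = ∑ i, ∑ j, ∑ k, w i j k ^ 2 :=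
    Finset.sum_congr rfl fun i _ => Finset.sum_comm
  simp only [u3] at t3
  have c4 : 0 ≤ 4 / δ ^ 4 := by positivity
  have c6 : 0 ≤ 144 / δ ^ 6 := by positivity
  have t1' := t1.trans (mul_le_mul_of_nonneg_left u1 c4)
  have t2' := t2.trans (mul_le_mul_of_nonneg_left u2 c4)
  have t3' := t3.trans (mul_le_mul_of_nonneg_left hw2 c6)
  have t4' := t4.trans (mul_le_mul_of_nonneg_left hw2 c6)
  calc _ ≤ ∑ l, 6 * ((∑ i, (W i / s.M i i) * s.M i l) ^ 2
        + (∑ j, ∑ i, s.M i j / s.M i i * y₁ i j * s.Mc2 j l i) ^ 2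
        + (∑ k, ∑ i, s.M i k / s.M i i * y₂ i k * s.Mc2 k l i) ^ 2
        + (∑ j, ∑ i, ∑ k, w i j k * (s.M i k / s.M i i * s.Mc2 k j i) * s.Mc3 j l i k) ^ 2
        + (∑ k, ∑ i, ∑ j, w i j k * (s.M i j / s.M i i * s.Mc2 j k i) * s.Mc3 k l i j) ^ 2
        + W l ^ 2) := Finset.sum_le_sum fun l _ => by
          rw [hdec]
          exact sq_six_le _ _ _ _ _ _
    _ ≤ 6 * (1 / δ ^ 2 * (2 * B ^ 2 * (1 + B ^ 4) * ∑ i, E i)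
        + 4 / δ ^ 4 * (2 * B ^ 4 * (1 + B ^ 2) * ∑ i, E i)
        + 4 / δ ^ 4 * (2 * B ^ 4 * (1 + B ^ 2) * ∑ i, E i)
        + 144 / δ ^ 6 * (B ^ 6 * ∑ i, E i) + 144 / δ ^ 6 * (B ^ 6 * ∑ i, E i)
        + 2 * B ^ 2 * (1 + B ^ 4) * ∑ i, E i) := by
          rw [← Finset.mul_sum]
          simp only [Finset.sum_add_distrib]
          linarith
    _ = _ := by ring

end WellPosed

end DeterministicBounds

end IVSample

/-! ### Contracted coefficients of the third-order and double leave-out forms -/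

/-- The sum of the squared absolute row sums and of the squared absolute column sums. -/
def rowColSq {n : ℕ} (c : Fin n → Fin n → ℝ) : ℝ :=
  ∑ i, (∑ j, |c i j|) ^ 2 + ∑ j, (∑ i, |c i j|) ^ 2

open scoped BigOperators in
lemma sq_sum_abs_mul_le {n : ℕ} {c : Fin n → ℝ} {z : Fin n → ℝ} {D : ℝ} (hz : ∀ i, |z i| ≤ D) :
    (∑ i, |c i * z i|) ^ 2 ≤ D ^ 2 * (∑ i, |c i|) ^ 2 := by
  rw [← mul_pow, Finset.mul_sum]
  gcongr with i
  rw [abs_mul, mul_comm]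
  exact mul_le_mul_of_nonneg_right (hz i) (abs_nonneg _)

open scoped BigOperators in
/-- Random factors with bounded second moments change `rowColSq` by at most a constant factor, on
average over the signs. -/
lemma expect_rowColSq_le {n : ℕ} {c : Fin n → Fin n → ℝ} (hc : ∀ i, c i i = 0)
    {Ξ : (Fin n → Bool) → Fin n → Fin n → ℝ} {D : ℝ}
    (hΞ : ∀ i j, i ≠ j → 𝔼 ε : Fin n → Bool, Ξ ε i j ^ 2 ≤ D) :
    𝔼 ε : Fin n → Bool, rowColSq (fun i j => c i j * Ξ ε i j) ≤ D * rowColSq c := by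
  have key : ∀ (f : Fin n → ℝ) (z : (Fin n → Bool) → Fin n → ℝ),
      (∀ j, f j ≠ 0 → 𝔼 ε : Fin n → Bool, z ε j ^ 2 ≤ D) →
      𝔼 ε : Fin n → Bool, (∑ j, |f j * z ε j|) ^ 2 ≤ D * (∑ j, |f j|) ^ 2 := by
    intro f z hz
    have e1 : ∀ ε, (∑ j, |f j * z ε j|) ^ 2 ≤ (∑ j, |f j|) * ∑ j, |f j| * z ε j ^ 2 := by
      intro ε
      refine Finset.sum_sq_le_sum_mul_sum_of_sq_le_mul _ (fun j _ => abs_nonneg _)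
        (fun j _ => by positivity) fun j _ => ?_
      rw [abs_mul, mul_pow, sq_abs (z ε j)]
      exact (by ring : |f j| ^ 2 * z ε j ^ 2 = |f j| * (|f j| * z ε j ^ 2)).le
    calc _ ≤ 𝔼 ε : Fin n → Bool, (∑ j, |f j|) * ∑ j, |f j| * z ε j ^ 2 :=
          Finset.expect_le_expect fun ε _ => e1 ε
      _ = (∑ j, |f j|) * ∑ j, |f j| * 𝔼 ε : Fin n → Bool, z ε j ^ 2 := by
          rw [← Finset.mul_expect, Finset.expect_sum_comm]
          simp_rw [← Finset.mul_expect]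
      _ ≤ (∑ j, |f j|) * ∑ j, |f j| * D := by
          refine mul_le_mul_of_nonneg_left (Finset.sum_le_sum fun j _ => ?_)
            (Finset.sum_nonneg fun _ _ => abs_nonneg _)
          by_cases hf : f j = 0
          · simp [hf]
          · exact mul_le_mul_of_nonneg_left (hz j hf) (abs_nonneg _)
      _ = _ := by
          rw [← Finset.sum_mul]
          ring
  have hne : ∀ i j, c i j ≠ 0 → i ≠ j := fun i j hcij e => hcij (by rw [e, hc])
  unfold rowColSq
  rw [Finset.expect_add_distrib, Finset.expect_sum_comm, Finset.expect_sum_comm, mul_add,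
    Finset.mul_sum, Finset.mul_sum]
  exact add_le_add
    (Finset.sum_le_sum fun i _ => key _ (fun ε j => Ξ ε i j) fun j hj => hΞ i j (hne i j hj))
    (Finset.sum_le_sum fun j _ => key _ (fun ε i => Ξ ε i j) fun i hi => hΞ i j (hne i j hi))

namespace IVSample

section DeterministicBounds

open scoped BigOperators

variable {Ω : Type*} [MeasurableSpace Ω] {P : Measure Ω} {n K L : ℕ}
  {s : IVSample Ω P n K L} {δ : ℝ} (h : s.WellPosed δ)
include h

namespace WellPosed

/-- The third-order coefficients, contracted with bounded vectors. -/
lemma cubic_coef_bound {c : Fin n → Fin n → ℝ} (hc : ∀ i, c i i = 0) {S W : Fin n → ℝ} {B : ℝ}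
    (hS : ∀ i, |S i| ≤ B) (hW : ∀ i, |W i| ≤ B) :
    ∑ l, (∑ i, ∑ j, S i * W j * (c i j * s.loo i j j l)) ^ 2
      ≤ (4 / δ ^ 2 + 2) * B ^ 4 * rowColSq c := by
  have hδ := h.pos
  set x : Fin n → Fin n → ℝ := fun i j => c i j * (S i * W j) with hx
  have hx0 : ∀ i, x i i = 0 := fun i => by simp [hx, hc]
  have hSW : ∀ i j, |S i * W j| ≤ B ^ 2 := fun i j => by
    rw [abs_mul, sq]
    exact mul_le_mul (hS i) (hW j) (abs_nonneg _) ((abs_nonneg _).trans (hS i))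
  have hrow : ∀ i, (∑ j, |x i j|) ^ 2 ≤ B ^ 4 * (∑ j, |c i j|) ^ 2 := fun i => by
    have := sq_sum_abs_mul_le (c := fun j => c i j) (fun j => hSW i j)
    rwa [← pow_mul] at this
  have hcol : ∀ j, (∑ i, |x i j|) ^ 2 ≤ B ^ 4 * (∑ i, |c i j|) ^ 2 := fun j => by
    have := sq_sum_abs_mul_le (c := fun i => c i j) (fun i => hSW i j)
    rwa [← pow_mul] at this
  have e : ∀ l, ∑ i, ∑ j, S i * W j * (c i j * s.loo i j j l)
      = ∑ i, ∑ j, x i j * s.Mc2 i l j - ∑ j, x l j := by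
    intro l
    have e1 : ∀ i j, S i * W j * (c i j * s.loo i j j l)
        = x i j * s.Mc2 i l j - if i = l then x i j else 0 := by
      intro i j
      by_cases hij : i = j
      · subst hij
        simp [hx, hc]
      · rw [loo, if_pos rfl]
        by_cases hil : i = l
        · subst hil
          rw [s.Mc2_self (h.D2_ne hij)]
          simp
        · by_cases hjl : j = l
          · subst hjl
            rw [s.Mc2_right]
            simp [hil]
          · rw [if_neg (by simp [Ne.symm hil, Ne.symm hjl]), if_neg hil]
            simp only [hx]
            ring
    simp_rw [e1, Finset.sum_sub_distrib]
    congr 1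
    rw [Finset.sum_eq_single l]
    · simp
    · intro i _ hi
      simp [hi]
    · simp
  have h1 := h.sum_sq_comb_Mc2_le hx0
  have h2 := Finset.sum_le_sum fun i (_ : i ∈ Finset.univ) => hrow i
  have h3 := Finset.sum_le_sum fun i (_ : i ∈ Finset.univ) => hcol i
  rw [← Finset.mul_sum] at h2 h3
  have h4 : ∑ l, (∑ j, x l j) ^ 2 ≤ B ^ 4 * ∑ i, (∑ j, |c i j|) ^ 2 := by
    refine le_trans (Finset.sum_le_sum fun l _ => ?_) h2
    exact sq_le_sq_of_abs_le (Finset.abs_sum_le_sum_abs _ _)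
  have h5 : 0 ≤ B ^ 4 * ∑ j, (∑ i, |c i j|) ^ 2 :=
    mul_nonneg (by positivity) (Finset.sum_nonneg fun _ _ => sq_nonneg _)
  have h6 : ∑ l, (∑ i, ∑ j, x i j * s.Mc2 i l j) ^ 2 ≤ 2 / δ ^ 2 * (B ^ 4 * rowColSq c) := by
    refine h1.trans (mul_le_mul_of_nonneg_left ?_ (by positivity))
    unfold rowColSq
    linarith
  have h7 : ∑ l, (∑ j, x l j) ^ 2 ≤ B ^ 4 * rowColSq c := by
    unfold rowColSq
    linarith
  calc ∑ l, (∑ i, ∑ j, S i * W j * (c i j * s.loo i j j l)) ^ 2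
      ≤ ∑ l, (2 * (∑ i, ∑ j, x i j * s.Mc2 i l j) ^ 2 + 2 * (∑ j, x l j) ^ 2) := by
        refine Finset.sum_le_sum fun l _ => ?_
        rw [e]
        nlinarith [sq_nonneg (∑ i, ∑ j, x i j * s.Mc2 i l j + ∑ j, x l j)]
    _ ≤ 2 * (2 / δ ^ 2 * (B ^ 4 * rowColSq c)) + 2 * (B ^ 4 * rowColSq c) := by
        rw [Finset.sum_add_distrib, ← Finset.mul_sum, ← Finset.mul_sum]
        linarith
    _ = _ := by ring

/-- The weights of a leave-two-out residual are square summable, uniformly. -/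
lemma sum_loo_sq_le {i j : Fin n} (hij : i ≠ j) : ∑ k, s.loo i j j k ^ 2 ≤ 4 / δ ^ 2 := by
  have hδ := h.pos
  have e : ∀ k, s.loo i j j k ^ 2 ≤ 2 / δ ^ 2 * (s.M i k ^ 2 + s.M j k ^ 2) := by
    intro k
    rw [loo, if_pos rfl]
    split_ifs
    · rw [zero_pow two_ne_zero]
      positivity
    · have h1 := h.abs_Mc2_le hij k
      have h2 : |s.Mc2 i k j| ≤ (|s.M i k| + |s.M j k|) / δ := h1.trans (by
        gcongr
        exact mul_le_of_le_one_left (abs_nonneg _) (h.abs_M_le i j))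
      have h3 := add_sq_le (a := |s.M i k|) (b := |s.M j k|)
      rw [sq_abs, sq_abs] at h3
      calc s.Mc2 i k j ^ 2 ≤ ((|s.M i k| + |s.M j k|) / δ) ^ 2 := sq_le_sq_of_abs_le h2
        _ = (|s.M i k| + |s.M j k|) ^ 2 / δ ^ 2 := div_pow _ _ _
        _ ≤ 2 * (s.M i k ^ 2 + s.M j k ^ 2) / δ ^ 2 := by gcongr
        _ = _ := by ring
  refine (Finset.sum_le_sum fun k _ => e k).trans ?_
  rw [← Finset.mul_sum, Finset.sum_add_distrib]
  calc 2 / δ ^ 2 * (∑ k, s.M i k ^ 2 + ∑ k, s.M j k ^ 2) ≤ 2 / δ ^ 2 * (1 + 1) := by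
        gcongr
        · exact h.sum_M_sq_le i
        · exact h.sum_M_sq_le j
    _ = _ := by ring

lemma abs_loo_le {i j : Fin n} (hij : i ≠ j) (k : Fin n) :
    |s.loo i j j k| ≤ (|s.M i k| + |s.M j k|) / δ := by
  have hδ := h.pos
  rw [loo, if_pos rfl]
  split_ifs
  · rw [abs_zero]
    positivity
  · refine (h.abs_Mc2_le hij k).trans ?_
    gcongr
    exact mul_le_of_le_one_left (abs_nonneg _) (h.abs_M_le i j)

/-- Combinations of leave-three-out weights whose coefficients carry two leave-two-out weights. -/
lemma sum_sq_loo_mul_Mc3_le {c : Fin n → Fin n → ℝ} (hc : ∀ i, c i i = 0)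
    {x : Fin n → Fin n → Fin n → ℝ} {B : ℝ}
    (hx : ∀ i j k, |x i j k| ≤ B ^ 3 * |c i j * (s.loo i j j k * s.Mc2 j k i)|) :
    ∑ l, (∑ k, ∑ j, ∑ i, x i j k * s.Mc3 k l j i) ^ 2
      ≤ 288 * B ^ 6 / δ ^ 6 * rowColSq c := by
  have hδ := h.pos
  have hB6 : 0 ≤ B ^ 6 := by positivity
  have hx0 : ∀ k j i, k = j ∨ k = i ∨ j = i → x i j k = 0 := by
    intro k j i hk
    rw [← abs_nonpos_iff]
    refine (hx i j k).trans_eq ?_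
    rcases hk with rfl | rfl | rfl
    · simp [loo]
    · simp [loo]
    · simp [hc]
  set g : Fin n → Fin n → Fin n → ℝ := fun i j k => |c i j| * (s.M i k ^ 2 + s.M j k ^ 2) with hg
  -- a product of two leave-out weights is at most a sum of squares of entries of `M`
  have hxg : ∀ i j k, |x i j k| ≤ 2 * |B| ^ 3 / δ ^ 2 * g i j k := by
    intro i j k
    by_cases hij : i = j
    · subst hij
      rw [hx0 k i i (by tauto), abs_zero]
      positivity
    · refine (hx i j k).trans ?_
      have h1 := h.abs_loo_le hij k
      have h2 : |s.Mc2 j k i| ≤ (|s.M i k| + |s.M j k|) / δ := by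
        refine (h.abs_Mc2_le (Ne.symm hij) k).trans ?_
        rw [add_comm]
        gcongr
        exact mul_le_of_le_one_left (abs_nonneg _) (h.abs_M_le j i)
      have h3 : |s.loo i j j k * s.Mc2 j k i| ≤ 2 / δ ^ 2 * (s.M i k ^ 2 + s.M j k ^ 2) := by
        rw [abs_mul]
        have h4 := add_sq_le (a := |s.M i k|) (b := |s.M j k|)
        rw [sq_abs, sq_abs] at h4
        calc _ ≤ (|s.M i k| + |s.M j k|) / δ * ((|s.M i k| + |s.M j k|) / δ) :=
              mul_le_mul h1 h2 (abs_nonneg _) (by positivity)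
          _ = (|s.M i k| + |s.M j k|) ^ 2 / δ ^ 2 := by field_simp
          _ ≤ 2 * (s.M i k ^ 2 + s.M j k ^ 2) / δ ^ 2 := by gcongr
          _ = _ := by ring
      rw [abs_mul]
      have hB3 : B ^ 3 ≤ |B| ^ 3 := by
        rw [← abs_pow]
        exact le_abs_self _
      calc B ^ 3 * (|c i j| * |s.loo i j j k * s.Mc2 j k i|)
          ≤ |B| ^ 3 * (|c i j| * |s.loo i j j k * s.Mc2 j k i|) := by gcongr
        _ ≤ |B| ^ 3 * (|c i j| * (2 / δ ^ 2 * (s.M i k ^ 2 + s.M j k ^ 2))) := by gcongr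
        _ = _ := by
          simp only [hg]
          ring
  have hg0 : ∀ i j k, 0 ≤ g i j k := fun i j k => by
    simp only [hg]
    positivity
  have hsq : ∀ f g' : Fin n → Fin n → ℝ, (∀ a b, |f a b| ≤ 2 * |B| ^ 3 / δ ^ 2 * g' a b) →
      (∑ a, ∑ b, |f a b|) ^ 2 ≤ 4 * B ^ 6 / δ ^ 4 * (∑ a, ∑ b, g' a b) ^ 2 := by
    intro f g' hf
    have e : 4 * B ^ 6 / δ ^ 4 = (2 * |B| ^ 3 / δ ^ 2) ^ 2 := by
      rw [div_pow, mul_pow, ← pow_mul, ← abs_pow, abs_of_nonneg (by positivity)]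
      ring
    rw [e, ← mul_pow]
    simp only [Finset.mul_sum]
    have : ∑ a, ∑ b, |f a b| ≤ ∑ a, ∑ b, 2 * |B| ^ 3 / δ ^ 2 * g' a b :=
      Finset.sum_le_sum fun a _ => Finset.sum_le_sum fun b _ => hf a b
    exact pow_le_pow_left₀
      (Finset.sum_nonneg fun _ _ => Finset.sum_nonneg fun _ _ => abs_nonneg _) this 2
  -- the matrix of the squares `M_{ik}²` has row and column sums at most one, so it acts as an
  -- average
  have G1 : ∑ k, (∑ j, ∑ i, g i j k) ^ 2 ≤ 2 * rowColSq c := by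
    have hav : ∀ r : Fin n → ℝ, ∑ k, (∑ i, r i * s.M i k ^ 2) ^ 2 ≤ ∑ i, r i ^ 2 := by
      intro r
      have e1 : ∀ k, (∑ i, r i * s.M i k ^ 2) ^ 2 ≤ ∑ i, r i ^ 2 * s.M i k ^ 2 := by
        intro k
        have := Finset.sum_sq_le_sum_mul_sum_of_sq_le_mul Finset.univ
          (r := fun i => r i * s.M i k ^ 2) (f := fun i => r i ^ 2 * s.M i k ^ 2)
          (g := fun i => s.M i k ^ 2) (fun i _ => by positivity) (fun i _ => by positivity)
          (fun i _ => (by ring : (r i * s.M i k ^ 2) ^ 2 = _).le)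
        refine this.trans (mul_le_of_le_one_right ?_ (h.sum_M_sq_le' k))
        exact Finset.sum_nonneg fun i _ => by positivity
      refine (Finset.sum_le_sum fun k _ => e1 k).trans ?_
      rw [Finset.sum_comm]
      refine Finset.sum_le_sum fun i _ => ?_
      rw [← Finset.mul_sum]
      exact mul_le_of_le_one_right (sq_nonneg _) (h.sum_M_sq_le i)
    have e2 : ∀ k, ∑ j, ∑ i, g i j k
        = ∑ i, (∑ j, |c i j|) * s.M i k ^ 2 + ∑ j, (∑ i, |c i j|) * s.M j k ^ 2 := by
      intro k
      simp only [hg, mul_add, Finset.sum_add_distrib, Finset.sum_mul]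
      congr 1
      exact Finset.sum_comm
    calc ∑ k, (∑ j, ∑ i, g i j k) ^ 2
        ≤ ∑ k, (2 * (∑ i, (∑ j, |c i j|) * s.M i k ^ 2) ^ 2
            + 2 * (∑ j, (∑ i, |c i j|) * s.M j k ^ 2) ^ 2) := by
          refine Finset.sum_le_sum fun k _ => ?_
          rw [e2]
          have := add_sq_le (a := ∑ i, (∑ j, |c i j|) * s.M i k ^ 2)
            (b := ∑ j, (∑ i, |c i j|) * s.M j k ^ 2)
          linarith
      _ ≤ _ := by
          rw [Finset.sum_add_distrib, ← Finset.mul_sum, ← Finset.mul_sum, rowColSq]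
          have := hav fun i => ∑ j, |c i j|
          have := hav fun j => ∑ i, |c i j|
          linarith
  have hgk : ∀ i j, ∑ k, g i j k ≤ 2 * |c i j| := by
    intro i j
    simp only [hg]
    rw [← Finset.mul_sum, Finset.sum_add_distrib, mul_comm]
    have := h.sum_M_sq_le i
    have := h.sum_M_sq_le j
    gcongr
    linarith
  have G2 : ∑ j, (∑ k, ∑ i, g i j k) ^ 2 ≤ 4 * ∑ j, (∑ i, |c i j|) ^ 2 := by
    rw [Finset.mul_sum]
    refine Finset.sum_le_sum fun j _ => ?_
    rw [Finset.sum_comm]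
    have e1 : ∑ i, ∑ k, g i j k ≤ 2 * ∑ i, |c i j| := by
      rw [Finset.mul_sum]
      exact Finset.sum_le_sum fun i _ => hgk i j
    calc _ ≤ (2 * ∑ i, |c i j|) ^ 2 := pow_le_pow_left₀
          (Finset.sum_nonneg fun _ _ => Finset.sum_nonneg fun _ _ => hg0 _ _ _) e1 2
      _ = _ := by ring
  have G3 : ∑ i, (∑ k, ∑ j, g i j k) ^ 2 ≤ 4 * ∑ i, (∑ j, |c i j|) ^ 2 := by
    rw [Finset.mul_sum]
    refine Finset.sum_le_sum fun i _ => ?_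
    rw [Finset.sum_comm]
    have e1 : ∑ j, ∑ k, g i j k ≤ 2 * ∑ j, |c i j| := by
      rw [Finset.mul_sum]
      exact Finset.sum_le_sum fun j _ => hgk i j
    calc _ ≤ (2 * ∑ j, |c i j|) ^ 2 := pow_le_pow_left₀
          (Finset.sum_nonneg fun _ _ => Finset.sum_nonneg fun _ _ => hg0 _ _ _) e1 2
      _ = _ := by ring
  have h1 := h.sum_sq_comb_Mc3_le (x := fun k j i => x i j k) hx0
  refine h1.trans ?_
  have hC : 0 ≤ 4 * B ^ 6 / δ ^ 4 := by positivity
  have k1 : ∑ k, (∑ j, ∑ i, |x i j k|) ^ 2 ≤ 4 * B ^ 6 / δ ^ 4 * ∑ k, (∑ j, ∑ i, g i j k) ^ 2 := by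
    rw [Finset.mul_sum]
    exact Finset.sum_le_sum fun k _ => hsq _ _ fun j i => hxg i j k
  have k2 : ∑ j, (∑ k, ∑ i, |x i j k|) ^ 2 ≤ 4 * B ^ 6 / δ ^ 4 * ∑ j, (∑ k, ∑ i, g i j k) ^ 2 := by
    rw [Finset.mul_sum]
    exact Finset.sum_le_sum fun j _ => hsq _ _ fun k i => hxg i j k
  have k3 : ∑ i, (∑ k, ∑ j, |x i j k|) ^ 2 ≤ 4 * B ^ 6 / δ ^ 4 * ∑ i, (∑ k, ∑ j, g i j k) ^ 2 := by
    rw [Finset.mul_sum]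
    exact Finset.sum_le_sum fun i _ => hsq _ _ fun k j => hxg i j k
  have k4 : 4 * B ^ 6 / δ ^ 4 * (∑ k, (∑ j, ∑ i, g i j k) ^ 2 + ∑ j, (∑ k, ∑ i, g i j k) ^ 2
      + ∑ i, (∑ k, ∑ j, g i j k) ^ 2) ≤ 4 * B ^ 6 / δ ^ 4 * (6 * rowColSq c) := by
    refine mul_le_mul_of_nonneg_left ?_ hC
    have : rowColSq c = ∑ i, (∑ j, |c i j|) ^ 2 + ∑ j, (∑ i, |c i j|) ^ 2 := rfl
    linarith
  calc _ ≤ 12 / δ ^ 2 * (4 * B ^ 6 / δ ^ 4 * (6 * rowColSq c)) := by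
        refine mul_le_mul_of_nonneg_left ?_ (by positivity)
        linarith
    _ = _ := by
        field_simp
        ring

/-- Leave-two-out residuals of a slot with mean linear in `Q` have bounded second moments. -/
lemma expect_sq_residual_le {ρ : Fin n → ℝ} {κ : ℝ} (hρ : ∀ i, |ρ i| ≤ κ)
    (hann : ∀ i j, ∑ k, s.Mc2 i k j * ρ k = 0) {i j : Fin n} (hij : i ≠ j) :
    𝔼 ε : Fin n → Bool, (∑ k, (ρ k + κ * signOf (ε k)) * s.loo i j j k) ^ 2
      ≤ κ ^ 2 * (1 + 4 / δ ^ 2) := by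
  rw [expect_sq_sum]
  have h1 : ∑ k, ρ k * s.loo i j j k = -ρ i := by
    have h2 := hann i j
    have e : ∀ k, s.Mc2 i k j * ρ k = ρ k * s.loo i j j k + if i = k then ρ k else 0 := by
      intro k
      rw [loo, if_pos rfl]
      by_cases hik : i = k
      · subst hik
        rw [s.Mc2_self (h.D2_ne hij)]
        simp
      · by_cases hjk : j = k
        · subst hjk
          rw [s.Mc2_right]
          simp [hij]
        · rw [if_neg (by simp [Ne.symm hik, Ne.symm hjk]), if_neg hik]
          ring
    simp_rw [e, Finset.sum_add_distrib] at h2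
    rw [Finset.sum_ite_eq Finset.univ i, if_pos (Finset.mem_univ _)] at h2
    linarith
  rw [h1, neg_sq, mul_add, mul_one]
  exact add_le_add (sq_le_sq_of_abs_le (hρ i))
    (mul_le_mul_of_nonneg_left (h.sum_loo_sq_le hij) (sq_nonneg _))

/-- The fourth-order coefficients that involve two leave-out residuals, contracted with bounded
vectors. -/
lemma double_loo_coef_bound {c : Fin n → Fin n → ℝ} (hc : ∀ i, c i i = 0) {U S X : Fin n → ℝ}
    {B : ℝ} (hU : ∀ i, |U i| ≤ B) (hS : ∀ i, |S i| ≤ B) (hX : ∀ i, |X i| ≤ B) :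
    ∑ l, (∑ i, ∑ j, ∑ k, U i * S j * X k * (c i j * s.loo i j j k *
        (if i = k then 0 else s.loo j i k l))) ^ 2
      ≤ 3 * ((2 / δ ^ 2 + 1) * B ^ 4 * rowColSq (fun i j => c i j * ∑ k, X k * s.loo i j j k)
          + 288 * B ^ 6 / δ ^ 6 * rowColSq c) := by
  have hδ := h.pos
  set Ξ : Fin n → Fin n → ℝ := fun i j => ∑ k, X k * s.loo i j j k with hΞ
  set y : Fin n → Fin n → ℝ := fun j i => c i j * Ξ i j * (U i * S j) with hy
  set x : Fin n → Fin n → Fin n → ℝ := fun i j k =>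
    U i * S j * X k * (c i j * (s.loo i j j k * s.Mc2 j k i)) with hx
  have hB : ∀ i : Fin n, 0 ≤ B := fun i => (abs_nonneg _).trans (hU i)
  have hdec : ∀ l, ∑ i, ∑ j, ∑ k, U i * S j * X k * (c i j * s.loo i j j k *
        (if i = k then 0 else s.loo j i k l))
      = ∑ j, ∑ i, y j i * s.Mc2 j l i - ∑ i, y l i
        - ∑ k, ∑ j, ∑ i, x i j k * s.Mc3 k l j i := by
    intro l
    have e : ∀ i j k, U i * S j * X k * (c i j * s.loo i j j k *
        (if i = k then 0 else s.loo j i k l))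
        = c i j * (X k * s.loo i j j k) * (U i * S j) * s.Mc2 j l i
          - (if j = l then c i j * (X k * s.loo i j j k) * (U i * S j) else 0)
          - x i j k * s.Mc3 k l j i := by
      intro i j k
      by_cases hijk : i = j ∨ i = k ∨ j = k
      · have hz : c i j * s.loo i j j k = 0 := by
          rcases hijk with rfl | rfl | rfl <;> simp [hc, loo]
        have e1 : c i j * (X k * s.loo i j j k) = 0 := by
          rw [mul_left_comm, hz, mul_zero]
        have e2 : x i j k = 0 := by
          simp only [hx]
          rw [← mul_assoc (c i j), hz, zero_mul, mul_zero]
        rw [e1, e2, hz]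
        simp
      · push Not at hijk
        obtain ⟨hij, hik, hjk⟩ := hijk
        have e1 := s.Mc3_step (i := j) (j := i) (k := k) l (h.D2_ne (Ne.symm hij)) (h.D2_ne hik)
          (h.D3_ne (Ne.symm hij) hjk hik)
        have e2 : s.loo j i k l = s.Mc3 j l i k - if j = l then 1 else 0 := by
          rw [loo]
          by_cases hjl : j = l
          · subst hjl
            rw [s.Mc3_self (h.D2_ne hik) (h.D3_ne (Ne.symm hij) hjk hik)]
            simp
          · by_cases hil : i = l
            · subst hil
              rw [s.Mc3_left (h.D2_ne hik)]
              simp [hjl]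
            · by_cases hkl : k = l
              · subst hkl
                rw [s.Mc3_right (h.D2_ne hik)]
                simp [hjl]
              · rw [if_neg (by simp [Ne.symm hil, Ne.symm hjl, Ne.symm hkl]), if_neg hik,
                  if_neg hjl, sub_zero]
        rw [if_neg hik, e2, e1]
        simp only [hx]
        split_ifs <;> ring
    simp_rw [e, Finset.sum_sub_distrib]
    have f1 : ∑ i, ∑ j, ∑ k, c i j * (X k * s.loo i j j k) * (U i * S j) * s.Mc2 j l i
        = ∑ j, ∑ i, y j i * s.Mc2 j l i := by
      rw [Finset.sum_comm]
      simp only [hy, hΞ, Finset.mul_sum, Finset.sum_mul]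
    have f2 : ∑ i, ∑ j, ∑ k, (if j = l then c i j * (X k * s.loo i j j k) * (U i * S j) else 0)
        = ∑ i, y l i := by
      refine Finset.sum_congr rfl fun i _ => ?_
      rw [Finset.sum_eq_single l]
      · simp only [hy, hΞ, Finset.mul_sum, Finset.sum_mul, if_true]
      · intro j _ hj
        simp [hj]
      · simp
    have f3 : ∑ i, ∑ j, ∑ k, x i j k * s.Mc3 k l j i
        = ∑ k, ∑ j, ∑ i, x i j k * s.Mc3 k l j i := by
      rw [Finset.sum_comm]
      rw [Finset.sum_comm (f := fun k j => ∑ i, x i j k * s.Mc3 k l j i)]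
      exact Finset.sum_congr rfl fun j _ => Finset.sum_comm
    rw [f1, f2, f3]
  have hUS : ∀ i j, |U i * S j| ≤ B ^ 2 := fun i j => by
    rw [abs_mul, sq]
    exact mul_le_mul (hU i) (hS j) (abs_nonneg _) (hB i)
  have hrow : ∀ i, (∑ j, |y j i|) ^ 2 ≤ B ^ 4 * (∑ j, |c i j * Ξ i j|) ^ 2 := fun i => by
    have := sq_sum_abs_mul_le (c := fun j => c i j * Ξ i j) (fun j => hUS i j)
    rwa [← pow_mul] at this
  have hcol : ∀ j, (∑ i, |y j i|) ^ 2 ≤ B ^ 4 * (∑ i, |c i j * Ξ i j|) ^ 2 := fun j => by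
    have := sq_sum_abs_mul_le (c := fun i => c i j * Ξ i j) (fun i => hUS i j)
    rwa [← pow_mul] at this
  have h1 := h.sum_sq_comb_Mc2_le (x := y) fun i => by simp [hy, hc]
  have h2 := Finset.sum_le_sum fun i (_ : i ∈ Finset.univ) => hrow i
  have h3 := Finset.sum_le_sum fun i (_ : i ∈ Finset.univ) => hcol i
  rw [← Finset.mul_sum] at h2 h3
  have hr : rowColSq (fun i j => c i j * Ξ i j)
    = ∑ i, (∑ j, |c i j * Ξ i j|) ^ 2 + ∑ j, (∑ i, |c i j * Ξ i j|) ^ 2 := rfl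
  have h4 : ∑ l, (∑ j, y l j) ^ 2 ≤ B ^ 4 * ∑ j, (∑ i, |c i j * Ξ i j|) ^ 2 := by
    refine le_trans (Finset.sum_le_sum fun l _ => ?_) h3
    exact sq_le_sq_of_abs_le (Finset.abs_sum_le_sum_abs _ _)
  have h5 : 0 ≤ B ^ 4 * ∑ i, (∑ j, |c i j * Ξ i j|) ^ 2 :=
    mul_nonneg (by positivity) (Finset.sum_nonneg fun _ _ => sq_nonneg _)
  have h6 : ∑ l, (∑ j, ∑ i, y j i * s.Mc2 j l i) ^ 2
      ≤ 2 / δ ^ 2 * (B ^ 4 * rowColSq (fun i j => c i j * Ξ i j)) := by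
    refine h1.trans (mul_le_mul_of_nonneg_left ?_ (by positivity))
    rw [hr]
    linarith
  have h7 : ∑ l, (∑ j, y l j) ^ 2 ≤ B ^ 4 * rowColSq (fun i j => c i j * Ξ i j) := by
    rw [hr]
    linarith
  have h8 := h.sum_sq_loo_mul_Mc3_le hc (x := x) (B := B) fun i j k => by
    simp only [hx]
    rw [abs_mul]
    refine mul_le_mul_of_nonneg_right ?_ (abs_nonneg _)
    rw [abs_mul, pow_succ]
    exact mul_le_mul (hUS i j) (hX k) (abs_nonneg _) (sq_nonneg _)
  calc _ ≤ ∑ l, 3 * ((∑ j, ∑ i, y j i * s.Mc2 j l i) ^ 2 + (∑ i, y l i) ^ 2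
        + (∑ k, ∑ j, ∑ i, x i j k * s.Mc3 k l j i) ^ 2) := by
        refine Finset.sum_le_sum fun l _ => ?_
        rw [hdec]
        generalize ∑ j, ∑ i, y j i * s.Mc2 j l i = A
        generalize ∑ i, y l i = A'
        generalize ∑ k, ∑ j, ∑ i, x i j k * s.Mc3 k l j i = A''
        nlinarith [sq_nonneg (A + A'), sq_nonneg (A + A''), sq_nonneg (A' - A'')]
    _ ≤ _ := by
        rw [← Finset.mul_sum, Finset.sum_add_distrib, Finset.sum_add_distrib]
        refine mul_le_mul_of_nonneg_left ?_ (by norm_num)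
        linarith

end WellPosed

end DeterministicBounds

end IVSample

/-! ### Second moments of forms with leave-out weights -/

/-- `F` is square integrable with mean zero and variance at most `v`. -/
structure CentredL2 {Ω : Type*} [MeasurableSpace Ω] (P : Measure Ω) (F : Ω → ℝ) (v : ℝ) :
    Prop where
  memLp : MemLp F 2 P
  mean : ∫ ω, F ω ∂P = 0
  sq_le : ∫ ω, F ω ^ 2 ∂P ≤ v

namespace CentredL2

variable {Ω : Type*} [MeasurableSpace Ω] {P : Measure Ω} {F F' : Ω → ℝ} {v v' : ℝ}

lemma integrable [IsFiniteMeasure P] (h : CentredL2 P F v) : Integrable F P :=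
  h.memLp.integrable (by norm_num)

lemma mono (h : CentredL2 P F v) (hv : v ≤ v') : CentredL2 P F v' :=
  ⟨h.memLp, h.mean, h.sq_le.trans hv⟩

lemma add [IsFiniteMeasure P] (h : CentredL2 P F v) (h' : CentredL2 P F' v') :
    CentredL2 P (fun ω => F ω + F' ω) (2 * (v + v')) where
  memLp := h.memLp.add h'.memLp
  mean := by rw [integral_add h.integrable h'.integrable, h.mean, h'.mean, add_zero]
  sq_le := by
    have h1 := h.memLp.integrable_sq
    have h2 := h'.memLp.integrable_sq
    calc ∫ ω, (F ω + F' ω) ^ 2 ∂P ≤ ∫ ω, 2 * (F ω ^ 2 + F' ω ^ 2) ∂P := by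
          refine integral_mono (h.memLp.add h'.memLp).integrable_sq ((h1.add h2).const_mul 2)
            fun ω => ?_
          simp only
          nlinarith [sq_nonneg (F ω - F' ω)]
      _ = 2 * (∫ ω, F ω ^ 2 ∂P + ∫ ω, F' ω ^ 2 ∂P) := by
          rw [integral_const_mul, integral_add h1 h2]
      _ ≤ _ := by
          have := h.sq_le
          have := h'.sq_le
          linarith

lemma const_mul (h : CentredL2 P F v) (a : ℝ) :
    CentredL2 P (fun ω => a * F ω) (a ^ 2 * v) where
  memLp := h.memLp.const_mul a
  mean := by rw [integral_const_mul, h.mean, mul_zero]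
  sq_le := by
    simp_rw [mul_pow]
    rw [integral_const_mul]
    exact mul_le_mul_of_nonneg_left h.sq_le (sq_nonneg a)

lemma congr (h : CentredL2 P F v) (e : ∀ ω, F' ω = F ω) : CentredL2 P F' v := by
  rwa [funext e]

end CentredL2

namespace IVSample

section Forms

open scoped BigOperators

variable {Ω : Type*} [mΩ : MeasurableSpace Ω] {P : Measure Ω} {n K L : ℕ}
  (s : IVSample Ω P n K L)

/-- The fourth-order form in which the left-out observations `j`, `k` are weighted by `a` and `b`. -/
def quarticForm (a b : Fin n → Fin n → ℝ) (S U V τ : Fin n → Ω → ℝ) (ω : Ω) : ℝ :=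
  ∑ i, ∑ j, ∑ k, ∑ l, (if j = k then 0 else a i j * b i k * s.loo i j k l)
    * (S i ω * U j ω * V k ω * τ l ω)

/-- The third-order form with leave-two-out weights. -/
def cubicForm (c : Fin n → Fin n → ℝ) (S W τ : Fin n → Ω → ℝ) (ω : Ω) : ℝ :=
  ∑ i, ∑ j, ∑ l, (c i j * s.loo i j j l) * (S i ω * W j ω * τ l ω)

/-- The fourth-order form with the weights of two leave-out residuals. -/
def doubleForm (c : Fin n → Fin n → ℝ) (U S X τ : Fin n → Ω → ℝ) (ω : Ω) : ℝ :=
  ∑ i, ∑ j, ∑ k, ∑ l, (c i j * s.loo i j j k * if i = k then 0 else s.loo j i k l)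
    * (U i ω * S j ω * X k ω * τ l ω)

variable {s} {δ : ℝ} (h : s.WellPosed δ) [IsProbabilityMeasure P] {m : Fin n → MeasurableSpace Ω}
  (hm : ∀ i, m i ≤ mΩ) (hI : iIndep m P) {κ : ℝ} (hκ : 0 ≤ κ)

omit [IsProbabilityMeasure P] in
lemma expect_sq_sum_signed (x : Fin n → ℝ) (U : Fin n → Ω → ℝ) :
    𝔼 ε : Fin n → Bool, (∑ j, x j * signed P κ U ε j) ^ 2
      = (∑ j, x j * ∫ ω, U j ω ∂P) ^ 2 + κ ^ 2 * ∑ j, x j ^ 2 := by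
  have := expect_sq_sum (fun j => ∫ ω, U j ω ∂P) x κ
  simp_rw [mul_comm _ (x _)] at this
  exact this

omit [IsProbabilityMeasure P] in
lemma expect_sq_mul_sq_le (a b : Fin n → Fin n → ℝ) (U V : Fin n → Ω → ℝ) :
    𝔼 ε : Fin n → Bool, 𝔼 ε' : Fin n → Bool,
      ∑ i, ((∑ j, a i j * signed P κ U ε j) ^ 2 + ∑ j, a i j ^ 2)
        * ((∑ k, b i k * signed P κ V ε' k) ^ 2 + ∑ k, b i k ^ 2)
      ≤ (1 + κ ^ 2) ^ 2 * (∑ i, ((∑ j, a i j * ∫ ω, U j ω ∂P) ^ 4 + (∑ j, a i j ^ 2) ^ 2)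
          + ∑ i, ((∑ j, b i j * ∫ ω, V j ω ∂P) ^ 4 + (∑ j, b i j ^ 2) ^ 2)) := by
  have e : ∀ ε' : Fin n → Bool, 𝔼 ε'' : Fin n → Bool, ∑ i,
      ((∑ j, a i j * signed P κ U ε' j) ^ 2 + ∑ j, a i j ^ 2)
        * ((∑ k, b i k * signed P κ V ε'' k) ^ 2 + ∑ k, b i k ^ 2)
      = ∑ i, ((∑ j, a i j * signed P κ U ε' j) ^ 2 + ∑ j, a i j ^ 2)
        * (((∑ k, b i k * ∫ ω, V k ω ∂P) ^ 2 + κ ^ 2 * ∑ k, b i k ^ 2) + ∑ k, b i k ^ 2) := by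
    intro ε'
    rw [Finset.expect_sum_comm]
    simp_rw [← Finset.mul_expect, Finset.expect_add_distrib,
      Finset.expect_const Finset.univ_nonempty, expect_sq_sum_signed]
  simp_rw [e]
  rw [Finset.expect_sum_comm]
  simp_rw [← Finset.expect_mul, Finset.expect_add_distrib,
      Finset.expect_const Finset.univ_nonempty, expect_sq_sum_signed]
  rw [← Finset.sum_add_distrib, Finset.mul_sum]
  refine Finset.sum_le_sum fun i _ => ?_
  have hα : 0 ≤ ∑ j, a i j ^ 2 := Finset.sum_nonneg fun _ _ => sq_nonneg _
  have hβ : 0 ≤ ∑ j, b i j ^ 2 := Finset.sum_nonneg fun _ _ => sq_nonneg _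
  generalize ∑ j, a i j ^ 2 = α at *
  generalize ∑ j, b i j ^ 2 = β at *
  generalize ∑ j, a i j * ∫ ω, U j ω ∂P = p
  generalize ∑ j, b i j * ∫ ω, V j ω ∂P = p'
  have hk : 0 ≤ κ ^ 2 := sq_nonneg κ
  calc (p ^ 2 + κ ^ 2 * α + α) * (p' ^ 2 + κ ^ 2 * β + β)
      ≤ ((1 + κ ^ 2) * (p ^ 2 + α)) * ((1 + κ ^ 2) * (p' ^ 2 + β)) := by
        refine mul_le_mul ?_ ?_ (by positivity) (by positivity)
        · nlinarith [mul_nonneg hk (sq_nonneg p)]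
        · nlinarith [mul_nonneg hk (sq_nonneg p')]
    _ = (1 + κ ^ 2) ^ 2 * ((p ^ 2 + α) * (p' ^ 2 + β)) := by ring
    _ ≤ _ := by
        refine mul_le_mul_of_nonneg_left ?_ (by positivity)
        nlinarith [sq_nonneg (p ^ 2 + α - (p' ^ 2 + β)), sq_nonneg (p ^ 2 - α),
          sq_nonneg (p' ^ 2 - β)]

include h hm hI hκ in
lemma centredL2_cubicForm {c : Fin n → Fin n → ℝ} (hc : ∀ i, c i i = 0)
    {S W τ : Fin n → Ω → ℝ} (hS : Slot m P κ S) (hW : Slot m P κ W) (hτ : Slot m P κ τ)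
    (h0 : ∀ i, ∫ ω, τ i ω ∂P = 0) :
    CentredL2 P (s.cubicForm c S W τ)
      (108 * κ ^ 2 * ((4 / δ ^ 2 + 2) * (2 * κ) ^ 4 * rowColSq c)) := by
  obtain ⟨h1, h2, h3⟩ := cubic_chaos hm hI hS hW hτ h0 (c := fun i j l => c i j * s.loo i j j l)
    (by rintro j k l (rfl | rfl | rfl) <;> simp [hc, loo])
  refine ⟨h1, h2, h3.trans (mul_le_mul_of_nonneg_left ?_ (by positivity))⟩
  exact Finset.expect_le Finset.univ_nonempty fun ε _ =>
    Finset.expect_le Finset.univ_nonempty fun ε' _ =>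
      h.cubic_coef_bound hc (abs_signed_le hκ hS ε) (abs_signed_le hκ hW ε')

include h hm hI hκ in
lemma centredL2_quarticForm {a b : Fin n → Fin n → ℝ} (ha : ∀ i, a i i = 0) (hb : ∀ i, b i i = 0)
    {S U V τ : Fin n → Ω → ℝ} (hS : Slot m P κ S) (hU : Slot m P κ U) (hV : Slot m P κ V)
    (hτ : Slot m P κ τ) (h0 : ∀ i, ∫ ω, τ i ω ∂P = 0) :
    CentredL2 P (s.quarticForm a b S U V τ)
      (2048 * κ ^ 2 * (6 * (2 * (2 * κ) ^ 2 * (1 + (2 * κ) ^ 4) * (1 / δ ^ 2 + 1)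
          + 16 * (2 * κ) ^ 4 * (1 + (2 * κ) ^ 2) / δ ^ 4 + 288 * (2 * κ) ^ 6 / δ ^ 6) *
        ((1 + κ ^ 2) ^ 2 * (∑ i, ((∑ j, a i j * ∫ ω, U j ω ∂P) ^ 4 + (∑ j, a i j ^ 2) ^ 2)
          + ∑ i, ((∑ j, b i j * ∫ ω, V j ω ∂P) ^ 4 + (∑ j, b i j ^ 2) ^ 2))))) := by
  obtain ⟨h1, h2, h3⟩ := quartic_chaos hm hI hS hU hV hτ h0
    (c := fun i j k l => if j = k then 0 else a i j * b i k * s.loo i j k l)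
    (by rintro i j k l (rfl | rfl | rfl | rfl | rfl | rfl) <;> simp [ha, hb, loo])
  refine ⟨h1, h2, h3.trans (mul_le_mul_of_nonneg_left ?_ (by positivity))⟩
  have hδ := h.pos
  refine (Finset.expect_le Finset.univ_nonempty fun ε _ => Finset.expect_le_expect fun ε' _ =>
    Finset.expect_le_expect fun ε'' _ => h.quartic_coef_bound ha hb (abs_signed_le hκ hS ε)
      (abs_signed_le hκ hU ε') (abs_signed_le hκ hV ε'')).trans ?_
  simp_rw [← Finset.mul_expect]
  refine mul_le_mul_of_nonneg_left ?_ (by positivity)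
  exact expect_sq_mul_sq_le a b U V

include h hm hI hκ in
lemma centredL2_doubleForm {c : Fin n → Fin n → ℝ} (hc : ∀ i, c i i = 0)
    {U S X τ : Fin n → Ω → ℝ} (hU : Slot m P κ U) (hS : Slot m P κ S) (hX : Slot m P κ X)
    (hann : ∀ i j, ∑ k, s.Mc2 i k j * ∫ ω, X k ω ∂P = 0)
    (hτ : Slot m P κ τ) (h0 : ∀ i, ∫ ω, τ i ω ∂P = 0) :
    CentredL2 P (s.doubleForm c U S X τ)
      (2048 * κ ^ 2 * (3 * ((2 / δ ^ 2 + 1) * (2 * κ) ^ 4 * (κ ^ 2 * (1 + 4 / δ ^ 2))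
          + 288 * (2 * κ) ^ 6 / δ ^ 6) * rowColSq c)) := by
  obtain ⟨h1, h2, h3⟩ := quartic_chaos hm hI hU hS hX hτ h0
    (c := fun i j k l => c i j * s.loo i j j k * if i = k then 0 else s.loo j i k l)
    (by rintro i j k l (rfl | rfl | rfl | rfl | rfl | rfl) <;> simp [hc, loo])
  refine ⟨h1, h2, h3.trans (mul_le_mul_of_nonneg_left ?_ (by positivity))⟩
  have hδ := h.pos
  refine Finset.expect_le Finset.univ_nonempty fun ε _ =>
    Finset.expect_le Finset.univ_nonempty fun ε' _ => ?_
  refine (Finset.expect_le_expect fun ε'' _ => h.double_loo_coef_bound hc (abs_signed_le hκ hU ε)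
      (abs_signed_le hκ hS ε') (abs_signed_le hκ hX ε'')).trans ?_
  rw [← Finset.mul_expect, Finset.expect_add_distrib, ← Finset.mul_expect,
    Finset.expect_const Finset.univ_nonempty]
  have hμ : ∀ i, |∫ ω, X i ω ∂P| ≤ κ := fun i => abs_le_of_sq_le_sq (hX.sq_mean_le i) hκ
  have h4 := expect_rowColSq_le hc
    (Ξ := fun ε i j => ∑ k, signed P κ X ε k * s.loo i j j k)
    fun i j hij => h.expect_sq_residual_le hμ hann hij
  rw [mul_assoc 3]
  refine mul_le_mul_of_nonneg_left ?_ (by norm_num)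
  have h5 := mul_le_mul_of_nonneg_left h4
    (by positivity : 0 ≤ (2 / δ ^ 2 + 1) * (2 * κ) ^ 4)
  linarith

end Forms

end IVSample

/-! ### Frobenius norms and forms without leave-out weights -/

section GramSq

variable {n : ℕ}

/-- The squared Frobenius norm of `a * aᵀ`. -/
def gramSq (a : Fin n → Fin n → ℝ) : ℝ := ∑ i, ∑ i', (∑ j, a i j * a i' j) ^ 2

lemma gramSq_nonneg (a : Fin n → Fin n → ℝ) : 0 ≤ gramSq a :=
  Finset.sum_nonneg fun _ _ => Finset.sum_nonneg fun _ _ => sq_nonneg _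

lemma gramSq_transpose (a : Fin n → Fin n → ℝ) : gramSq (fun i j => a j i) = gramSq a := by
  simp only [gramSq, sq, Finset.sum_mul_sum]
  calc ∑ i, ∑ i', ∑ j, ∑ j', a j i * a j i' * (a j' i * a j' i')
      = ∑ j, ∑ j', ∑ i, ∑ i', a j i * a j i' * (a j' i * a j' i') := by
        simp_rw [Finset.sum_comm (s := Finset.univ (α := Fin n)) (t := Finset.univ)
          (f := fun i' j => ∑ j', a j _ * a j i' * (a j' _ * a j' i'))]
        rw [Finset.sum_comm]
        refine Finset.sum_congr rfl fun j _ => ?_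
        simp_rw [Finset.sum_comm (f := fun i' j' => a j _ * a j i' * (a j' _ * a j' i'))]
        rw [Finset.sum_comm]
    _ = _ := by
        refine Finset.sum_congr rfl fun j _ => Finset.sum_congr rfl fun j' _ =>
          Finset.sum_congr rfl fun i _ => Finset.sum_congr rfl fun i' _ => ?_
        ring

lemma sum_sq_sum_sq_le_gramSq (a : Fin n → Fin n → ℝ) :
    ∑ i, (∑ j, a i j ^ 2) ^ 2 ≤ gramSq a := by
  refine Finset.sum_le_sum fun i _ => ?_
  have := Finset.single_le_sum (f := fun i' => (∑ j, a i j * a i' j) ^ 2)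
    (fun _ _ => sq_nonneg _) (Finset.mem_univ i)
  simpa only [sq (a i _)] using this

lemma rowColSq_mul_le (a b : Fin n → Fin n → ℝ) :
    rowColSq (fun i j => a i j * b i j) ≤ gramSq a + gramSq b := by
  have key : ∀ a b : Fin n → Fin n → ℝ,
      ∑ i, (∑ j, |a i j * b i j|) ^ 2 ≤ (gramSq a + gramSq b) / 2 := by
    intro a b
    have : ∀ i, (∑ j, |a i j * b i j|) ^ 2
        ≤ ((∑ j, a i j ^ 2) ^ 2 + (∑ j, b i j ^ 2) ^ 2) / 2 := fun i => by
      have h1 := Finset.sum_mul_sq_le_sq_mul_sq Finset.univ (fun j => |a i j|) fun j => |b i j|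
      simp only [← abs_mul, sq_abs] at h1
      nlinarith [sq_nonneg (∑ j, a i j ^ 2 - ∑ j, b i j ^ 2)]
    refine (Finset.sum_le_sum fun i _ => this i).trans ?_
    rw [← Finset.sum_div, Finset.sum_add_distrib]
    have h2 := sum_sq_sum_sq_le_gramSq a
    have h3 := sum_sq_sum_sq_le_gramSq b
    linarith
  have h1 := key a b
  have h2 := key (fun i j => a j i) fun i j => b j i
  rw [gramSq_transpose a, gramSq_transpose b] at h2
  simp only [rowColSq]
  linarith

lemma sq_sum_mul_eq (x : Fin n → ℝ) (a : Fin n → Fin n → ℝ) :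
    ∑ j, (∑ i, x i * a i j) ^ 2 = ∑ i, ∑ i', (x i * x i') * ∑ j, a i j * a i' j := by
  simp only [sq, Finset.sum_mul_sum]
  simp only [Finset.mul_sum]
  rw [Finset.sum_comm]
  refine Finset.sum_congr rfl fun i _ => ?_
  rw [Finset.sum_comm]
  refine Finset.sum_congr rfl fun i' _ => Finset.sum_congr rfl fun j _ => ?_
  ring

/-- The operator norm is at most the fourth root of `gramSq`. -/
lemma sum_sq_comb_le_gramSq (x : Fin n → ℝ) (a : Fin n → Fin n → ℝ) :
    ∑ j, (∑ i, x i * a i j) ^ 2 ≤ √(gramSq a) * ∑ i, x i ^ 2 := by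
  have h1 := IVSample.sq_sum_sum_mul_le (fun i i' => x i * x i') fun i i' => ∑ j, a i j * a i' j
  have h2 : ∑ i, ∑ i', (x i * x i') ^ 2 = (∑ i, x i ^ 2) ^ 2 := by
    simp only [mul_pow, sq (∑ i, x i ^ 2), Finset.sum_mul_sum]
  rw [← sq_sum_mul_eq, h2] at h1
  have h3 : 0 ≤ ∑ i, x i ^ 2 := Finset.sum_nonneg fun _ _ => sq_nonneg _
  refine le_of_sq_le_sq ?_ (by positivity)
  rw [mul_pow, Real.sq_sqrt (gramSq_nonneg a), mul_comm]
  exact h1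

lemma sum_sq_triple_le_gramSq {x : Fin n → ℝ} {κ : ℝ} (hx : ∀ i, |x i| ≤ κ)
    (a b : Fin n → Fin n → ℝ) :
    ∑ j, ∑ k, (∑ i, x i * (a i j * b i k)) ^ 2 ≤ κ ^ 2 * (gramSq a + gramSq b) := by
  have e : ∑ j, ∑ k, (∑ i, x i * (a i j * b i k)) ^ 2
      = ∑ i, ∑ i', (x i * x i') * ((∑ j, a i j * a i' j) * ∑ k, b i k * b i' k) := by
    have := fun j => sq_sum_mul_eq (fun i => x i * a i j) b
    simp only [← mul_assoc] at this ⊢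
    simp_rw [this]
    rw [Finset.sum_comm]
    refine Finset.sum_congr rfl fun i _ => ?_
    rw [Finset.sum_comm]
    refine Finset.sum_congr rfl fun i' _ => ?_
    rw [← Finset.sum_mul]
    congr 1
    rw [Finset.mul_sum]
    exact Finset.sum_congr rfl fun j _ => by ring
  rw [e]
  simp only [gramSq, ← Finset.sum_add_distrib, Finset.mul_sum (s := Finset.univ) (a := κ ^ 2)]
  refine Finset.sum_le_sum fun i _ => Finset.sum_le_sum fun i' _ => ?_
  generalize ∑ j, a i j * a i' j = A
  generalize ∑ j, b i j * b i' j = A'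
  have h1 : |x i * x i'| ≤ κ ^ 2 := by
    rw [abs_mul, sq]
    exact mul_le_mul (hx i) (hx i') (abs_nonneg _) ((abs_nonneg _).trans (hx i))
  calc _ ≤ |x i * x i' * (A * A')| := le_abs_self _
    _ = |x i * x i'| * |A * A'| := abs_mul _ _
    _ ≤ κ ^ 2 * (A ^ 2 + A' ^ 2) := by
        refine mul_le_mul h1 ?_ (abs_nonneg _) (sq_nonneg _)
        rw [abs_le]
        constructor <;> nlinarith [sq_nonneg (A + A'), sq_nonneg (A - A')]

lemma sum_sq_mixed_le_gramSq {x μ p : Fin n → ℝ} {κ : ℝ} (hx : ∀ i, |x i| ≤ κ)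
    (hμ : ∀ i, |μ i| ≤ κ) (a b : Fin n → Fin n → ℝ) :
    ∑ j, (∑ i, x i * a i j * (p i - b i j * μ j)) ^ 2
      ≤ 2 * κ ^ 2 * (√(gramSq a) * ∑ i, p i ^ 2) + 2 * κ ^ 4 * (gramSq a + gramSq b) := by
  have h1 := sum_sq_comb_le_gramSq (fun i => x i * p i) a
  have h2 : ∑ i, (x i * p i) ^ 2 ≤ κ ^ 2 * ∑ i, p i ^ 2 := by
    rw [Finset.mul_sum]
    refine Finset.sum_le_sum fun i _ => ?_
    rw [mul_pow]
    exact mul_le_mul_of_nonneg_right (IVSample.sq_le_sq_of_abs_le (hx i)) (sq_nonneg _)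
  have h3 : ∑ j, (∑ i, |a i j * b i j|) ^ 2 ≤ gramSq a + gramSq b :=
    (le_add_of_nonneg_left (Finset.sum_nonneg fun _ _ => sq_nonneg _)).trans (rowColSq_mul_le a b)
  have h4 : ∀ j, (∑ i, a i j * b i j * (x i * μ j)) ^ 2 ≤ κ ^ 4 * (∑ i, |a i j * b i j|) ^ 2 := by
    intro j
    have hxμ : ∀ i, |x i * μ j| ≤ κ ^ 2 := fun i => by
      rw [abs_mul, sq]
      exact mul_le_mul (hx i) (hμ j) (abs_nonneg _) ((abs_nonneg _).trans (hx i))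
    exact (IVSample.sq_le_sq_of_abs_le (Finset.abs_sum_le_sum_abs _ _)).trans
      ((sq_sum_abs_mul_le (c := fun i => a i j * b i j) hxμ).trans_eq (by ring))
  calc _ ≤ ∑ j, (2 * (∑ i, x i * p i * a i j) ^ 2
        + 2 * (κ ^ 4 * (∑ i, |a i j * b i j|) ^ 2)) := by
        refine Finset.sum_le_sum fun j _ => ?_
        have e : ∑ i, x i * a i j * (p i - b i j * μ j)
            = ∑ i, x i * p i * a i j - ∑ i, a i j * b i j * (x i * μ j) := by
          rw [← Finset.sum_sub_distrib]
          exact Finset.sum_congr rfl fun i _ => by ring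
        rw [e]
        have := h4 j
        nlinarith [sq_nonneg (∑ i, x i * p i * a i j + ∑ i, a i j * b i j * (x i * μ j))]
    _ ≤ _ := by
        rw [Finset.sum_add_distrib, ← Finset.mul_sum, ← Finset.mul_sum, ← Finset.mul_sum]
        have h5 := mul_le_mul_of_nonneg_left h2 (Real.sqrt_nonneg (gramSq a))
        have h6 : κ ^ 4 * ∑ j, (∑ i, |a i j * b i j|) ^ 2 ≤ κ ^ 4 * (gramSq a + gramSq b) :=
          mul_le_mul_of_nonneg_left h3 (by positivity)
        linarith

end GramSq

section LowOrder

open scoped BigOperators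

variable {n : ℕ} {Ω : Type*} [mΩ : MeasurableSpace Ω] {P : Measure Ω} [IsProbabilityMeasure P]
  {m : Fin n → MeasurableSpace Ω} (hm : ∀ i, m i ≤ mΩ) (hI : iIndep m P) {κ : ℝ} (hκ : 0 ≤ κ)

lemma Slot.abs_mean_le {F : Fin n → Ω → ℝ} (hκ : 0 ≤ κ) (hF : Slot m P κ F) (i : Fin n) :
    |∫ ω, F i ω ∂P| ≤ κ := abs_le_of_sq_le_sq (hF.sq_mean_le i) hκ

include hm hI hκ

/-- Centred quadratic forms in two slots, without diagonal terms. -/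
lemma centredL2_bilinear {c : Fin n → Fin n → ℝ} (hc : ∀ i, c i i = 0) {H W : Fin n → Ω → ℝ}
    (hH : Slot m P κ H) (hW : Slot m P κ W) :
    CentredL2 P (fun ω => ∑ i, ∑ j, c i j * (H i ω * W j ω)
        - ∑ i, ∑ j, c i j * ((∫ ω', H i ω' ∂P) * ∫ ω', W j ω' ∂P))
      (66 * κ ^ 4 * rowColSq c) := by
  obtain ⟨h1, h2, h3⟩ := quadratic_chaos hm hI hW hH.sub_mean
    (fun i => integral_sub_mean (hH.integrable i)) (c := fun j i => c i j) hc
  obtain ⟨g1, g2, g3⟩ := linear_chaos hm hI hW.sub_mean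
    (fun i => integral_sub_mean (hW.integrable i)) (fun j => ∑ i, c i j * ∫ ω, H i ω ∂P)
  have hr : rowColSq c = ∑ i, (∑ j, |c i j|) ^ 2 + ∑ j, (∑ i, |c i j|) ^ 2 := rfl
  have p1 : 0 ≤ ∑ i, (∑ j, |c i j|) ^ 2 := Finset.sum_nonneg fun _ _ => sq_nonneg _
  have p2 : 0 ≤ ∑ j, (∑ i, |c i j|) ^ 2 := Finset.sum_nonneg fun _ _ => sq_nonneg _
  have A : CentredL2 P (fun ω => ∑ j, ∑ i, c i j * (W j ω * (H i ω - ∫ ω', H i ω' ∂P)))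
      (8 * κ ^ 2 * ((2 * κ) ^ 2 * rowColSq c)) := by
    refine ⟨h1, h2, h3.trans (mul_le_mul_of_nonneg_left ?_ (by positivity))⟩
    refine Finset.expect_le Finset.univ_nonempty fun ε _ => ?_
    refine le_trans ?_ (mul_le_mul_of_nonneg_left (hr ▸ le_add_of_nonneg_right p2)
      (by positivity))
    rw [Finset.mul_sum]
    refine Finset.sum_le_sum fun i _ => ?_
    have := sq_sum_abs_mul_le (c := fun j => c i j) (abs_signed_le hκ hW ε)
    refine le_trans (IVSample.sq_le_sq_of_abs_le ?_) this
    simp_rw [mul_comm (signed P κ W ε _)]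
    exact Finset.abs_sum_le_sum_abs _ _
  have B : CentredL2 P (fun ω => ∑ j, (∑ i, c i j * ∫ ω, H i ω ∂P) * (W j ω - ∫ ω', W j ω' ∂P))
      (κ ^ 2 * (κ ^ 2 * rowColSq c)) := by
    refine ⟨g1, g2, g3.trans (mul_le_mul_of_nonneg_left ?_ (by positivity))⟩
    refine le_trans ?_ (mul_le_mul_of_nonneg_left (hr ▸ le_add_of_nonneg_left p1)
      (by positivity))
    rw [Finset.mul_sum]
    refine Finset.sum_le_sum fun j _ => ?_
    exact le_trans (IVSample.sq_le_sq_of_abs_le (Finset.abs_sum_le_sum_abs _ _))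
      (sq_sum_abs_mul_le (c := fun i => c i j) (hH.abs_mean_le hκ))
  refine ((A.add B).congr fun ω => ?_).mono (le_of_eq (by ring))
  rw [Finset.sum_comm (f := fun j i => c i j * (W j ω * (H i ω - ∫ ω', H i ω' ∂P)))]
  simp only [Finset.sum_mul]
  rw [Finset.sum_comm (f := fun j i => c i j * (∫ ω, H i ω ∂P) * (W j ω - ∫ ω', W j ω' ∂P))]
  simp only [← Finset.sum_add_distrib, ← Finset.sum_sub_distrib]
  refine Finset.sum_congr rfl fun i _ => Finset.sum_congr rfl fun j _ => ?_
  ring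

/-- Centred trilinear forms in three slots, without coinciding indices. -/
lemma centredL2_trilinear {a b : Fin n → Fin n → ℝ} (ha : ∀ i, a i i = 0) (hb : ∀ i, b i i = 0)
    {H U V : Fin n → Ω → ℝ} (hH : Slot m P κ H) (hU : Slot m P κ U) (hV : Slot m P κ V) :
    CentredL2 P (fun ω => ∑ i, ∑ j, ∑ k, (if j = k then 0 else a i j * b i k)
          * (H i ω * U j ω * V k ω)
        - ∑ i, ∑ j, ∑ k, (if j = k then 0 else a i j * b i k)
          * ((∫ ω', H i ω' ∂P) * (∫ ω', U j ω' ∂P) * ∫ ω', V k ω' ∂P))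
      (20000 * κ ^ 2 * (1 + κ ^ 2) ^ 2 * (gramSq a + gramSq b
        + ∑ i, (∑ j, a i j * ∫ ω, U j ω ∂P) ^ 4 + ∑ i, (∑ j, b i j * ∫ ω, V j ω ∂P) ^ 4
        + √(gramSq a) * ∑ i, (∑ j, b i j * ∫ ω, V j ω ∂P) ^ 2
        + √(gramSq b) * ∑ i, (∑ j, a i j * ∫ ω, U j ω ∂P) ^ 2)) := by
  set μH : Fin n → ℝ := fun i => ∫ ω, H i ω ∂P with hμH
  set μU : Fin n → ℝ := fun i => ∫ ω, U i ω ∂P with hμU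
  set μV : Fin n → ℝ := fun i => ∫ ω, V i ω ∂P with hμV
  have aH : ∀ i, |μH i| ≤ κ := hH.abs_mean_le hκ
  have aU : ∀ i, |μU i| ≤ κ := hU.abs_mean_le hκ
  have aV : ∀ i, |μV i| ≤ κ := hV.abs_mean_le hκ
  set p : Fin n → ℝ := fun i => ∑ j, a i j * μU j with hp
  set p' : Fin n → ℝ := fun i => ∑ j, b i j * μV j with hp'
  have hga := gramSq_nonneg a
  have hgb := gramSq_nonneg b
  have hab := rowColSq_mul_le a b
  have hr : rowColSq (fun i j => a i j * b i j)
    = ∑ i, (∑ j, |a i j * b i j|) ^ 2 + ∑ j, (∑ i, |a i j * b i j|) ^ 2 := rfl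
  have q1 : 0 ≤ ∑ i, (∑ j, |a i j * b i j|) ^ 2 := Finset.sum_nonneg fun _ _ => sq_nonneg _
  have q2 : 0 ≤ ∑ j, (∑ i, |a i j * b i j|) ^ 2 := Finset.sum_nonneg fun _ _ => sq_nonneg _
  have hrow : ∑ i, (∑ j, |a i j * b i j|) ^ 2 ≤ gramSq a + gramSq b := by linarith
  have hcol : ∑ j, (∑ i, |a i j * b i j|) ^ 2 ≤ gramSq a + gramSq b := by linarith
  have a1 := sum_sq_sum_sq_le_gramSq a
  have b1 := sum_sq_sum_sq_le_gramSq b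
  set c : Fin n → Fin n → Fin n → ℝ := fun j k i => if j = k then 0 else a i j * b i k with hc
  -- the term that involves the fluctuation of `H`
  have A : CentredL2 P (fun ω => ∑ j, ∑ k, ∑ i, c j k i * (U j ω * V k ω * (H i ω - μH i)))
      (108 * κ ^ 2 * (2 * ((1 + κ ^ 2) ^ 2 * (∑ i, p i ^ 4 + gramSq a + (∑ i, p' i ^ 4 + gramSq b)))
        + 32 * κ ^ 4 * (gramSq a + gramSq b))) := by
    obtain ⟨h1, h2, h3⟩ := cubic_chaos hm hI hU hV hH.sub_mean
      (fun i => integral_sub_mean (hH.integrable i)) (c := c)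
      (by rintro j k l (rfl | rfl | rfl) <;> simp [hc, ha, hb])
    refine ⟨h1, h2, h3.trans (mul_le_mul_of_nonneg_left ?_ (by positivity))⟩
    have e : ∀ ε ε', ∑ i, (∑ j, ∑ k, signed P κ U ε j * signed P κ V ε' k * c j k i) ^ 2
        ≤ 2 * (∑ i, ((∑ j, a i j * signed P κ U ε j) ^ 2 + ∑ j, a i j ^ 2)
            * ((∑ k, b i k * signed P κ V ε' k) ^ 2 + ∑ k, b i k ^ 2))
          + 32 * κ ^ 4 * (gramSq a + gramSq b) := by
      intro ε ε'
      have e1 : ∀ i, ∑ j, ∑ k, signed P κ U ε j * signed P κ V ε' k * c j k i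
          = (∑ j, a i j * signed P κ U ε j) * (∑ k, b i k * signed P κ V ε' k)
            - ∑ j, a i j * b i j * (signed P κ U ε j * signed P κ V ε' j) := by
        intro i
        rw [Finset.sum_mul_sum, ← Finset.sum_sub_distrib]
        refine Finset.sum_congr rfl fun j _ => ?_
        have : ∀ k, signed P κ U ε j * signed P κ V ε' k * c j k i
            = a i j * signed P κ U ε j * (b i k * signed P κ V ε' k)
              - if j = k then a i j * b i k * (signed P κ U ε j * signed P κ V ε' k) else 0 := by
          intro k
          simp only [hc]
          split_ifs <;> ring
        simp_rw [this]
        rw [Finset.sum_sub_distrib, Finset.sum_ite_eq]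
        simp
      have e2 : ∀ i, (∑ j, a i j * b i j * (signed P κ U ε j * signed P κ V ε' j)) ^ 2
          ≤ 16 * κ ^ 4 * (∑ j, |a i j * b i j|) ^ 2 := by
        intro i
        have h4 : ∀ j, |signed P κ U ε j * signed P κ V ε' j| ≤ 4 * κ ^ 2 := fun j => by
          rw [abs_mul]
          calc _ ≤ 2 * κ * (2 * κ) := mul_le_mul (abs_signed_le hκ hU ε j)
                (abs_signed_le hκ hV ε' j) (abs_nonneg _) (by positivity)
            _ = _ := by ring
        refine (IVSample.sq_le_sq_of_abs_le (Finset.abs_sum_le_sum_abs _ _)).trans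
          ((sq_sum_abs_mul_le (c := fun j => a i j * b i j) h4).trans_eq (by ring))
      have e3 : 32 * κ ^ 4 * (∑ i, (∑ j, |a i j * b i j|) ^ 2)
          ≤ 32 * κ ^ 4 * (gramSq a + gramSq b) := mul_le_mul_of_nonneg_left hrow (by positivity)
      refine le_trans ?_ (add_le_add_right e3 _)
      rw [Finset.mul_sum, Finset.mul_sum, ← Finset.sum_add_distrib]
      refine Finset.sum_le_sum fun i _ => ?_
      rw [e1]
      have e4 := e2 i
      have e5 : 0 ≤ ∑ j, a i j ^ 2 := Finset.sum_nonneg fun _ _ => sq_nonneg _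
      have e6 : 0 ≤ ∑ j, b i j ^ 2 := Finset.sum_nonneg fun _ _ => sq_nonneg _
      have e7 := mul_le_mul
        (le_add_of_nonneg_right e5 : (∑ j, a i j * signed P κ U ε j) ^ 2 ≤ _)
        (le_add_of_nonneg_right e6 : (∑ j, b i j * signed P κ V ε' j) ^ 2 ≤ _)
        (sq_nonneg _) (by positivity)
      rw [← mul_pow] at e7
      generalize (∑ j, a i j * signed P κ U ε j) * ∑ k, b i k * signed P κ V ε' k = X at *
      nlinarith [sq_nonneg (X + ∑ j, a i j * b i j * (signed P κ U ε j * signed P κ V ε' j))]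
    refine (Finset.expect_le_expect fun ε _ => Finset.expect_le_expect fun ε' _ => e ε ε').trans ?_
    simp_rw [Finset.expect_add_distrib, Finset.expect_const Finset.univ_nonempty,
      ← Finset.mul_expect]
    refine add_le_add_left (mul_le_mul_of_nonneg_left ((IVSample.expect_sq_mul_sq_le a b U V).trans ?_)
      (by norm_num)) _
    refine mul_le_mul_of_nonneg_left ?_ (by positivity)
    rw [Finset.sum_add_distrib, Finset.sum_add_distrib]
    exact add_le_add (add_le_add_right a1 _) (add_le_add_right b1 _)
  -- the term that involves the fluctuation of `U` and the mean of `H`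
  have B : CentredL2 P (fun ω => ∑ k, ∑ j, (if k = j then 0 else ∑ i, μH i * (a i j * b i k))
        * (V k ω * (U j ω - μU j)))
      (8 * κ ^ 2 * ((2 * κ ^ 2 * (√(gramSq a) * ∑ i, p' i ^ 2)
        + 2 * κ ^ 4 * (gramSq a + gramSq b)) + κ ^ 2 * (κ ^ 2 * (gramSq a + gramSq b)))) := by
    obtain ⟨h1, h2, h3⟩ := quadratic_chaos hm hI hV hU.sub_mean
      (fun i => integral_sub_mean (hU.integrable i))
      (c := fun k j => if k = j then 0 else ∑ i, μH i * (a i j * b i k)) (by simp)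
    refine ⟨h1, h2, h3.trans (mul_le_mul_of_nonneg_left ?_ (by positivity))⟩
    rw [Finset.expect_sum_comm]
    have e1 : ∀ j, ∑ k, μV k * (if k = j then 0 else ∑ i, μH i * (a i j * b i k))
        = ∑ i, μH i * a i j * (p' i - b i j * μV j) := by
      intro j
      have : ∀ k, μV k * (if k = j then 0 else ∑ i, μH i * (a i j * b i k))
          = ∑ i, μH i * a i j * (b i k * μV k)
            - if k = j then ∑ i, μH i * a i j * (b i k * μV k) else 0 := by
        intro k
        split_ifs
        · simp
        · rw [sub_zero, Finset.mul_sum]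
          exact Finset.sum_congr rfl fun i _ => by ring
      simp_rw [this]
      rw [Finset.sum_sub_distrib, Finset.sum_ite_eq' _ j, if_pos (Finset.mem_univ j),
        Finset.sum_comm, ← Finset.sum_sub_distrib]
      refine Finset.sum_congr rfl fun i _ => ?_
      simp only [hp', ← Finset.mul_sum]
      ring
    have e2 : ∑ j, ∑ k, (if k = j then 0 else ∑ i, μH i * (a i j * b i k)) ^ 2
        ≤ κ ^ 2 * (gramSq a + gramSq b) := by
      refine le_trans (Finset.sum_le_sum fun j _ => Finset.sum_le_sum fun k _ => ?_)
        (sum_sq_triple_le_gramSq aH a b)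
      split_ifs
      · simp only [ne_eq, OfNat.ofNat_ne_zero, not_false_eq_true, zero_pow]
        exact sq_nonneg _
      · rfl
    have e3 : ∀ j, 𝔼 ε : Fin n → Bool, (∑ k, signed P κ V ε k
          * (if k = j then 0 else ∑ i, μH i * (a i j * b i k))) ^ 2
        = (∑ i, μH i * a i j * (p' i - b i j * μV j)) ^ 2
          + κ ^ 2 * ∑ k, (if k = j then 0 else ∑ i, μH i * (a i j * b i k)) ^ 2 := by
      intro j
      rw [← e1]
      exact expect_sq_sum μV _ κ
    simp_rw [e3]
    rw [Finset.sum_add_distrib, ← Finset.mul_sum]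
    exact add_le_add (sum_sq_mixed_le_gramSq aH aV a b)
      (mul_le_mul_of_nonneg_left e2 (sq_nonneg κ))
  -- the term that involves the fluctuation of `V` only
  have C : CentredL2 P (fun ω => ∑ k, (∑ i, μH i * b i k * (p i - a i k * μU k))
        * (V k ω - μV k))
      (κ ^ 2 * (2 * κ ^ 2 * (√(gramSq b) * ∑ i, p i ^ 2) + 2 * κ ^ 4 * (gramSq a + gramSq b))) := by
    obtain ⟨h1, h2, h3⟩ := linear_chaos hm hI hV.sub_mean
      (fun i => integral_sub_mean (hV.integrable i))
      (fun k => ∑ i, μH i * b i k * (p i - a i k * μU k))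
    refine ⟨h1, h2, h3.trans (mul_le_mul_of_nonneg_left ?_ (by positivity))⟩
    rw [add_comm (gramSq a)]
    exact sum_sq_mixed_le_gramSq aH aU b a
  refine (((A.add B).add C).congr fun ω => ?_).mono ?_
  · have e1 : ∑ j, ∑ k, ∑ i, c j k i * (U j ω * V k ω * (H i ω - μH i))
        = ∑ i, ∑ j, ∑ k, (if j = k then 0 else a i j * b i k)
          * (U j ω * V k ω * (H i ω - μH i)) := by
      rw [Finset.sum_comm (f := fun i j => ∑ k, (if j = k then 0 else a i j * b i k)
          * (U j ω * V k ω * (H i ω - μH i)))]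
      exact Finset.sum_congr rfl fun j _ => Finset.sum_comm
    have e2 : ∑ k, ∑ j, (if k = j then 0 else ∑ i, μH i * (a i j * b i k))
          * (V k ω * (U j ω - μU j))
        = ∑ i, ∑ j, ∑ k, (if j = k then 0 else a i j * b i k)
          * (μH i * (V k ω * (U j ω - μU j))) := by
      rw [Finset.sum_comm]
      rw [Finset.sum_comm (f := fun i j => ∑ k, (if j = k then 0 else a i j * b i k)
          * (μH i * (V k ω * (U j ω - μU j))))]
      refine Finset.sum_congr rfl fun j _ => ?_
      rw [Finset.sum_comm]
      refine Finset.sum_congr rfl fun k _ => ?_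
      by_cases hjk : j = k
      · simp [hjk]
      · simp only [if_neg hjk, if_neg (Ne.symm hjk)]
        rw [Finset.sum_mul]
        exact Finset.sum_congr rfl fun i _ => by ring
    have e3 : ∑ k, (∑ i, μH i * b i k * (p i - a i k * μU k)) * (V k ω - μV k)
        = ∑ i, ∑ j, ∑ k, (if j = k then 0 else a i j * b i k)
          * (μH i * μU j * (V k ω - μV k)) := by
      simp_rw [Finset.sum_mul]
      rw [Finset.sum_comm]
      refine Finset.sum_congr rfl fun i _ => ?_
      rw [Finset.sum_comm]
      refine Finset.sum_congr rfl fun k _ => ?_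
      have : ∀ j, (if j = k then 0 else a i j * b i k) * (μH i * μU j * (V k ω - μV k))
          = a i j * μU j * (μH i * b i k * (V k ω - μV k))
            - if j = k then a i j * μU j * (μH i * b i k * (V k ω - μV k)) else 0 := by
        intro j
        split_ifs <;> ring
      simp_rw [this]
      rw [Finset.sum_sub_distrib, Finset.sum_ite_eq' _ k, if_pos (Finset.mem_univ k),
        ← Finset.sum_mul]
      simp only [hp]
      ring
    rw [e1, e2, e3]
    simp only [← Finset.sum_add_distrib, ← Finset.sum_sub_distrib]
    refine Finset.sum_congr rfl fun i _ => Finset.sum_congr rfl fun j _ =>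
      Finset.sum_congr rfl fun k _ => ?_
    ring
  · have s1 : 0 ≤ ∑ i, p i ^ 4 := Finset.sum_nonneg fun _ _ => by positivity
    have s2 : 0 ≤ ∑ i, p' i ^ 4 := Finset.sum_nonneg fun _ _ => by positivity
    have s3 : 0 ≤ √(gramSq a) * ∑ i, p' i ^ 2 :=
      mul_nonneg (Real.sqrt_nonneg _) (Finset.sum_nonneg fun _ _ => sq_nonneg _)
    have s4 : 0 ≤ √(gramSq b) * ∑ i, p i ^ 2 :=
      mul_nonneg (Real.sqrt_nonneg _) (Finset.sum_nonneg fun _ _ => sq_nonneg _)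
    generalize ∑ i, p i ^ 4 = P4 at *
    generalize ∑ i, p' i ^ 4 = P4' at *
    generalize √(gramSq a) * ∑ i, p' i ^ 2 = T at *
    generalize √(gramSq b) * ∑ i, p i ^ 2 = T' at *
    generalize gramSq a = ga at *
    generalize gramSq b = gb at *
    have hw1 : κ ^ 2 ≤ (1 + κ ^ 2) ^ 2 := by nlinarith [sq_nonneg κ]
    have hw2 : κ ^ 4 ≤ (1 + κ ^ 2) ^ 2 := by nlinarith [sq_nonneg κ]
    have hk : 0 ≤ κ ^ 2 := sq_nonneg κ
    generalize hw : (1 + κ ^ 2) ^ 2 = w at *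
    have t1 : κ ^ 4 * (ga + gb) ≤ w * (ga + gb) := mul_le_mul_of_nonneg_right hw2 (by linarith)
    have t2 : κ ^ 2 * T ≤ w * T := mul_le_mul_of_nonneg_right hw1 s3
    have t3 : κ ^ 2 * T' ≤ w * T' := mul_le_mul_of_nonneg_right hw1 s4
    have hw0 : 0 ≤ w := by rw [← hw]; positivity
    have u1 := mul_nonneg hw0 (add_nonneg s1 s2)
    have u2 := mul_nonneg hw0 s3
    have u3 := mul_nonneg hw0 s4
    have u4 := mul_nonneg hw0 (add_nonneg hga hgb)
    have key : 4 * (108 * (2 * (w * (P4 + ga + (P4' + gb))) + 32 * κ ^ 4 * (ga + gb))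
        + 8 * ((2 * κ ^ 2 * T + 2 * κ ^ 4 * (ga + gb)) + κ ^ 2 * (κ ^ 2 * (ga + gb))))
        + 2 * (2 * κ ^ 2 * T' + 2 * κ ^ 4 * (ga + gb))
        ≤ 20000 * w * (ga + gb + P4 + P4' + T + T') := by nlinarith
    have := mul_le_mul_of_nonneg_left key hk
    linarith

end LowOrder

/-! ### The estimator in terms of leave-out weights -/

namespace IVSample

section Decomposition

variable {Ω : Type*} [MeasurableSpace Ω] {P : Measure Ω} {n K L : ℕ} (s : IVSample Ω P n K L)

/-- The weights `G` with the diagonal removed. -/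
def offG (i j : Fin n) : ℝ := if i = j then 0 else s.G i j

/-- The transpose of `offG`. -/
def offGT (i j : Fin n) : ℝ := s.offG j i

lemma offG_self (i : Fin n) : s.offG i i = 0 := if_pos rfl

lemma offGT_self (i : Fin n) : s.offGT i i = 0 := if_pos rfl

lemma sum_compl_singleton (i : Fin n) (f : Fin n → ℝ) :
    ∑ j ∈ {i}ᶜ, f j = ∑ j, if i = j then 0 else f j := by
  rw [← Finset.sum_subset (Finset.subset_univ ({i}ᶜ : Finset (Fin n)))]
  · refine Finset.sum_congr rfl fun j hj => ?_
    rw [if_neg fun h => by simp [h] at hj]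
  · intro j _ hj
    rw [if_pos (by simpa [eq_comm] using hj)]

/-- The sums `A₁`, `A₂`, `A₃` in terms of the weights of the leave-out residual. -/
def leaveOutForm (a b : Fin n → Fin n → ℝ) (S U V τ : Fin n → Ω → ℝ) (ω : Ω) : ℝ :=
  ∑ i, ∑ j, ∑ k, a i j * b i k * (S i ω * U j ω * V k ω)
    * (τ i ω + ∑ l, s.loo i j k l * τ l ω)

/-- The sums `A₄`, `A₅` in terms of the weights of the leave-out residual. -/
def doubleOutForm (c : Fin n → Fin n → ℝ) (U S τ : Fin n → Ω → ℝ) (ω : Ω) : ℝ :=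
  ∑ i, ∑ j, ∑ k, c i j * s.Mc2 i k j * (U i ω * S j ω * s.X k ω)
    * (τ j ω + ∑ l, s.loo j i k l * τ l ω)

lemma leaveOutForm_eq (a b : Fin n → Fin n → ℝ) (S U V τ : Fin n → Ω → ℝ) (ω : Ω) :
    s.leaveOutForm a b S U V τ ω
      = ∑ i, ∑ j, ∑ k, (if j = k then 0 else a i j * b i k)
            * (S i ω * τ i ω * U j ω * V k ω)
        + ∑ i, ∑ j, a i j * b i j * (S i ω * τ i ω * (U j ω * V j ω))
        + s.quarticForm a b S U V τ ω
        + s.cubicForm (fun i j => a i j * b i j) S (fun j ω => U j ω * V j ω) τ ω := by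
  simp only [leaveOutForm, quarticForm, cubicForm, ← Finset.sum_add_distrib]
  refine Finset.sum_congr rfl fun i _ => Finset.sum_congr rfl fun j _ => ?_
  have h1 : ∀ k, a i j * b i k * (S i ω * U j ω * V k ω) * (τ i ω + ∑ l, s.loo i j k l * τ l ω)
      = (if j = k then 0 else a i j * b i k) * (S i ω * τ i ω * U j ω * V k ω)
        + ∑ l, (if j = k then 0 else a i j * b i k * s.loo i j k l)
          * (S i ω * U j ω * V k ω * τ l ω)
        + if j = k then a i j * b i k * (S i ω * τ i ω * (U j ω * V k ω))
          + ∑ l, a i j * b i k * s.loo i j k l * (S i ω * (U j ω * V k ω) * τ l ω) else 0 := by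
    intro k
    split_ifs
    · simp only [zero_mul, Finset.sum_const_zero, zero_add, mul_add, Finset.mul_sum]
      refine congrArg₂ _ (by ring) (Finset.sum_congr rfl fun l _ => by ring)
    · simp only [add_zero, mul_add, Finset.mul_sum]
      refine congrArg₂ _ (by ring) (Finset.sum_congr rfl fun l _ => by ring)
  simp_rw [h1]
  rw [Finset.sum_add_distrib, Finset.sum_add_distrib, Finset.sum_ite_eq,
    if_pos (Finset.mem_univ j)]
  ring

/-- The leave-two-out residual of `X` in terms of the first-stage errors. -/
lemma sum_Mc2_mul_X (hQ : IsUnit (s.Q.transpose * s.Q)) {i j : Fin n} (h2 : s.D2 i j ≠ 0)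
    (ω : Ω) : ∑ k, s.Mc2 i k j * s.X k ω = s.η i ω + ∑ k, s.loo i j j k * s.η k ω := by
  simp only [X, mul_add, Finset.sum_add_distrib, s.sum_Mc2_mul_R hQ, zero_add]
  have : ∀ k, s.Mc2 i k j * s.η k ω
      = (if i = k then s.η k ω else 0) + s.loo i j j k * s.η k ω := by
    intro k
    by_cases hik : i = k
    · subst hik
      rw [s.Mc2_self h2]
      simp [loo]
    · by_cases hjk : j = k
      · subst hjk
        rw [s.Mc2_right]
        simp [loo, hik]
      · simp [loo, hik, Ne.symm hik, Ne.symm hjk]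
  simp_rw [this]
  rw [Finset.sum_add_distrib, Finset.sum_ite_eq, if_pos (Finset.mem_univ i)]

lemma doubleOutForm_eq (hQ : IsUnit (s.Q.transpose * s.Q)) (hD : ∀ i j, i ≠ j → s.D2 i j ≠ 0)
    {c : Fin n → Fin n → ℝ} (hc : ∀ i, c i i = 0) (U S τ : Fin n → Ω → ℝ) (ω : Ω) :
    s.doubleOutForm c U S τ ω
      = ∑ i, ∑ j, c i j * (U i ω * s.η i ω * (S j ω * τ j ω))
        + s.cubicForm c U (fun j ω => S j ω * τ j ω) s.η ω
        + s.cubicForm (fun i j => c j i) S (fun i ω => U i ω * s.X i ω) τ ω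
        + s.doubleForm c U S s.X τ ω := by
  have e : s.cubicForm (fun i j => c j i) S (fun i ω => U i ω * s.X i ω) τ ω
      = ∑ i, ∑ j, ∑ l, c i j * s.loo j i i l * (S j ω * (U i ω * s.X i ω) * τ l ω) :=
    Finset.sum_comm
  rw [e]
  simp only [doubleOutForm, doubleForm, cubicForm, ← Finset.sum_add_distrib]
  refine Finset.sum_congr rfl fun i _ => Finset.sum_congr rfl fun j _ => ?_
  by_cases hij : i = j
  · subst hij
    simp [hc]
  have h1 : ∀ k, c i j * s.Mc2 i k j * (U i ω * S j ω * s.X k ω)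
        * (τ j ω + ∑ l, s.loo j i k l * τ l ω)
      = c i j * (U i ω * (S j ω * τ j ω)) * (s.Mc2 i k j * s.X k ω)
        + (if i = k then ∑ l, c i j * s.loo j i k l * (S j ω * (U i ω * s.X k ω) * τ l ω) else 0)
        + ∑ l, (c i j * s.loo i j j k * if i = k then 0 else s.loo j i k l)
          * (U i ω * S j ω * s.X k ω * τ l ω) := by
    intro k
    have h2 : s.Mc2 i k j * ∑ l, s.loo j i k l * τ l ω
        = (if i = k then ∑ l, s.loo j i k l * τ l ω else 0)
          + ∑ l, (s.loo i j j k * if i = k then 0 else s.loo j i k l) * τ l ω := by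
      by_cases hik : i = k
      · subst hik
        simp [s.Mc2_self (hD i j hij)]
      · by_cases hjk : j = k
        · subst hjk
          simp [s.Mc2_right, hik, loo]
        · simp [loo, hik, Ne.symm hik, Ne.symm hjk, Finset.mul_sum, mul_assoc]
    have h3 : c i j * s.Mc2 i k j * (U i ω * S j ω * s.X k ω)
        * (τ j ω + ∑ l, s.loo j i k l * τ l ω)
      = c i j * (U i ω * (S j ω * τ j ω)) * (s.Mc2 i k j * s.X k ω)
        + c i j * (U i ω * S j ω * s.X k ω) * (s.Mc2 i k j * ∑ l, s.loo j i k l * τ l ω) := by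
      ring
    rw [h3, h2, mul_add, ← add_assoc]
    refine congrArg₂ _ (congrArg₂ _ rfl ?_) ?_
    · split_ifs
      · rw [Finset.mul_sum]
        exact Finset.sum_congr rfl fun l _ => by ring
      · ring
    · rw [Finset.mul_sum]
      exact Finset.sum_congr rfl fun l _ => by ring
  simp_rw [h1]
  rw [Finset.sum_add_distrib, Finset.sum_add_distrib, Finset.sum_ite_eq,
    if_pos (Finset.mem_univ i), ← Finset.mul_sum, s.sum_Mc2_mul_X hQ (hD i j hij), mul_add,
    Finset.mul_sum]
  refine congrArg₂ _ (congrArg₂ _ (congrArg₂ _ (by ring) ?_) rfl) rfl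
  exact Finset.sum_congr rfl fun l _ => by ring

variable (hinv : ∀ i j k, IsUnit (s.gram3 i j k))
include hinv

lemma A1_eq (ω : Ω) :
    s.A1 s.β ω = s.leaveOutForm s.offG s.offG (s.e s.β) s.X s.X s.ν ω := by
  simp only [A1, leaveOutForm, sum_compl_singleton]
  refine Finset.sum_congr rfl fun i _ => Finset.sum_congr rfl fun j _ => ?_
  split_ifs with hij
  · simp [offG, hij]
  refine Finset.sum_congr rfl fun k _ => ?_
  split_ifs with hik
  · simp [offG, hik]
  rw [s.resE_eq (hinv i j k) hij hik, offG, offG, if_neg hij, if_neg hik]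
  ring

lemma A2_eq (ω : Ω) :
    s.A2 s.β ω = 2 * s.leaveOutForm s.offG s.offGT (s.e s.β) s.X (s.e s.β) s.η ω := by
  simp only [A2, leaveOutForm, sum_compl_singleton]
  congr 1
  refine Finset.sum_congr rfl fun i _ => Finset.sum_congr rfl fun j _ => ?_
  split_ifs with hij
  · simp [offG, hij]
  refine Finset.sum_congr rfl fun k _ => ?_
  split_ifs with hik
  · simp [offGT, offG, hik]
  rw [s.resX_eq (hinv i j k) hij hik, offG, offGT, offG, if_neg hij, if_neg (Ne.symm hik)]
  ring

lemma A3_eq (ω : Ω) :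
    s.A3 s.β ω = s.leaveOutForm s.offGT s.offGT s.X (s.e s.β) (s.e s.β) s.η ω := by
  simp only [A3, leaveOutForm, sum_compl_singleton]
  refine Finset.sum_congr rfl fun i _ => Finset.sum_congr rfl fun j _ => ?_
  split_ifs with hij
  · simp [offGT, offG, hij]
  refine Finset.sum_congr rfl fun k _ => ?_
  split_ifs with hik
  · simp [offGT, offG, hik]
  rw [s.resX_eq (hinv i j k) hij hik, offGT, offG, offGT, offG, if_neg (Ne.symm hij),
    if_neg (Ne.symm hik)]
  ring

lemma A4_eq (ω : Ω) :
    s.A4 s.β ω = -s.doubleOutForm (fun i j => s.offGT i j * s.offGT i j) s.X (s.e s.β) s.ν ω := by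
  simp only [A4, doubleOutForm, sum_compl_singleton]
  refine congrArg _ (Finset.sum_congr rfl fun i _ => Finset.sum_congr rfl fun j _ => ?_)
  split_ifs with hij
  · simp [offGT, offG, hij]
  refine Finset.sum_congr rfl fun k _ => ?_
  split_ifs with hjk
  · simp [← hjk, s.Mc2_right]
  rw [s.resE_swap, s.resE_eq (hinv j i k) (Ne.symm hij) hjk, offGT, offG, if_neg (Ne.symm hij)]
  ring

lemma A5_eq (ω : Ω) :
    s.A5 s.β ω
      = -s.doubleOutForm (fun i j => s.offG i j * s.offGT i j) (s.e s.β) (s.e s.β) s.η ω := by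
  simp only [A5, doubleOutForm, sum_compl_singleton]
  refine congrArg _ (Finset.sum_congr rfl fun i _ => Finset.sum_congr rfl fun j _ => ?_)
  split_ifs with hij
  · simp [offG, hij]
  refine Finset.sum_congr rfl fun k _ => ?_
  split_ifs with hjk
  · simp [← hjk, s.Mc2_right]
  rw [s.resX_swap, s.resX_eq (hinv j i k) (Ne.symm hij) hjk, offG, offGT, offG, if_neg hij,
    if_neg (Ne.symm hij)]
  ring

end Decomposition

end IVSample

/-! ### Fourth moments and the five sums of the estimator -/

section FourthMoments

variable {Ω N : Type*} [mΩ : MeasurableSpace Ω] {P : Measure Ω} {m : N → MeasurableSpace Ω}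

/-- A family of random variables whose `i`-th member depends only on the `i`-th observation and
whose fourth moments are at most `κ`. -/
structure FourthSlot (m : N → MeasurableSpace Ω) (P : Measure Ω) (κ : ℝ) (F : N → Ω → ℝ) :
    Prop where
  meas : ∀ i, Measurable[m i] (F i)
  memLp : ∀ i, MemLp (F i) 4 P
  fourth_le : ∀ i, ∫ ω, F i ω ^ 4 ∂P ≤ κ

namespace FourthSlot

variable {κ : ℝ} {F G : N → Ω → ℝ}

lemma mono {κ' : ℝ} (hF : FourthSlot m P κ F) (h : κ ≤ κ') : FourthSlot m P κ' F :=
  ⟨hF.meas, hF.memLp, fun i => (hF.fourth_le i).trans h⟩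

lemma integrable_pow (hF : FourthSlot m P κ F) (i : N) : Integrable (fun ω => F i ω ^ 4) P := by
  have := (hF.memLp i).integrable_norm_pow (p := 4) (by norm_num)
  simpa [Even.pow_abs (by decide : Even 4)] using this

lemma mul_slot (hκ : 1 ≤ κ) (hm : ∀ i, m i ≤ mΩ) (hF : FourthSlot m P κ F)
    (hG : FourthSlot m P κ G) : Slot m P κ fun i ω => F i ω * G i ω := by
  have hdom : ∀ i, Integrable (fun ω => (F i ω ^ 4 + G i ω ^ 4) / 2) P := fun i =>
    ((hF.integrable_pow i).add (hG.integrable_pow i)).div_const 2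
  have hle : ∀ i ω, (F i ω * G i ω) ^ 2 ≤ (F i ω ^ 4 + G i ω ^ 4) / 2 := fun i ω => by
    nlinarith [sq_nonneg (F i ω ^ 2 - G i ω ^ 2)]
  have hmeas : ∀ i, Measurable[m i] fun ω => F i ω * G i ω := fun i => (hF.meas i).mul (hG.meas i)
  have hae : ∀ i, AEStronglyMeasurable (fun ω => F i ω * G i ω) P := fun i =>
    ((hmeas i).mono (hm i) le_rfl).aestronglyMeasurable
  have hint : ∀ i, Integrable (fun ω => (F i ω * G i ω) ^ 2) P := fun i =>
    (hdom i).mono' ((hae i).pow 2) (Eventually.of_forall fun ω => by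
      rw [Real.norm_of_nonneg (sq_nonneg _)]
      exact hle i ω)
  refine ⟨hmeas, fun i => (memLp_two_iff_integrable_sq (hae i)).2 (hint i), fun i => ?_⟩
  calc _ ≤ ∫ ω, (F i ω ^ 4 + G i ω ^ 4) / 2 ∂P := integral_mono (hint i) (hdom i) (hle i)
    _ = (∫ ω, F i ω ^ 4 ∂P + ∫ ω, G i ω ^ 4 ∂P) / 2 := by
        rw [integral_div, integral_add (hF.integrable_pow i) (hG.integrable_pow i)]
    _ ≤ κ ^ 2 := by nlinarith [hF.fourth_le i, hG.fourth_le i]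

variable [IsProbabilityMeasure P]

lemma const {c : N → ℝ} {ρ : ℝ} (hc : ∀ i, |c i| ≤ ρ) :
    FourthSlot m P (ρ ^ 4) fun i _ => c i where
  meas _ := measurable_const
  memLp _ := memLp_const _
  fourth_le i := by
    simp only [integral_const, probReal_univ, one_smul]
    rw [← Even.pow_abs (by decide : Even 4)]
    exact pow_le_pow_left₀ (abs_nonneg _) (hc i) 4

lemma slot (hκ : 1 ≤ κ) (hm : ∀ i, m i ≤ mΩ) (hF : FourthSlot m P κ F) : Slot m P κ F := by
  have h1 : FourthSlot m P κ fun (_ : N) (_ : Ω) => (1 : ℝ) :=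
    (const (ρ := 1) fun _ => by simp).mono (by simpa)
  simpa using hF.mul_slot hκ hm h1

lemma const_add {c : N → ℝ} {ρ : ℝ} (hc : ∀ i, |c i| ≤ ρ) (hF : FourthSlot m P κ F) :
    FourthSlot m P (8 * (ρ ^ 4 + κ)) fun i ω => c i + F i ω := by
  have h0 : ∀ i, MemLp (fun ω => c i + F i ω) 4 P := fun i => (memLp_const (c i)).add (hF.memLp i)
  have h1 : ∀ i, Integrable (fun ω => (c i + F i ω) ^ 4) P := fun i => by
    have := (h0 i).integrable_norm_pow (p := 4) (by norm_num)
    simpa only [Real.norm_eq_abs, Even.pow_abs (by decide : Even 4)] using this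
  have h2 : ∀ x y : ℝ, (x + y) ^ 4 ≤ 8 * (x ^ 4 + y ^ 4) := fun x y => by
    have := Even.add_pow_le (n := 4) (a := x) (b := y) (by decide)
    norm_num at this
    exact this
  refine ⟨fun i => measurable_const.add (hF.meas i), h0, fun i => ?_⟩
  calc ∫ ω, (c i + F i ω) ^ 4 ∂P ≤ ∫ ω, 8 * (c i ^ 4 + F i ω ^ 4) ∂P :=
        integral_mono (h1 i) (((integrable_const _).add (hF.integrable_pow i)).const_mul 8)
          fun ω => h2 _ _
    _ = 8 * (c i ^ 4 + ∫ ω, F i ω ^ 4 ∂P) := by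
        rw [integral_const_mul, integral_add (integrable_const _) (hF.integrable_pow i)]
        simp only [integral_const, probReal_univ, one_smul]
    _ ≤ _ := by
        have h3 : c i ^ 4 ≤ ρ ^ 4 := by
          rw [← Even.pow_abs (by decide : Even 4)]
          exact pow_le_pow_left₀ (abs_nonneg _) (hc i) 4
        have := hF.fourth_le i
        linarith

end FourthSlot

end FourthMoments

namespace IVSample

section LeaveOutForms

variable {Ω : Type*} [mΩ : MeasurableSpace Ω] {P : Measure Ω} {n K L : ℕ}
  {s : IVSample Ω P n K L} {δ : ℝ} (h : s.WellPosed δ) [IsProbabilityMeasure P]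
  {m : Fin n → MeasurableSpace Ω} (hm : ∀ i, m i ≤ mΩ) (hI : iIndep m P) {κ : ℝ} (hκ : 0 ≤ κ)

/-- The constant in the variance bound for `leaveOutForm`. -/
def leaveOutConst (κ δ : ℝ) : ℝ :=
  8 * (20000 * κ ^ 2 * (1 + κ ^ 2) ^ 2) + 8 * (66 * κ ^ 4)
    + 4 * (2048 * κ ^ 2 * (6 * (2 * (2 * κ) ^ 2 * (1 + (2 * κ) ^ 4) * (1 / δ ^ 2 + 1)
          + 16 * (2 * κ) ^ 4 * (1 + (2 * κ) ^ 2) / δ ^ 4 + 288 * (2 * κ) ^ 6 / δ ^ 6)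
        * (1 + κ ^ 2) ^ 2))
    + 2 * (108 * κ ^ 2 * ((4 / δ ^ 2 + 2) * (2 * κ) ^ 4))

/-- The constant in the variance bound for `doubleOutForm`. -/
def doubleOutConst (κ δ : ℝ) : ℝ :=
  8 * (66 * κ ^ 4) + 12 * (108 * κ ^ 2 * ((4 / δ ^ 2 + 2) * (2 * κ) ^ 4))
    + 2 * (2048 * κ ^ 2 * (3 * ((2 / δ ^ 2 + 1) * (2 * κ) ^ 4 * (κ ^ 2 * (1 + 4 / δ ^ 2))
          + 288 * (2 * κ) ^ 6 / δ ^ 6)))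

include h hm hI hκ

lemma centredL2_leaveOutForm {a b : Fin n → Fin n → ℝ} (ha : ∀ i, a i i = 0)
    (hb : ∀ i, b i i = 0) {S U V τ : Fin n → Ω → ℝ} (hS : Slot m P κ S) (hU : Slot m P κ U)
    (hV : Slot m P κ V) (hτ : Slot m P κ τ) (hSτ : Slot m P κ fun i ω => S i ω * τ i ω)
    (hUV : Slot m P κ fun i ω => U i ω * V i ω) (h0 : ∀ i, ∫ ω, τ i ω ∂P = 0) :
    CentredL2 P (fun ω => s.leaveOutForm a b S U V τ ω
        - ∑ i, (∫ ω', S i ω' * τ i ω' ∂P) *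
          ((∑ j, a i j * ∫ ω', U j ω' ∂P) * (∑ j, b i j * ∫ ω', V j ω' ∂P)
            + ∑ j, a i j * b i j * (∫ ω', U j ω' * V j ω' ∂P
                - (∫ ω', U j ω' ∂P) * ∫ ω', V j ω' ∂P)))
      (leaveOutConst κ δ * (gramSq a + gramSq b
        + ∑ i, (∑ j, a i j * ∫ ω, U j ω ∂P) ^ 4 + ∑ i, (∑ j, b i j * ∫ ω, V j ω ∂P) ^ 4
        + √(gramSq a) * ∑ i, (∑ j, b i j * ∫ ω, V j ω ∂P) ^ 2
        + √(gramSq b) * ∑ i, (∑ j, a i j * ∫ ω, U j ω ∂P) ^ 2)) := by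
  have f1 := centredL2_trilinear hm hI hκ ha hb hSτ hU hV
  have f2 := centredL2_bilinear hm hI hκ (c := fun i j => a i j * b i j)
    (fun i => by rw [ha, zero_mul]) hSτ hUV
  have f3 := centredL2_quarticForm h hm hI hκ ha hb hS hU hV hτ h0
  have f4 := centredL2_cubicForm h hm hI hκ (c := fun i j => a i j * b i j)
    (fun i => by rw [ha, zero_mul]) hS hUV hτ h0
  refine ((((f1.add f2).add f3).add f4).congr fun ω => ?_).mono ?_
  · rw [s.leaveOutForm_eq]
    have e : ∑ i, (∫ ω', S i ω' * τ i ω' ∂P) *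
          ((∑ j, a i j * ∫ ω', U j ω' ∂P) * (∑ j, b i j * ∫ ω', V j ω' ∂P)
            + ∑ j, a i j * b i j * (∫ ω', U j ω' * V j ω' ∂P
                - (∫ ω', U j ω' ∂P) * ∫ ω', V j ω' ∂P))
        = ∑ i, ∑ j, ∑ k, (if j = k then 0 else a i j * b i k)
            * ((∫ ω', S i ω' * τ i ω' ∂P) * (∫ ω', U j ω' ∂P) * ∫ ω', V k ω' ∂P)
          + ∑ i, ∑ j, a i j * b i j
            * ((∫ ω', S i ω' * τ i ω' ∂P) * ∫ ω', U j ω' * V j ω' ∂P) := by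
      rw [← Finset.sum_add_distrib]
      refine Finset.sum_congr rfl fun i _ => ?_
      rw [Finset.sum_mul_sum, ← Finset.sum_add_distrib, ← Finset.sum_add_distrib, Finset.mul_sum]
      refine Finset.sum_congr rfl fun j _ => ?_
      have : ∀ k, (if j = k then 0 else a i j * b i k)
            * ((∫ ω', S i ω' * τ i ω' ∂P) * (∫ ω', U j ω' ∂P) * ∫ ω', V k ω' ∂P)
          = (∫ ω', S i ω' * τ i ω' ∂P) * (a i j * (∫ ω', U j ω' ∂P) * (b i k * ∫ ω', V k ω' ∂P))
            - if j = k then (∫ ω', S i ω' * τ i ω' ∂P)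
              * (a i j * (∫ ω', U j ω' ∂P) * (b i k * ∫ ω', V k ω' ∂P)) else 0 := by
        intro k
        split_ifs <;> ring
      simp_rw [this]
      rw [Finset.sum_sub_distrib, Finset.sum_ite_eq, if_pos (Finset.mem_univ j)]
      simp only [← Finset.mul_sum]
      ring
    rw [e]
    ring
  · have g1 := gramSq_nonneg a
    have g2 := gramSq_nonneg b
    have s1 : 0 ≤ ∑ i, (∑ j, a i j * ∫ ω, U j ω ∂P) ^ 4 :=
      Finset.sum_nonneg fun _ _ => by positivity
    have s2 : 0 ≤ ∑ i, (∑ j, b i j * ∫ ω, V j ω ∂P) ^ 4 :=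
      Finset.sum_nonneg fun _ _ => by positivity
    have s3 : 0 ≤ √(gramSq a) * ∑ i, (∑ j, b i j * ∫ ω, V j ω ∂P) ^ 2 :=
      mul_nonneg (Real.sqrt_nonneg _) (Finset.sum_nonneg fun _ _ => sq_nonneg _)
    have s4 : 0 ≤ √(gramSq b) * ∑ i, (∑ j, a i j * ∫ ω, U j ω ∂P) ^ 2 :=
      mul_nonneg (Real.sqrt_nonneg _) (Finset.sum_nonneg fun _ _ => sq_nonneg _)
    have hab := rowColSq_mul_le a b
    have a1 := sum_sq_sum_sq_le_gramSq a
    have b1 := sum_sq_sum_sq_le_gramSq b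
    have hδ := h.pos
    have k2 : 0 ≤ 66 * κ ^ 4 := by positivity
    have k3 : 0 ≤ 2048 * κ ^ 2 * (6 * (2 * (2 * κ) ^ 2 * (1 + (2 * κ) ^ 4) * (1 / δ ^ 2 + 1)
          + 16 * (2 * κ) ^ 4 * (1 + (2 * κ) ^ 2) / δ ^ 4 + 288 * (2 * κ) ^ 6 / δ ^ 6)
        * (1 + κ ^ 2) ^ 2) := by positivity
    have k4 : 0 ≤ 108 * κ ^ 2 * ((4 / δ ^ 2 + 2) * (2 * κ) ^ 4) := by positivity
    unfold leaveOutConst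
    simp only [Finset.sum_add_distrib]
    rw [← mul_assoc (6 * _) ((1 + κ ^ 2) ^ 2), ← mul_assoc (2048 * κ ^ 2),
      ← mul_assoc (108 * κ ^ 2) _ (rowColSq _)]
    generalize 2048 * κ ^ 2 * (6 * (2 * (2 * κ) ^ 2 * (1 + (2 * κ) ^ 4) * (1 / δ ^ 2 + 1)
          + 16 * (2 * κ) ^ 4 * (1 + (2 * κ) ^ 2) / δ ^ 4 + 288 * (2 * κ) ^ 6 / δ ^ 6)
        * (1 + κ ^ 2) ^ 2) = c3 at *
    generalize 108 * κ ^ 2 * ((4 / δ ^ 2 + 2) * (2 * κ) ^ 4) = c4 at *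
    generalize 66 * κ ^ 4 = c2 at *
    set E := gramSq a + gramSq b
        + ∑ i, (∑ j, a i j * ∫ ω, U j ω ∂P) ^ 4 + ∑ i, (∑ j, b i j * ∫ ω, V j ω ∂P) ^ 4
        + √(gramSq a) * ∑ i, (∑ j, b i j * ∫ ω, V j ω ∂P) ^ 2
        + √(gramSq b) * ∑ i, (∑ j, a i j * ∫ ω, U j ω ∂P) ^ 2 with hE
    have u2 := mul_le_mul_of_nonneg_left
      (by linarith : rowColSq (fun i j => a i j * b i j) ≤ E) k2
    have u3 := mul_le_mul_of_nonneg_left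
      (by linarith : ∑ i, (∑ j, a i j * ∫ ω, U j ω ∂P) ^ 4 + ∑ i, (∑ j, a i j ^ 2) ^ 2
        + (∑ i, (∑ j, b i j * ∫ ω, V j ω ∂P) ^ 4 + ∑ i, (∑ j, b i j ^ 2) ^ 2) ≤ E) k3
    have u4 := mul_le_mul_of_nonneg_left
      (by linarith : rowColSq (fun i j => a i j * b i j) ≤ E) k4
    linarith

lemma centredL2_doubleOutForm {c : Fin n → Fin n → ℝ} (hc : ∀ i, c i i = 0)
    {U S τ : Fin n → Ω → ℝ} (hU : Slot m P κ U) (hS : Slot m P κ S) (hX : Slot m P κ s.X)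
    (hτ : Slot m P κ τ) (hη : Slot m P κ s.η) (hUη : Slot m P κ fun i ω => U i ω * s.η i ω)
    (hSτ : Slot m P κ fun i ω => S i ω * τ i ω) (hUX : Slot m P κ fun i ω => U i ω * s.X i ω)
    (hR : ∀ i, ∫ ω, s.X i ω ∂P = s.R i) (h0 : ∀ i, ∫ ω, τ i ω ∂P = 0) :
    CentredL2 P (fun ω => s.doubleOutForm c U S τ ω - ∑ i, ∑ j, c i j
          * ((∫ ω', U i ω' * s.η i ω' ∂P) * ∫ ω', S j ω' * τ j ω' ∂P))
      (doubleOutConst κ δ * rowColSq c) := by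
  have hQ : Nonempty (Fin n) → IsUnit (s.Q.transpose * s.Q) := fun ⟨i⟩ => h.gram i
  have f1 := centredL2_bilinear hm hI hκ hc hUη hSτ
  have f2 := centredL2_cubicForm h hm hI hκ hc hU hSτ hη s.mean_η
  have f3 := centredL2_cubicForm h hm hI hκ (c := fun i j => c j i) hc hS hUX hτ h0
  have f4 := centredL2_doubleForm h hm hI hκ hc hU hS hX
    (fun i j => by simp_rw [hR]; exact s.sum_Mc2_mul_R (h.gram i) i j) hτ h0
  have er : rowColSq (fun i j => c j i) = rowColSq c := add_comm _ _
  rw [er] at f3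
  refine ((((f1.add f2).add f3).add f4).congr fun ω => ?_).mono (le_of_eq ?_)
  · rcases isEmpty_or_nonempty (Fin n) with hn | hn
    · simp [doubleOutForm, cubicForm, doubleForm]
    · rw [s.doubleOutForm_eq (hQ hn) (fun i j hij => h.D2_ne hij) hc]
      ring
  · unfold doubleOutConst
    ring

end LeaveOutForms

end IVSample

/-! ### Moments of the sample and unbiasedness -/

section SecondMoments

variable {Ω : Type*} [mΩ : MeasurableSpace Ω] {P : Measure Ω}

lemma integral_sum_mul_sum {ι ι' : Type*} [Fintype ι] [Fintype ι'] {f : ι → Ω → ℝ}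
    {g : ι' → Ω → ℝ} (hf : ∀ a, MemLp (f a) 2 P) (hg : ∀ b, MemLp (g b) 2 P) :
    ∫ ω, (∑ a, f a ω) * ∑ b, g b ω ∂P = ∑ a, ∑ b, ∫ ω, f a ω * g b ω ∂P := by
  simp_rw [Finset.sum_mul_sum]
  have hi : ∀ a b, Integrable (fun ω => f a ω * g b ω) P := fun a b =>
    (hf a).integrable_mul (hg b)
  rw [integral_finsetSum _ fun a _ => integrable_finsetSum _ fun b _ => hi a b]
  exact Finset.sum_congr rfl fun a _ => integral_finsetSum _ fun b _ => hi a b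

lemma integral_const_add_mul_const_add [IsProbabilityMeasure P] {F G : Ω → ℝ}
    (hF : MemLp F 2 P) (hG : MemLp G 2 P) (hF0 : ∫ ω, F ω ∂P = 0) (hG0 : ∫ ω, G ω ∂P = 0)
    (c d : ℝ) : ∫ ω, (c + F ω) * (d + G ω) ∂P = c * d + ∫ ω, F ω * G ω ∂P := by
  have hFi : Integrable F P := hF.integrable (by norm_num)
  have hGi : Integrable G P := hG.integrable (by norm_num)
  have hFG : Integrable (fun ω => F ω * G ω) P := hF.integrable_mul hG
  have e : ∀ ω, (c + F ω) * (d + G ω) = c * d + c * G ω + d * F ω + F ω * G ω := fun ω => by ring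
  have h1 : Integrable (fun ω => c * d + c * G ω) P := (integrable_const _).add (hGi.const_mul c)
  have h2 : Integrable (fun ω => c * d + c * G ω + d * F ω) P := h1.add (hFi.const_mul d)
  simp_rw [e]
  rw [integral_add h2 hFG, integral_add h1 (hFi.const_mul d),
    integral_add (integrable_const _) (hGi.const_mul c), integral_const_mul d F,
    integral_const_mul c G, hF0, hG0]
  simp

end SecondMoments

namespace IVSample

section Observations

variable {Ω : Type*} [mΩ : MeasurableSpace Ω] {P : Measure Ω} {n K L : ℕ} (s : IVSample Ω P n K L)

/-- The `σ`-algebra generated by the errors of observation `i`. -/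
abbrev obs (i : Fin n) : MeasurableSpace Ω :=
  MeasurableSpace.comap (fun ω => (s.ζ i ω, s.η i ω)) inferInstance

lemma obs_le (i : Fin n) : s.obs i ≤ mΩ :=
  ((s.measurable_ζ i).prodMk (s.measurable_η i)).comap_le

lemma iIndep_obs : iIndep s.obs P := s.indep.iIndep

lemma measurable_obs_pair (i : Fin n) : Measurable[s.obs i] fun ω => (s.ζ i ω, s.η i ω) :=
  comap_measurable _

lemma measurable_obs_η (i : Fin n) : Measurable[s.obs i] (s.η i) :=
  measurable_snd.comp (s.measurable_obs_pair i)

lemma measurable_obs_ν (i : Fin n) : Measurable[s.obs i] (s.ν i) := by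
  have : Measurable fun x : ℝ × ℝ => x.1 - x.2 * s.β := by fun_prop
  exact this.comp (s.measurable_obs_pair i)

lemma mean_ν (i : Fin n) : ∫ ω, s.ν i ω ∂P = 0 := by
  simp only [ν]
  rw [integral_sub (s.integrable_ζ i) ((s.integrable_η i).mul_const _), integral_mul_const,
    s.mean_ζ, s.mean_η, zero_mul, sub_zero]

/-- The variance of `ν_i`. -/
def sνν (i : Fin n) : ℝ := ∫ ω, s.ν i ω * s.ν i ω ∂P

/-- The covariance of `ν_i` and `η_i`. -/
def sνη (i : Fin n) : ℝ := ∫ ω, s.ν i ω * s.η i ω ∂P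

/-- The variance of `η_i`. -/
def sηη (i : Fin n) : ℝ := ∫ ω, s.η i ω * s.η i ω ∂P

/-- The sum `∑_{j ≠ i} G_{ij} R_j`. -/
def rowX (i : Fin n) : ℝ := ∑ j, s.offG i j * s.R j

/-- The sum `∑_{j ≠ i} G_{ji} R_{Δj}`. -/
def colE (i : Fin n) : ℝ := ∑ j, s.offGT i j * s.RΔ j

/-- The variance of the part of the statistic that is linear in the errors. -/
def linVar : ℝ := ∑ i, (s.sνν i * s.rowX i ^ 2 + 2 * s.sνη i * (s.rowX i * s.colE i)
  + s.sηη i * s.colE i ^ 2)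

/-- The variance of the part of the statistic that is quadratic in the errors. -/
def quadVar : ℝ := ∑ i, ∑ j, (s.offG i j * s.offG i j * (s.sνν i * s.sηη j)
  + s.offG i j * s.offGT i j * (s.sνη i * s.sνη j))

/-- Fourth moments of the errors and of the observed variables are at most `κ`. -/
structure MomentBound (κ : ℝ) : Prop where
  one_le : 1 ≤ κ
  η4 : FourthSlot s.obs P κ s.η
  ν4 : FourthSlot s.obs P κ s.ν
  X4 : FourthSlot s.obs P κ s.X
  e4 : FourthSlot s.obs P κ (s.e s.β)

lemma momentBound_of {C ρ : ℝ} [IsProbabilityMeasure P] (hη : ∀ i, MemLp (s.η i) 4 P)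
    (hν : ∀ i, MemLp (s.ν i) 4 P)
    (hC : ∀ i, ∫ ω, s.η i ω ^ 4 ∂P + ∫ ω, s.ν i ω ^ 4 ∂P ≤ C) (hR : ∀ i, |s.R i| ≤ ρ)
    (hRΔ : ∀ i, |s.RΔ i| ≤ ρ) : s.MomentBound (1 + 8 * (ρ ^ 4 + |C|)) := by
  have p1 : ∀ i, 0 ≤ ∫ ω, s.η i ω ^ 4 ∂P := fun i => integral_nonneg fun _ => by positivity
  have p2 : ∀ i, 0 ≤ ∫ ω, s.ν i ω ^ 4 ∂P := fun i => integral_nonneg fun _ => by positivity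
  have h1 : FourthSlot s.obs P |C| s.η := ⟨s.measurable_obs_η, hη, fun i => by
    linarith [hC i, p2 i, le_abs_self C]⟩
  have h2 : FourthSlot s.obs P |C| s.ν := ⟨s.measurable_obs_ν, hν, fun i => by
    linarith [hC i, p1 i, le_abs_self C]⟩
  have hρ : 0 ≤ ρ ^ 4 := by positivity
  have hC0 : 0 ≤ |C| := abs_nonneg C
  refine ⟨by linarith, h1.mono (by linarith), h2.mono (by linarith), ?_, ?_⟩
  · exact (FourthSlot.const_add hR h1).mono (by linarith)
  · have e : s.e s.β = fun i ω => s.RΔ i + s.ν i ω := by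
      funext i ω
      exact s.e_eq i ω
    rw [e]
    exact (FourthSlot.const_add hRΔ h2).mono (by linarith)

lemma mean_X [IsProbabilityMeasure P] (i : Fin n) : ∫ ω, s.X i ω ∂P = s.R i := by
  simp only [X]
  rw [integral_add (integrable_const _) (s.integrable_η i), s.mean_η]
  simp

variable {s} [IsProbabilityMeasure P] {κ : ℝ} (hB : s.MomentBound κ)
include hB

namespace MomentBound

omit [IsProbabilityMeasure P] in
lemma nonneg : 0 ≤ κ := zero_le_one.trans hB.one_le

lemma η2 : Slot s.obs P κ s.η := hB.η4.slot hB.one_le s.obs_le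

lemma ν2 : Slot s.obs P κ s.ν := hB.ν4.slot hB.one_le s.obs_le

lemma X2 : Slot s.obs P κ s.X := hB.X4.slot hB.one_le s.obs_le

lemma e2 : Slot s.obs P κ (s.e s.β) := hB.e4.slot hB.one_le s.obs_le

lemma mean_e (i : Fin n) : ∫ ω, s.e s.β i ω ∂P = s.RΔ i := by
  simp only [e_eq]
  rw [integral_add (integrable_const _) (hB.ν2.integrable i), s.mean_ν]
  simp

lemma integral_e_mul_ν (i : Fin n) : ∫ ω, s.e s.β i ω * s.ν i ω ∂P = s.sνν i := by
  have := integral_const_add_mul_const_add (hB.ν2.memLp i) (hB.ν2.memLp i) (s.mean_ν i)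
    (s.mean_ν i) (s.RΔ i) 0
  simp only [zero_add, mul_zero] at this
  simpa only [e_eq, sνν] using this

lemma integral_e_mul_η (i : Fin n) : ∫ ω, s.e s.β i ω * s.η i ω ∂P = s.sνη i := by
  have := integral_const_add_mul_const_add (hB.ν2.memLp i) (hB.η2.memLp i) (s.mean_ν i)
    (s.mean_η i) (s.RΔ i) 0
  simp only [zero_add, mul_zero] at this
  simpa only [e_eq, sνη] using this

lemma integral_X_mul_η (i : Fin n) : ∫ ω, s.X i ω * s.η i ω ∂P = s.sηη i := by
  have := integral_const_add_mul_const_add (hB.η2.memLp i) (hB.η2.memLp i) (s.mean_η i)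
    (s.mean_η i) (s.R i) 0
  simp only [zero_add, mul_zero] at this
  simpa only [X, sηη] using this

lemma integral_X_mul_X (i : Fin n) : ∫ ω, s.X i ω * s.X i ω ∂P = s.R i * s.R i + s.sηη i :=
  integral_const_add_mul_const_add (hB.η2.memLp i) (hB.η2.memLp i) (s.mean_η i)
    (s.mean_η i) (s.R i) (s.R i)

lemma integral_X_mul_e (i : Fin n) :
    ∫ ω, s.X i ω * s.e s.β i ω ∂P = s.R i * s.RΔ i + s.sνη i := by
  have := integral_const_add_mul_const_add (hB.η2.memLp i) (hB.ν2.memLp i) (s.mean_η i)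
    (s.mean_ν i) (s.R i) (s.RΔ i)
  simp only [mul_comm (s.η i _)] at this
  simpa only [e_eq, X, sνη] using this

lemma integral_e_mul_e (i : Fin n) :
    ∫ ω, s.e s.β i ω * s.e s.β i ω ∂P = s.RΔ i * s.RΔ i + s.sνν i := by
  have := integral_const_add_mul_const_add (hB.ν2.memLp i) (hB.ν2.memLp i) (s.mean_ν i)
    (s.mean_ν i) (s.RΔ i) (s.RΔ i)
  simpa only [e_eq, sνν] using this

/-- The quantity that bounds the variance of the estimator, up to constants. -/
def _root_.IVSample.errorBound (s : IVSample Ω P n K L) : ℝ :=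
  gramSq s.offG + ∑ i, s.rowX i ^ 4 + ∑ i, s.colE i ^ 4
    + √(gramSq s.offG) * (∑ i, s.rowX i ^ 2 + ∑ i, s.colE i ^ 2)

/-- The estimator is unbiased for `linVar + quadVar`, with a variance controlled by
`errorBound`. -/
theorem centredL2_VhatLM {δ : ℝ} (h : s.WellPosed δ) :
    CentredL2 P (fun ω => s.VhatLM s.β ω - (s.linVar + s.quadVar))
      ((88 * leaveOutConst κ δ + 16 * doubleOutConst κ δ) * s.errorBound) := by
  have hκ := hB.nonneg
  have one := hB.one_le
  have hm := s.obs_le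
  have hI := s.iIndep_obs
  have heν := hB.e4.mul_slot one hm hB.ν4
  have heη := hB.e4.mul_slot one hm hB.η4
  have hXη := hB.X4.mul_slot one hm hB.η4
  have hXX := hB.X4.mul_slot one hm hB.X4
  have hXe := hB.X4.mul_slot one hm hB.e4
  have heX := hB.e4.mul_slot one hm hB.X4
  have hee := hB.e4.mul_slot one hm hB.e4
  have f1 := centredL2_leaveOutForm h hm hI hκ s.offG_self s.offG_self hB.e2 hB.X2 hB.X2 hB.ν2
    heν hXX s.mean_ν
  have f2 := centredL2_leaveOutForm h hm hI hκ s.offG_self s.offGT_self hB.e2 hB.X2 hB.e2 hB.η2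
    heη hXe s.mean_η
  have f3 := centredL2_leaveOutForm h hm hI hκ s.offGT_self s.offGT_self hB.X2 hB.e2 hB.e2 hB.η2
    hXη hee s.mean_η
  have f4 := centredL2_doubleOutForm h hm hI hκ (c := fun i j => s.offGT i j * s.offGT i j)
    (fun i => by rw [offGT_self, zero_mul]) hB.X2 hB.e2 hB.X2 hB.ν2 hB.η2 hXη heν hXX s.mean_X
    s.mean_ν
  have f5 := centredL2_doubleOutForm h hm hI hκ (c := fun i j => s.offG i j * s.offGT i j)
    (fun i => by rw [offGT_self, mul_zero]) hB.e2 hB.e2 hB.X2 hB.η2 hB.η2 heη heη heX s.mean_X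
    s.mean_η
  simp only [hB.integral_e_mul_ν, hB.integral_e_mul_η, hB.integral_X_mul_η, hB.integral_X_mul_X,
    hB.integral_X_mul_e, hB.integral_e_mul_e, s.mean_X, hB.mean_e, add_sub_cancel_left]
    at f1 f2 f3 f4 f5
  have gT : gramSq s.offGT = gramSq s.offG := gramSq_transpose s.offG
  have eX : ∀ i, ∑ j, s.offG i j * s.R j = s.rowX i := fun i => rfl
  have eE : ∀ i, ∑ j, s.offGT i j * s.RΔ j = s.colE i := fun i => rfl
  simp only [gT, eX, eE] at f1 f2 f3
  have q4 := rowColSq_mul_le s.offGT s.offGT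
  have q5 := rowColSq_mul_le s.offG s.offGT
  rw [gT] at q4 q5
  refine ((((f1.add (f2.const_mul 2)).add f3).add ((f4.const_mul (-1)).add
    (f5.const_mul (-1)))).congr fun ω => ?_).mono ?_
  · rw [VhatLM, s.A1_eq h.inv, s.A2_eq h.inv, s.A3_eq h.inv, s.A4_eq h.inv, s.A5_eq h.inv]
    have e : s.linVar + s.quadVar
        = ∑ i, s.sνν i * (s.rowX i * s.rowX i + ∑ j, s.offG i j * s.offG i j * s.sηη j)
        + 2 * ∑ i, s.sνη i * (s.rowX i * s.colE i + ∑ j, s.offG i j * s.offGT i j * s.sνη j)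
        + ∑ i, s.sηη i * (s.colE i * s.colE i + ∑ j, s.offGT i j * s.offGT i j * s.sνν j)
        - ∑ i, ∑ j, s.offGT i j * s.offGT i j * (s.sηη i * s.sνν j)
        - ∑ i, ∑ j, s.offG i j * s.offGT i j * (s.sνη i * s.sνη j) := by
      have q1 : ∀ i, ∑ j, (s.offG i j * s.offG i j * (s.sνν i * s.sηη j)
          + s.offG i j * s.offGT i j * (s.sνη i * s.sνη j))
          = s.sνν i * (∑ j, s.offG i j * s.offG i j * s.sηη j)
            + s.sνη i * ∑ j, s.offG i j * s.offGT i j * s.sνη j := fun i => by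
        rw [Finset.mul_sum, Finset.mul_sum, ← Finset.sum_add_distrib]
        exact Finset.sum_congr rfl fun j _ => by ring
      have q2 : ∀ i, ∑ j, s.offGT i j * s.offGT i j * (s.sηη i * s.sνν j)
          = s.sηη i * ∑ j, s.offGT i j * s.offGT i j * s.sνν j := fun i => by
        rw [Finset.mul_sum]
        exact Finset.sum_congr rfl fun j _ => by ring
      have q3 : ∀ i, ∑ j, s.offG i j * s.offGT i j * (s.sνη i * s.sνη j)
          = s.sνη i * ∑ j, s.offG i j * s.offGT i j * s.sνη j := fun i => by
        rw [Finset.mul_sum]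
        exact Finset.sum_congr rfl fun j _ => by ring
      unfold linVar quadVar
      simp_rw [q1, q2, q3]
      rw [Finset.mul_sum]
      simp only [← Finset.sum_add_distrib, ← Finset.sum_sub_distrib]
      exact Finset.sum_congr rfl fun i _ => by ring
    rw [e]
    ring
  · have hδ := h.pos
    have k1 : 0 ≤ leaveOutConst κ δ := by unfold leaveOutConst; positivity
    have k2 : 0 ≤ doubleOutConst κ δ := by unfold doubleOutConst; positivity
    have g0 := gramSq_nonneg s.offG
    have s1 : 0 ≤ ∑ i, s.rowX i ^ 4 := Finset.sum_nonneg fun _ _ => by positivity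
    have s2 : 0 ≤ ∑ i, s.colE i ^ 4 := Finset.sum_nonneg fun _ _ => by positivity
    have s3 : 0 ≤ √(gramSq s.offG) * ∑ i, s.rowX i ^ 2 :=
      mul_nonneg (Real.sqrt_nonneg _) (Finset.sum_nonneg fun _ _ => sq_nonneg _)
    have s4 : 0 ≤ √(gramSq s.offG) * ∑ i, s.colE i ^ 2 :=
      mul_nonneg (Real.sqrt_nonneg _) (Finset.sum_nonneg fun _ _ => sq_nonneg _)
    generalize leaveOutConst κ δ = A at *
    generalize doubleOutConst κ δ = A' at *
    have hE : s.errorBound = gramSq s.offG + ∑ i, s.rowX i ^ 4 + ∑ i, s.colE i ^ 4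
      + (√(gramSq s.offG) * ∑ i, s.rowX i ^ 2 + √(gramSq s.offG) * ∑ i, s.colE i ^ 2) := by
      rw [errorBound, mul_add]
    rw [hE]
    generalize gramSq s.offG = g at *
    generalize ∑ i, s.rowX i ^ 4 = p at *
    generalize ∑ i, s.colE i ^ 4 = q at *
    generalize √g * ∑ i, s.rowX i ^ 2 = x at *
    generalize √g * ∑ i, s.colE i ^ 2 = y at *
    have t4 := mul_le_mul_of_nonneg_left q4 k2
    have t5 := mul_le_mul_of_nonneg_left q5 k2
    nlinarith [mul_nonneg k1 g0, mul_nonneg k1 s1, mul_nonneg k1 s2, mul_nonneg k1 s3,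
      mul_nonneg k1 s4, mul_nonneg k2 s1, mul_nonneg k2 s2, mul_nonneg k2 s3, mul_nonneg k2 s4,
      mul_nonneg k2 g0]

end MomentBound

end Observations

end IVSample

/-! ### The variance of the statistic -/

namespace IVSample

section VarianceOfStatistic

variable {Ω : Type*} [mΩ : MeasurableSpace Ω] {P : Measure Ω} {n K L : ℕ} {s : IVSample Ω P n K L}

lemma integral_mul_eq_zero_of_obs {i : Fin n} {F F' : Ω → ℝ} (hF : Measurable[s.obs i] F)
    (h0 : ∫ ω, F ω ∂P = 0) (hF' : Measurable[sigmaOn s.obs {i}ᶜ] F') :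
    ∫ ω, F ω * F' ω ∂P = 0 := by
  have hF1 : Measurable[sigmaOn s.obs {i}] F := hF.mono (le_iSup₂_of_le i rfl le_rfl) le_rfl
  rw [integral_mul_of_disjoint s.obs_le s.iIndep_obs disjoint_compl_right hF1 hF', h0, zero_mul]

lemma measurable_compl_obs {i j : Fin n} (hij : j ≠ i) {F : Ω → ℝ} (hF : Measurable[s.obs j] F) :
    Measurable[sigmaOn s.obs {i}ᶜ] F :=
  hF.mono (le_iSup₂_of_le j hij le_rfl) le_rfl

lemma variance_const_add_add [IsProbabilityMeasure P] {F F' : Ω → ℝ} (hF : MemLp F 2 P)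
    (hF' : MemLp F' 2 P) (h0 : ∫ ω, F ω ∂P = 0) (h0' : ∫ ω, F' ω ∂P = 0)
    (hFF' : ∫ ω, F ω * F' ω ∂P = 0) (c : ℝ) :
    Var[fun ω => c + (F ω + F' ω); P] = ∫ ω, F ω ^ 2 ∂P + ∫ ω, F' ω ^ 2 ∂P := by
  have hs : MemLp (fun ω => F ω + F' ω) 2 P := hF.add hF'
  have hm : ∫ ω, F ω + F' ω ∂P = 0 := by
    rw [integral_add (hF.integrable (by norm_num)) (hF'.integrable (by norm_num)), h0, h0',
      add_zero]
  rw [variance_const_add hs.aestronglyMeasurable, variance_of_integral_eq_zero hs.aemeasurable hm]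
  have e : ∀ ω, (F ω + F' ω) ^ 2 = F ω ^ 2 + F' ω ^ 2 + 2 * (F ω * F' ω) := fun ω => by ring
  have hi : Integrable (fun ω => F ω * F' ω) P := hF.integrable_mul hF'
  have hi2 : Integrable (fun ω => F ω ^ 2 + F' ω ^ 2) P := hF.integrable_sq.add hF'.integrable_sq
  simp_rw [e]
  rw [integral_add hi2 (hi.const_mul 2), integral_add hF.integrable_sq hF'.integrable_sq,
    integral_const_mul 2 fun ω => F ω * F' ω, hFF', mul_zero, add_zero]

/-- The second moments of the products `ν_i η_j`. -/
lemma integral_ν_η_mul_ν_η {i j k l : Fin n} (hij : i ≠ j) (hkl : k ≠ l) :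
    ∫ ω, s.ν i ω * s.η j ω * (s.ν k ω * s.η l ω) ∂P
      = (if i = k then if j = l then s.sνν i * s.sηη j else 0 else 0)
        + if i = l then if j = k then s.sνη i * s.sνη j else 0 else 0 := by
  have mν := s.measurable_obs_ν
  have mη := s.measurable_obs_η
  have hself : ∀ i, ∀ F : Ω → ℝ, Measurable[s.obs i] F → Measurable[sigmaOn s.obs {i}] F :=
    fun i F hF => hF.mono (le_iSup₂_of_le i rfl le_rfl) le_rfl
  by_cases hik : i = k
  · subst hik
    rw [if_pos rfl, if_neg hkl, add_zero]
    by_cases hjl : j = l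
    · subst hjl
      rw [if_pos rfl]
      have := integral_mul_of_disjoint s.obs_le s.iIndep_obs
        (disjoint_compl_right (a := ({i} : Set (Fin n))))
        (hself i _ ((mν i).mul (mν i)))
        (measurable_compl_obs (Ne.symm hij) ((mη j).mul (mη j)))
      simp only [Pi.mul_apply] at this
      rw [sνν, sηη, ← this]
      congr 1 with ω
      ring
    · rw [if_neg hjl]
      have := integral_mul_eq_zero_of_obs (mη j) (s.mean_η j)
        (((measurable_compl_obs hij (mν i)).mul (measurable_compl_obs hij (mν i))).mul
          (measurable_compl_obs (Ne.symm hjl) (mη l)))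
      simp only [Pi.mul_apply] at this
      rw [← this]
      congr 1 with ω
      ring
  · rw [if_neg hik, zero_add]
    by_cases hil : i = l
    · subst hil
      rw [if_pos rfl]
      by_cases hjk : j = k
      · subst hjk
        rw [if_pos rfl]
        have := integral_mul_of_disjoint s.obs_le s.iIndep_obs
          (disjoint_compl_right (a := ({i} : Set (Fin n))))
          (hself i _ ((mν i).mul (mη i)))
          (measurable_compl_obs (Ne.symm hij) ((mν j).mul (mη j)))
        simp only [Pi.mul_apply] at this
        rw [sνη, sνη, ← this]
        congr 1 with ω
        ring
      · rw [if_neg hjk]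
        have := integral_mul_eq_zero_of_obs (mη j) (s.mean_η j)
          (((measurable_compl_obs hij (mν i)).mul (measurable_compl_obs hij (mη i))).mul
            (measurable_compl_obs (Ne.symm hjk) (mν k)))
        simp only [Pi.mul_apply] at this
        rw [← this]
        congr 1 with ω
        ring
    · rw [if_neg hil]
      have := integral_mul_eq_zero_of_obs (mν i) (s.mean_ν i)
        (((measurable_compl_obs (Ne.symm hij) (mη j)).mul
          (measurable_compl_obs (Ne.symm hik) (mν k))).mul
            (measurable_compl_obs (Ne.symm hil) (mη l)))
      simp only [Pi.mul_apply] at this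
      rw [← this]
      congr 1 with ω
      ring

variable (s) in
lemma integral_quad (x : Fin n × Fin n) :
    ∫ ω, s.offG x.1 x.2 * (s.ν x.1 ω * s.η x.2 ω) ∂P = 0 := by
  by_cases h : x.1 = x.2
  · simp [offG, h]
  · rw [integral_const_mul, integral_mul_eq_zero_of_obs (s.measurable_obs_ν x.1) (s.mean_ν x.1)
      (measurable_compl_obs (Ne.symm h) (s.measurable_obs_η x.2)), mul_zero]

variable (s) in
lemma measurable_lin (i : Fin n) :
    Measurable[s.obs i] fun ω => s.rowX i * s.ν i ω + s.colE i * s.η i ω :=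
  (measurable_const.mul (s.measurable_obs_ν i)).add (measurable_const.mul (s.measurable_obs_η i))

variable [IsProbabilityMeasure P] {κ : ℝ} (hB : s.MomentBound κ)
include hB

namespace MomentBound

lemma memLp_ν_mul_η {i j : Fin n} (hij : i ≠ j) :
    MemLp (fun ω => s.ν i ω * s.η j ω) 2 P := by
  have h1 : Measurable[sigmaOn s.obs {j}] (s.η j) :=
    (s.measurable_obs_η j).mono (le_iSup₂_of_le j rfl le_rfl) le_rfl
  exact memLp_two_mul_of_disjoint s.obs_le s.iIndep_obs disjoint_compl_left
    (measurable_compl_obs hij (s.measurable_obs_ν i)) h1 (hB.ν2.memLp i) (hB.η2.memLp j)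

lemma memLp_quad (x : Fin n × Fin n) :
    MemLp (fun ω => s.offG x.1 x.2 * (s.ν x.1 ω * s.η x.2 ω)) 2 P := by
  by_cases h : x.1 = x.2
  · simp [offG, h]
  · exact (hB.memLp_ν_mul_η h).const_mul _

lemma integral_sq_quad :
    ∫ ω, (∑ x : Fin n × Fin n, s.offG x.1 x.2 * (s.ν x.1 ω * s.η x.2 ω)) ^ 2 ∂P = s.quadVar := by
  simp_rw [sq]
  rw [integral_sum_mul_sum hB.memLp_quad hB.memLp_quad, Fintype.sum_prod_type, quadVar]
  refine Finset.sum_congr rfl fun i _ => Finset.sum_congr rfl fun j _ => ?_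
  by_cases hij : i = j
  · simp [offG, hij]
  have e : ∀ x : Fin n × Fin n, ∫ ω, s.offG i j * (s.ν i ω * s.η j ω)
        * (s.offG x.1 x.2 * (s.ν x.1 ω * s.η x.2 ω)) ∂P
      = s.offG i j * (s.offG x.1 x.2 *
        ((if i = x.1 then if j = x.2 then s.sνν i * s.sηη j else 0 else 0)
          + if i = x.2 then if j = x.1 then s.sνη i * s.sνη j else 0 else 0)) := by
    intro x
    by_cases hx : x.1 = x.2
    · simp [offG, hx]
    · rw [← integral_ν_η_mul_ν_η hij hx, ← integral_const_mul, ← integral_const_mul]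
      congr 1 with ω
      ring
  simp_rw [e]
  rw [← Finset.mul_sum, Fintype.sum_prod_type]
  simp only [mul_add, Finset.sum_add_distrib, mul_ite, mul_zero]
  rw [Finset.sum_comm (f := fun k l => if i = l then if j = k then _ else _ else _)]
  simp only [Finset.sum_ite_irrel, Finset.sum_const_zero, Finset.sum_ite_eq, Finset.mem_univ,
    if_true, offGT]
  ring

lemma memLp_lin (i : Fin n) :
    MemLp (fun ω => s.rowX i * s.ν i ω + s.colE i * s.η i ω) 2 P :=
  ((hB.ν2.memLp i).const_mul _).add ((hB.η2.memLp i).const_mul _)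

lemma integral_lin (i : Fin n) :
    ∫ ω, s.rowX i * s.ν i ω + s.colE i * s.η i ω ∂P = 0 := by
  rw [integral_add ((hB.ν2.integrable i).const_mul _) ((hB.η2.integrable i).const_mul _),
    integral_const_mul, integral_const_mul, s.mean_ν, s.mean_η, mul_zero, mul_zero, add_zero]

lemma integral_sq_lin :
    ∫ ω, (∑ i, (s.rowX i * s.ν i ω + s.colE i * s.η i ω)) ^ 2 ∂P = s.linVar := by
  simp_rw [sq]
  rw [integral_sum_mul_sum hB.memLp_lin hB.memLp_lin, linVar]
  refine Finset.sum_congr rfl fun i _ => ?_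
  rw [Finset.sum_eq_single i]
  · have h1 : Integrable (fun ω => s.rowX i ^ 2 * (s.ν i ω * s.ν i ω)) P :=
      ((hB.ν2.memLp i).integrable_mul (hB.ν2.memLp i)).const_mul _
    have h2 : Integrable (fun ω => 2 * (s.rowX i * s.colE i) * (s.ν i ω * s.η i ω)) P :=
      ((hB.ν2.memLp i).integrable_mul (hB.η2.memLp i)).const_mul _
    have h3 : Integrable (fun ω => s.colE i ^ 2 * (s.η i ω * s.η i ω)) P :=
      ((hB.η2.memLp i).integrable_mul (hB.η2.memLp i)).const_mul _
    have h12 : Integrable (fun ω => s.rowX i ^ 2 * (s.ν i ω * s.ν i ω)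
      + 2 * (s.rowX i * s.colE i) * (s.ν i ω * s.η i ω)) P := h1.add h2
    have e : ∀ ω, (s.rowX i * s.ν i ω + s.colE i * s.η i ω)
          * (s.rowX i * s.ν i ω + s.colE i * s.η i ω)
        = s.rowX i ^ 2 * (s.ν i ω * s.ν i ω) + 2 * (s.rowX i * s.colE i) * (s.ν i ω * s.η i ω)
          + s.colE i ^ 2 * (s.η i ω * s.η i ω) := fun ω => by
      ring
    simp_rw [e]
    rw [integral_add h12 h3, integral_add h1 h2, integral_const_mul (s.rowX i ^ 2) fun ω => _,
      integral_const_mul (2 * (s.rowX i * s.colE i)) fun ω => _,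
      integral_const_mul (s.colE i ^ 2) fun ω => _, sνν, sνη, sηη]
    ring
  · intro j _ hji
    exact integral_mul_eq_zero_of_obs (s.measurable_lin i) (hB.integral_lin i)
      (measurable_compl_obs hji (s.measurable_lin j))
  · simp

lemma integral_lin_mul_quad :
    ∫ ω, (∑ i, (s.rowX i * s.ν i ω + s.colE i * s.η i ω))
      * ∑ x : Fin n × Fin n, s.offG x.1 x.2 * (s.ν x.1 ω * s.η x.2 ω) ∂P = 0 := by
  rw [integral_sum_mul_sum hB.memLp_lin hB.memLp_quad]
  refine Finset.sum_eq_zero fun i _ => Finset.sum_eq_zero fun x _ => ?_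
  by_cases hx : x.1 = x.2
  · simp [offG, hx]
  have mν := s.measurable_obs_ν x.1
  have mη := s.measurable_obs_η x.2
  by_cases h1 : i = x.1
  · have := integral_mul_eq_zero_of_obs mη (s.mean_η x.2)
      ((measurable_compl_obs (h1.trans_ne hx) (s.measurable_lin i)).mul
        (measurable_compl_obs hx (mν.const_mul (s.offG x.1 x.2))))
    simp only [Pi.mul_apply] at this
    rw [← this]
    congr 1 with ω
    ring
  · have := integral_mul_eq_zero_of_obs mν (s.mean_ν x.1)
      ((measurable_compl_obs h1 (s.measurable_lin i)).mul
        (measurable_compl_obs (Ne.symm hx) (mη.const_mul (s.offG x.1 x.2))))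
    simp only [Pi.mul_apply] at this
    rw [← this]
    congr 1 with ω
    ring

lemma variance_quad : Var[fun ω => ∑ i, ∑ j ∈ {i}ᶜ, s.G i j * (s.ν i ω * s.η j ω); P]
    = s.quadVar := by
  have e : ∀ ω, ∑ i, ∑ j ∈ {i}ᶜ, s.G i j * (s.ν i ω * s.η j ω)
      = ∑ x : Fin n × Fin n, s.offG x.1 x.2 * (s.ν x.1 ω * s.η x.2 ω) := by
    intro ω
    rw [Fintype.sum_prod_type]
    refine Finset.sum_congr rfl fun i _ => ?_
    rw [sum_compl_singleton]
    refine Finset.sum_congr rfl fun j _ => ?_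
    by_cases hij : i = j <;> simp [offG, hij]
  simp_rw [e]
  have hM := memLp_finsetSum Finset.univ fun x _ => hB.memLp_quad x
  rw [variance_of_integral_eq_zero hM.aemeasurable, hB.integral_sq_quad]
  rw [integral_finsetSum _ fun x _ => (hB.memLp_quad x).integrable (by norm_num)]
  exact Finset.sum_eq_zero fun x _ => s.integral_quad x

/-- The Hoeffding decomposition of the statistic into a linear and a quadratic part. -/
theorem VLM_eq : s.VLM = s.linVar + s.quadVar := by
  have e : ∀ ω, ∑ i, ∑ j ∈ {i}ᶜ, s.G i j * s.e s.β i ω * s.X j ω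
      = ∑ i, s.RΔ i * s.rowX i + (∑ i, (s.rowX i * s.ν i ω + s.colE i * s.η i ω)
        + ∑ x : Fin n × Fin n, s.offG x.1 x.2 * (s.ν x.1 ω * s.η x.2 ω)) := by
    intro ω
    have h1 : ∑ i, s.colE i * s.η i ω = ∑ i, ∑ j, s.offG i j * (s.RΔ i * s.η j ω) := by
      simp only [colE, offGT, Finset.sum_mul]
      rw [Finset.sum_comm]
      exact Finset.sum_congr rfl fun i _ => Finset.sum_congr rfl fun j _ => by ring
    rw [Finset.sum_add_distrib, h1, Fintype.sum_prod_type]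
    simp only [rowX, Finset.sum_mul, Finset.mul_sum, ← Finset.sum_add_distrib]
    refine Finset.sum_congr rfl fun i _ => ?_
    rw [sum_compl_singleton]
    refine Finset.sum_congr rfl fun j _ => ?_
    by_cases hij : i = j
    · simp [offG, hij]
    · rw [if_neg hij, offG, if_neg hij, e_eq, X]
      ring
  have hL := memLp_finsetSum Finset.univ fun i _ => hB.memLp_lin i
  have hQ := memLp_finsetSum Finset.univ fun x _ => hB.memLp_quad x
  have hL0 : ∫ ω, ∑ i, (s.rowX i * s.ν i ω + s.colE i * s.η i ω) ∂P = 0 := by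
    rw [integral_finsetSum _ fun i _ => (hB.memLp_lin i).integrable (by norm_num)]
    exact Finset.sum_eq_zero fun i _ => hB.integral_lin i
  have hQ0 : ∫ ω, ∑ x : Fin n × Fin n, s.offG x.1 x.2 * (s.ν x.1 ω * s.η x.2 ω) ∂P = 0 := by
    rw [integral_finsetSum _ fun x _ => (hB.memLp_quad x).integrable (by norm_num)]
    exact Finset.sum_eq_zero fun x _ => s.integral_quad x
  have h2 := hB.integral_sq_lin
  have h3 := hB.integral_sq_quad
  have h4 := hB.integral_lin_mul_quad
  rw [VLM, ← h2, ← h3]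
  simp_rw [e]
  exact variance_const_add_add hL hQ hL0 hQ0 h4 _

end MomentBound

end VarianceOfStatistic

end IVSample

/-! ### Error bound and lower bound on the variance -/

lemma frobNorm_sq {n : ℕ} (A : Matrix (Fin n) (Fin n) ℝ) : frobNorm A ^ 2 = ∑ i, ∑ j, A i j ^ 2 := by
  have h0 : 0 ≤ ∑ i, ∑ j, A i j ^ 2 :=
    Finset.sum_nonneg fun _ _ => Finset.sum_nonneg fun _ _ => sq_nonneg _
  unfold frobNorm
  rw [Matrix.frobenius_norm_def]
  simp only [Real.norm_eq_abs, Real.rpow_two, sq_abs]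
  rw [← Real.sqrt_eq_rpow, Real.sq_sqrt h0]

lemma frobNorm_nonneg {n : ℕ} (A : Matrix (Fin n) (Fin n) ℝ) : 0 ≤ frobNorm A :=
  @norm_nonneg _ Matrix.frobeniusNormedAddCommGroup.toSeminormedAddCommGroup.toSeminormedAddGroup A

lemma sq_frobNorm_smul_mul_transpose {n : ℕ} (A : Matrix (Fin n) (Fin n) ℝ) (x : ℝ) :
    frobNorm (x • (A * A.transpose)) ^ 2 = x ^ 2 * gramSq A := by
  have e : gramSq A = ∑ i, ∑ i', (∑ j, A i j * A i' j) ^ 2 := rfl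
  rw [frobNorm_sq, e, Finset.mul_sum]
  refine Finset.sum_congr rfl fun i _ => ?_
  rw [Finset.mul_sum]
  refine Finset.sum_congr rfl fun j _ => ?_
  rw [Matrix.smul_apply, smul_eq_mul, mul_pow, Matrix.mul_apply]
  rfl

/-- Subadditivity up to constants. The cross terms are controlled by the cyclicity of the trace:
`‖a bᵀ‖_F²` is the trace of `(aᵀ a) (bᵀ b)`. -/
lemma gramSq_add_le {n : ℕ} (a b : Fin n → Fin n → ℝ) :
    gramSq (fun i j => a i j + b i j) ≤ 12 * (gramSq a + gramSq b) := by
  have h1 : ∑ i, ∑ i', (∑ j, a i j * b i' j) ^ 2 ≤ gramSq a + gramSq b := by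
    have := sum_sq_triple_le_gramSq (x := fun _ => 1) (κ := 1) (fun _ => by simp)
      (fun i j => a j i) fun i j => b j i
    rw [gramSq_transpose a, gramSq_transpose b] at this
    simpa using this
  have h2 : ∑ i, ∑ i', (∑ j, b i j * a i' j) ^ 2 ≤ gramSq a + gramSq b := by
    rw [Finset.sum_comm]
    simpa only [mul_comm (b _ _)] using h1
  have h3 : gramSq (fun i j => a i j + b i j) ≤ ∑ i, ∑ i', 4 * ((∑ j, a i j * a i' j) ^ 2
      + (∑ j, b i j * b i' j) ^ 2 + (∑ j, a i j * b i' j) ^ 2 + (∑ j, b i j * a i' j) ^ 2) := by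
    refine Finset.sum_le_sum fun i _ => Finset.sum_le_sum fun i' _ => ?_
    have e : ∑ j, (a i j + b i j) * (a i' j + b i' j) = ∑ j, a i j * a i' j + ∑ j, b i j * b i' j
        + ∑ j, a i j * b i' j + ∑ j, b i j * a i' j := by
      simp only [← Finset.sum_add_distrib]
      exact Finset.sum_congr rfl fun j _ => by ring
    rw [e]
    generalize ∑ j, a i j * a i' j = x
    generalize ∑ j, b i j * b i' j = y
    generalize ∑ j, a i j * b i' j = z
    generalize ∑ j, b i j * a i' j = w
    nlinarith [sq_nonneg (x - y), sq_nonneg (x - z), sq_nonneg (x - w), sq_nonneg (y - z),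
      sq_nonneg (y - w), sq_nonneg (z - w)]
  refine h3.trans ?_
  simp only [← Finset.mul_sum, Finset.sum_add_distrib]
  have e1 : ∑ i, ∑ i', (∑ j, a i j * a i' j) ^ 2 = gramSq a := rfl
  have e2 : ∑ i, ∑ i', (∑ j, b i j * b i' j) ^ 2 = gramSq b := rfl
  rw [e1, e2]
  linarith

namespace IVSample

section Bounds

variable {Ω : Type*} [mΩ : MeasurableSpace Ω] {P : Measure Ω} {n K L : ℕ} (s : IVSample Ω P n K L)

lemma rowX_eq (i : Fin n) : s.rowX i = ∑ j ∈ {i}ᶜ, s.G i j * s.R j := by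
  rw [sum_compl_singleton, rowX]
  exact Finset.sum_congr rfl fun j _ => by by_cases h : i = j <;> simp [offG, h]

lemma colE_eq (i : Fin n) : s.colE i = ∑ j ∈ {i}ᶜ, s.G j i * s.RΔ j := by
  rw [sum_compl_singleton, colE]
  exact Finset.sum_congr rfl fun j _ => by by_cases h : i = j <;> simp [offGT, offG, h, eq_comm]

lemma gramSq_offG_le : gramSq s.offG ≤ 12 * (gramSq s.Glower + gramSq s.Gupper) := by
  have e : s.offG = fun i j => s.Glower i j + s.Gupper i j := by
    funext i j
    rcases lt_trichotomy i j with h | h | h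
    · simp [offG, Glower, Gupper, h, h.ne, h.not_gt]
    · simp [offG, Glower, Gupper, h]
    · simp [offG, Glower, Gupper, h, h.ne', h.not_gt]
  rw [e]
  exact gramSq_add_le _ _

lemma sum_sq_rowX_le : ∑ i, s.rowX i ^ 2 ≤ s.r := by
  simp_rw [rowX_eq]
  unfold r
  have h1 : 0 ≤ ∑ i, (∑ j ∈ {i}ᶜ, s.G i j * s.RΔ j) ^ 2 := Finset.sum_nonneg fun _ _ => sq_nonneg _
  have h2 : 0 ≤ ∑ i, ∑ j ∈ {i}ᶜ, s.G i j ^ 2 :=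
    Finset.sum_nonneg fun _ _ => Finset.sum_nonneg fun _ _ => sq_nonneg _
  linarith

lemma sum_sq_Rtilde_le : ∑ i, s.Rtilde true i ^ 2 ≤ s.r := by
  unfold r
  have e : ∑ i, s.Rtilde true i ^ 2 = ∑ i, (∑ j ∈ {i}ᶜ, s.G i j * s.RΔ j) ^ 2 := rfl
  have h1 : 0 ≤ ∑ i, (∑ j ∈ {i}ᶜ, s.G i j * s.R j) ^ 2 := Finset.sum_nonneg fun _ _ => sq_nonneg _
  have h2 : 0 ≤ ∑ i, ∑ j ∈ {i}ᶜ, s.G i j ^ 2 :=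
    Finset.sum_nonneg fun _ _ => Finset.sum_nonneg fun _ _ => sq_nonneg _
  linarith

lemma r_nonneg : 0 ≤ s.r := (Finset.sum_nonneg fun _ _ => sq_nonneg _).trans s.sum_sq_rowX_le

/-- The error of the estimator relative to `r`, in terms of the quantities that vanish. -/
lemma errorBound_le (hr : 0 < s.r) {C φ : ℝ} (hC : ∑ i, s.colE i ^ 2 ≤ C * s.r)
    (hφ : φ = frobNorm ((1 / s.r) • (s.Glower * s.Glower.transpose))
      + frobNorm ((1 / s.r) • (s.Gupper * s.Gupper.transpose))) :
    s.errorBound ≤ s.r ^ 2 * (12 * φ ^ 2 + 1 / s.r ^ 2 * ∑ i,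
      ((∑ j ∈ {i}ᶜ, s.G i j * s.R j) ^ 4 + (∑ j ∈ {i}ᶜ, s.G i j * s.RΔ j) ^ 4
        + (∑ j ∈ {i}ᶜ, s.G j i * s.R j) ^ 4 + (∑ j ∈ {i}ᶜ, s.G j i * s.RΔ j) ^ 4)
      + 4 * φ * (1 + C)) := by
  have f1 := sq_frobNorm_smul_mul_transpose s.Glower (1 / s.r)
  have f2 := sq_frobNorm_smul_mul_transpose s.Gupper (1 / s.r)
  have n1 := frobNorm_nonneg ((1 / s.r) • (s.Glower * s.Glower.transpose))
  have n2 := frobNorm_nonneg ((1 / s.r) • (s.Gupper * s.Gupper.transpose))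
  generalize frobNorm ((1 / s.r) • (s.Glower * s.Glower.transpose)) = x at *
  generalize frobNorm ((1 / s.r) • (s.Gupper * s.Gupper.transpose)) = y at *
  have hφ0 : 0 ≤ φ := by rw [hφ]; positivity
  have g1 : gramSq s.Glower = s.r ^ 2 * x ^ 2 := by
    rw [f1]
    field_simp
  have g2 : gramSq s.Gupper = s.r ^ 2 * y ^ 2 := by
    rw [f2]
    field_simp
  have hg : gramSq s.offG ≤ 12 * (s.r ^ 2 * φ ^ 2) := by
    refine s.gramSq_offG_le.trans ?_
    rw [g1, g2, ← mul_add]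
    refine mul_le_mul_of_nonneg_left (mul_le_mul_of_nonneg_left ?_ (sq_nonneg _)) (by norm_num)
    rw [hφ]
    nlinarith [mul_nonneg n1 n2]
  have hs : √(gramSq s.offG) ≤ 4 * (s.r * φ) := by
    rw [Real.sqrt_le_left (by positivity)]
    nlinarith [sq_nonneg (s.r * φ)]
  have h4 : ∑ i, s.rowX i ^ 4 + ∑ i, s.colE i ^ 4 ≤ ∑ i,
      ((∑ j ∈ {i}ᶜ, s.G i j * s.R j) ^ 4 + (∑ j ∈ {i}ᶜ, s.G i j * s.RΔ j) ^ 4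
        + (∑ j ∈ {i}ᶜ, s.G j i * s.R j) ^ 4 + (∑ j ∈ {i}ᶜ, s.G j i * s.RΔ j) ^ 4) := by
    rw [← Finset.sum_add_distrib]
    refine Finset.sum_le_sum fun i _ => ?_
    rw [rowX_eq, colE_eq]
    have p1 : 0 ≤ (∑ j ∈ {i}ᶜ, s.G i j * s.RΔ j) ^ 4 := by positivity
    have p2 : 0 ≤ (∑ j ∈ {i}ᶜ, s.G j i * s.R j) ^ 4 := by positivity
    linarith
  have h5 : √(gramSq s.offG) * (∑ i, s.rowX i ^ 2 + ∑ i, s.colE i ^ 2)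
      ≤ 4 * (s.r * φ) * (s.r + C * s.r) :=
    mul_le_mul hs (add_le_add s.sum_sq_rowX_le hC) (add_nonneg
      (Finset.sum_nonneg fun _ _ => sq_nonneg _) (Finset.sum_nonneg fun _ _ => sq_nonneg _))
      (by positivity)
  unfold errorBound
  generalize (∑ i, ((∑ j ∈ {i}ᶜ, s.G i j * s.R j) ^ 4 + (∑ j ∈ {i}ᶜ, s.G i j * s.RΔ j) ^ 4
        + (∑ j ∈ {i}ᶜ, s.G j i * s.R j) ^ 4 + (∑ j ∈ {i}ᶜ, s.G j i * s.RΔ j) ^ 4)) = T at *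
  have e : s.r ^ 2 * (12 * φ ^ 2 + 1 / s.r ^ 2 * T + 4 * φ * (1 + C))
      = 12 * (s.r ^ 2 * φ ^ 2) + T + 4 * (s.r * φ) * (s.r + C * s.r) := by
    field_simp
  rw [e]
  linarith

variable {s} [IsProbabilityMeasure P] {κ : ℝ} (hB : s.MomentBound κ)
include hB

namespace MomentBound

lemma quadVar_nonneg : 0 ≤ s.quadVar := by
  rw [← hB.integral_sq_quad]
  exact integral_nonneg fun _ => sq_nonneg _

lemma linVar_ge {c : ℝ} (hc : 0 < c) (hc1 : c ≤ 1) (hν : ∀ i, c ≤ ∫ ω, s.ν i ω ^ 2 ∂P)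
    (hη : ∀ i, c ≤ ∫ ω, s.η i ω ^ 2 ∂P) (hcorr : ∀ i, |corr P (s.ν i) (s.η i)| ≤ 1 - c) :
    c ^ 2 * (∑ i, s.rowX i ^ 2 + ∑ i, s.colE i ^ 2) ≤ s.linVar := by
  rw [← Finset.sum_add_distrib, Finset.mul_sum, linVar]
  refine Finset.sum_le_sum fun i _ => ?_
  have hν' : c ≤ s.sνν i := by simpa only [sνν, ← sq] using hν i
  have hη' : c ≤ s.sηη i := by simpa only [sηη, ← sq] using hη i
  have h1 := hcorr i
  rw [corr, covariance_eq_sub (hB.ν2.memLp i) (hB.η2.memLp i),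
    variance_of_integral_eq_zero (hB.ν2.memLp i).aemeasurable (s.mean_ν i),
    variance_of_integral_eq_zero (hB.η2.memLp i).aemeasurable (s.mean_η i), s.mean_ν i,
    zero_mul, sub_zero] at h1
  have e1 : ∫ ω, s.ν i ω ^ 2 ∂P = s.sνν i := by simp only [sνν, ← sq]
  have e2 : ∫ ω, s.η i ω ^ 2 ∂P = s.sηη i := by simp only [sηη, ← sq]
  have e3 : ∫ ω, (s.ν i * s.η i) ω ∂P = s.sνη i := rfl
  rw [e1, e2, e3] at h1
  obtain ⟨a, ha, ha2⟩ : ∃ a, 0 < a ∧ s.sνν i = a ^ 2 :=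
    ⟨√(s.sνν i), Real.sqrt_pos.2 (hc.trans_le hν'), (Real.sq_sqrt (hc.le.trans hν')).symm⟩
  obtain ⟨b, hb, hb2⟩ : ∃ b, 0 < b ∧ s.sηη i = b ^ 2 :=
    ⟨√(s.sηη i), Real.sqrt_pos.2 (hc.trans_le hη'), (Real.sq_sqrt (hc.le.trans hη')).symm⟩
  rw [ha2, hb2, Real.sqrt_sq ha.le, Real.sqrt_sq hb.le, abs_div, abs_of_pos (mul_pos ha hb),
    div_le_iff₀ (mul_pos ha hb)] at h1
  rw [ha2] at hν' ⊢
  rw [hb2] at hη' ⊢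
  generalize s.sνη i = σ at *
  generalize s.rowX i = p
  generalize s.colE i = q
  have h2 : |σ * (p * q)| ≤ (1 - c) * (a * b) * |p * q| := by
    rw [abs_mul]
    exact mul_le_mul_of_nonneg_right h1 (abs_nonneg _)
  have h3 : a * b * |p * q| ≤ (a ^ 2 * p ^ 2 + b ^ 2 * q ^ 2) / 2 := by
    have : a * b * |p * q| = (a * |p|) * (b * |q|) := by rw [abs_mul]; ring
    rw [this]
    nlinarith [sq_nonneg (a * |p| - b * |q|), sq_abs p, sq_abs q]
  have h4 : (1 - c) * (a * b * |p * q|) ≤ (1 - c) * ((a ^ 2 * p ^ 2 + b ^ 2 * q ^ 2) / 2) :=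
    mul_le_mul_of_nonneg_left h3 (by linarith)
  have h5 : c * (c * p ^ 2) ≤ c * (a ^ 2 * p ^ 2) :=
    mul_le_mul_of_nonneg_left (mul_le_mul_of_nonneg_right hν' (sq_nonneg p)) hc.le
  have h6 : c * (c * q ^ 2) ≤ c * (b ^ 2 * q ^ 2) :=
    mul_le_mul_of_nonneg_left (mul_le_mul_of_nonneg_right hη' (sq_nonneg q)) hc.le
  have h7 := neg_abs_le (σ * (p * q))
  linarith

/-- The nondegeneracy condition for the coefficients `(0, 1, 0)` bounds the variance of the
statistic from below. -/
lemma VLM_ge {c c' : ℝ} (hc : 0 < c) (hc1 : c ≤ 1) (hν : ∀ i, c ≤ ∫ ω, s.ν i ω ^ 2 ∂P)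
    (hη : ∀ i, c ≤ ∫ ω, s.η i ω ^ 2 ∂P) (hcorr : ∀ i, |corr P (s.ν i) (s.η i)| ≤ 1 - c)
    (hc' : 0 < c')
    (hV : c' ≤ 1 / s.r * ∑ i, s.colE i ^ 2 + 1 / s.r * ∑ i, s.rowX i ^ 2 + 1 / s.r * s.quadVar) :
    0 < s.r ∧ c ^ 2 * c' * s.r ≤ s.VLM := by
  have hr : 0 < s.r := by
    refine s.r_nonneg.lt_of_ne fun h => ?_
    rw [← h] at hV
    simp only [div_zero, zero_mul, add_zero] at hV
    linarith
  refine ⟨hr, ?_⟩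
  rw [← mul_add, ← mul_add, one_div, inv_mul_eq_div, le_div_iff₀ hr] at hV
  rw [hB.VLM_eq]
  have h1 := hB.linVar_ge hc hc1 hν hη hcorr
  have h2 : c ^ 2 * s.quadVar ≤ s.quadVar :=
    mul_le_of_le_one_left hB.quadVar_nonneg (pow_le_one₀ hc.le hc1)
  have h3 := mul_le_mul_of_nonneg_left hV (sq_nonneg c)
  linarith

end MomentBound

end Bounds

end IVSample

/-! ### Convergence along the sequence -/

/-- Chebyshev's inequality for a ratio. -/
lemma CentredL2.measure_ratio_le {Ω : Type*} [MeasurableSpace Ω] {P : Measure Ω}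
    [IsProbabilityMeasure P] {F : Ω → ℝ} {V w v ε : ℝ} (h : CentredL2 P (fun ω => F ω - V) v)
    (hw : 0 < w) (hwV : w ≤ V) (hε : 0 < ε) :
    P {ω | ε ≤ |F ω / V - 1|} ≤ ENNReal.ofReal (v / (ε * w) ^ 2) := by
  have hV : 0 < V := hw.trans_le hwV
  have hsub : {ω | ε ≤ |F ω / V - 1|} ⊆ {ω | ε * w ≤ |(F ω - V) - ∫ ω', (F ω' - V) ∂P|} := by
    intro ω hω
    simp only [Set.mem_ofPred_eq] at hω ⊢
    rw [h.mean, sub_zero]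
    have e : F ω - V = V * (F ω / V - 1) := by field_simp
    rw [e, abs_mul, abs_of_pos hV, mul_comm ε]
    exact mul_le_mul hwV hω hε.le hV.le
  refine (measure_mono hsub).trans
    ((meas_ge_le_variance_div_sq h.memLp (mul_pos hε hw)).trans (ENNReal.ofReal_le_ofReal ?_))
  rw [variance_of_integral_eq_zero h.memLp.aemeasurable h.mean]
  exact div_le_div_of_nonneg_right h.sq_le (sq_nonneg _)

namespace IVSample

section Sequences

variable {Ω : ℕ → Type*} [∀ t, MeasurableSpace (Ω t)] {P : ∀ t, Measure (Ω t)} {N K L : ℕ → ℕ}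
  {s : ∀ t, IVSample (Ω t) (P t) (N t) (K t) (L t)}

lemma exists_wellPosed (h : LeaveThreeOutAssumption s) : ∃ δ, ∀ t, (s t).WellPosed δ := by
  obtain ⟨C, hC⟩ := h.bounded
  have hC0 : 0 < max C 1 := lt_max_of_lt_right one_pos
  refine ⟨(max C 1)⁻¹, fun t => wellPosed_of_le_D3 (inv_pos.2 hC0)
    (inv_le_one_of_one_le₀ (le_max_right _ _)) (h.invertible t) fun i j k hij hik hjk => ?_⟩
  have h3 := (s t).D3_pos (h.invertible t i j k) hij hik hjk
  exact inv_le_of_inv_le₀ h3 ((hC t i j k hij hjk (Ne.symm hik)).trans (le_max_left _ _))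

lemma exists_momentBound [∀ t, IsProbabilityMeasure (P t)] (h1 : MomentAssumption s)
    (h3 : SparsityAssumption s) : ∃ κ, ∀ t, (s t).MomentBound κ := by
  obtain ⟨C, hC⟩ := h1.moments
  obtain ⟨ρ, hρ⟩ := h3.bounded_R
  exact ⟨_, fun t => (s t).momentBound_of (fun i => (hC t i).1) (fun i => (hC t i).2.1)
    (fun i => (hC t i).2.2) (fun i => hρ t false i) fun i => hρ t true i⟩

/-- The column sums of `R_Δ` are controlled by the condition on products of two labels, applied to
the single factor `G_{ba}`. -/
lemma exists_sum_sq_colE_le (h3 : SparsityAssumption s) :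
    ∃ C, 0 ≤ C ∧ ∀ t, ∑ i, (s t).colE i ^ 2 ≤ C * (s t).r := by
  let h : HMonomial 2 :=
    { factors := [HFactor.G 1 0]
      valid := by simp [HFactor.Valid]
      occurs := by simp [HFactor.fst, HFactor.snd, Fin.forall_fin_two] }
  obtain ⟨C, hC⟩ := h3.two h
  refine ⟨max C 0, le_max_right _ _, fun t => ?_⟩
  have h1 := hC t true
  have e : ∀ i j, h.eval (s t) ![i, j] = (s t).G j i := fun i j => by
    simp [h, HMonomial.eval, HFactor.eval]
  simp only [e] at h1
  simp_rw [colE_eq]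
  refine h1.trans ((mul_le_mul_of_nonneg_right (le_max_left C 0)
    (Finset.sum_nonneg fun _ _ => sq_nonneg _)).trans
    (mul_le_mul_of_nonneg_left (s t).sum_sq_Rtilde_le (le_max_right _ _)))

/-- The variance of the statistic is at least of order `r`. -/
lemma exists_VLM_ge [∀ t, IsProbabilityMeasure (P t)] (h1 : MomentAssumption s) {κ : ℝ}
    (hB : ∀ t, (s t).MomentBound κ) :
    ∃ c, 0 < c ∧ ∀ t, 0 < (s t).r ∧ c * (s t).r ≤ (s t).VLM := by
  obtain ⟨c, hc, hnd⟩ := h1.nondegenerate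
  obtain ⟨c', hc', hV⟩ := h1.variance_bound 0 1 0 (by simp)
  have hc0 : 0 < min c 1 := lt_min hc one_pos
  refine ⟨min c 1 ^ 2 * c', by positivity, fun t => ?_⟩
  refine (hB t).VLM_ge hc0 (min_le_right _ _) (fun i => (min_le_left _ _).trans (hnd t i).1)
    (fun i => (min_le_left _ _).trans (hnd t i).2.1)
    (fun i => (hnd t i).2.2.trans (by linarith [min_le_left c 1])) hc' ?_
  have := hV t
  simp only [zero_mul, zero_add, one_mul, add_zero] at this
  rw [(hB t).variance_quad] at this
  simpa only [rowX_eq, colE_eq] using this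

end Sequences

end IVSample

theorem theorem2 {Ω : ℕ → Type*} [∀ t, MeasurableSpace (Ω t)]
    (P : ∀ t, Measure (Ω t)) [∀ t, IsProbabilityMeasure (P t)]
    (N K L : ℕ → ℕ) (hN : Tendsto N atTop atTop)
    (s : ∀ t, IVSample (Ω t) (P t) (N t) (K t) (L t)) (β₀ : ℕ → ℝ)
    (hnull : ∀ t, (s t).β = β₀ t)
    (h1 : MomentAssumption s) (h2 : LeaveThreeOutAssumption s) (h3 : SparsityAssumption s) :
    (∀ t, Integrable ((s t).VhatLM (β₀ t)) (P t) ∧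
      ∫ ω, (s t).VhatLM (β₀ t) ω ∂(P t) = (s t).VLM) ∧
    ∀ ε : ℝ, 0 < ε → Tendsto
      (fun t => P t {ω | ε ≤ |(s t).VhatLM (β₀ t) ω / (s t).VLM - 1|}) atTop (𝓝 0) := by
  obtain rfl : (fun t => (s t).β) = β₀ := funext hnull
  obtain ⟨δ, hδ⟩ := IVSample.exists_wellPosed h2
  obtain ⟨κ, hB⟩ := IVSample.exists_momentBound h1 h3
  obtain ⟨C, hC, hq⟩ := IVSample.exists_sum_sq_colE_le h3
  obtain ⟨c, hc, hV⟩ := IVSample.exists_VLM_ge h1 hB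
  have hcentred := fun t => (hB t).centredL2_VhatLM (hδ t)
  simp_rw [← fun t => (hB t).VLM_eq] at hcentred
  set A : ℝ := 88 * IVSample.leaveOutConst κ δ + 16 * IVSample.doubleOutConst κ δ with hA
  refine ⟨fun t => ?_, fun ε hε => ?_⟩
  · have h4 : Integrable (fun ω => (s t).VhatLM (s t).β ω) (P t) := by
      have := (hcentred t).integrable.add (integrable_const (s t).VLM)
      refine this.congr (Eventually.of_forall fun ω => ?_)
      simp
    refine ⟨h4, ?_⟩
    have h5 := (hcentred t).mean
    rw [integral_sub h4 (integrable_const _)] at h5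
    simp only [integral_const, probReal_univ, one_smul] at h5
    linarith
  · have hA0 : 0 ≤ A := by
      have hδ0 := (hδ 0).pos
      have hκ0 := (hB 0).nonneg
      rw [hA]
      unfold IVSample.leaveOutConst IVSample.doubleOutConst
      positivity
    set φ : ℕ → ℝ := fun t => frobNorm ((1 / (s t).r) • ((s t).Glower * (s t).Glower.transpose))
        + frobNorm ((1 / (s t).r) • ((s t).Gupper * (s t).Gupper.transpose)) with hφ
    set ψ : ℕ → ℝ := fun t => 1 / (s t).r ^ 2 * ∑ i,
      ((∑ j ∈ {i}ᶜ, (s t).G i j * (s t).R j) ^ 4 + (∑ j ∈ {i}ᶜ, (s t).G i j * (s t).RΔ j) ^ 4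
        + (∑ j ∈ {i}ᶜ, (s t).G j i * (s t).R j) ^ 4
        + (∑ j ∈ {i}ᶜ, (s t).G j i * (s t).RΔ j) ^ 4) with hψ
    have hφ0 : Tendsto φ atTop (𝓝 0) := h1.frobenius
    have hψ0 : Tendsto ψ atTop (𝓝 0) := h1.fourth_powers
    -- Chebyshev, with the variance of the estimator of smaller order than `r ^ 2` and `V_LM` at least
    -- of order `r`
    have hbound : ∀ t, P t {ω | ε ≤ |(s t).VhatLM (s t).β ω / (s t).VLM - 1|}
        ≤ ENNReal.ofReal (A / (ε * c) ^ 2 * (12 * φ t ^ 2 + ψ t + 4 * φ t * (1 + C))) := by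
      intro t
      obtain ⟨hr, hVr⟩ := hV t
      refine ((hcentred t).measure_ratio_le (mul_pos hc hr) hVr hε).trans
        (ENNReal.ofReal_le_ofReal ?_)
      have h6 := mul_le_mul_of_nonneg_left ((s t).errorBound_le hr (hq t) rfl) hA0
      rw [div_le_iff₀ (by positivity)]
      refine h6.trans_eq ?_
      simp only [hφ, hψ]
      field_simp
    have hlim : Tendsto (fun t => ENNReal.ofReal
        (A / (ε * c) ^ 2 * (12 * φ t ^ 2 + ψ t + 4 * φ t * (1 + C)))) atTop (𝓝 0) := by
      have h7 : Tendsto (fun t => A / (ε * c) ^ 2 * (12 * φ t ^ 2 + ψ t + 4 * φ t * (1 + C))) atTop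
          (𝓝 (A / (ε * c) ^ 2 * (12 * 0 ^ 2 + 0 + 4 * 0 * (1 + C)))) :=
        ((((hφ0.pow 2).const_mul 12).add hψ0).add ((hφ0.const_mul 4).mul_const (1 + C))).const_mul _
      have h8 := ENNReal.tendsto_ofReal h7
      simpa using h8
    exact tendsto_of_tendsto_of_tendsto_of_le_of_le tendsto_const_nhds hlim
      (fun _ => bot_le) hbound

end
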